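/- Let $\Omega\subset\mathbf R^2$ be a connected open set with smooth boundary such that: $\Omega$ is invariant under $(x,y)\mapsto(x+1,y)$; the sets $\Omega_n:=\Omega\cap([n,n+1]\times\mathbf R)$, $n\in\mathbf Z$, are bounded; the points $(n,0)$ lie in $\Omega$; and the vertical lines $\{n\}\times\mathbf R$ are nowhere tangent to $\partial\Omega$. Let $u$ be an eigenfunction of the Neumann Laplacian on $\Omega_0$, i.e. there is $E\in\mathbf R$ such that $0\ne u\in H^1(\Omega_0)$ and $\int_{\Omega_0}\overline{\nabla v}\cdot\nabla u=E\int_{\Omega_0}\bar v\,u$ for all $v\in H^1(\Omega_0)$; $u$ denotes the representative that is continuous on $\Omega_0$ (which includes the vertical segments $\Omega\cap(\{0,1\}\times\mathbf R)$). For $\varepsilon>0$ and $\theta\in\mathbf R$ put \[ u_{\theta,\varepsilon}(y):=u(0,y)-e^{i\theta}u(1,y),\quad y\in[-\varepsilon,\varepsilon],\qquad \langle f,g\rangle:=\int_{-\varepsilon}^{\varepsilon}\overline{f(y)}\,g(y)\,dy, \] let $X_\varepsilon$ be the Hilbert space of functions $\varphi$ with $\|\varphi\|_{X_\varepsilon}^2:=\int_{-\varepsilon}^{\varepsilon}\sqrt{\varepsilon^2-y^2}\,|\varphi(y)|^2\,dy<\infty$,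 let $Y_\varepsilon:=\{\psi\in C[-\varepsilon,\varepsilon]:\psi'\in X_\varepsilon\}$ (weak derivative), and let $L_\varepsilon f(x):=\int_{-\varepsilon}^{\varepsilon}\log|x-y|\,f(y)\,dy$. Then there are constants $\varepsilon_0\in(0,1)$ and $C,A>0$, depending only on $\Omega$ and $u$, such that for all $\varepsilon\in(0,\varepsilon_0)$ the operator $L_\varepsilon$ is a bijection from $X_\varepsilon$ onto $Y_\varepsilon$, and for all $\theta\in\mathbf R$ one has $u_{\theta,\varepsilon}\in Y_\varepsilon$, \[ \Big|\langle L_\varepsilon^{-1}u_{\theta,\varepsilon},u_{\theta,\varepsilon}\rangle-\frac{|u_{\theta,\varepsilon}(0)|^2}{\log\varepsilon}\Big|\le\frac{C}{|\log\varepsilon|^2}, \] and, for every bounded linear operator $B$ on $X_\varepsilon$, \[ \big|\langle BL_\varepsilon^{-1}u_{\theta,\varepsilon},u_{\theta,\varepsilon}\rangle\big|\le\frac{A\,\|B\|_{L(X_\varepsilon,X_\varepsilon)}}{|\log\varepsilon|}. \] -/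

import Mathlib

open MeasureTheory Set Filter Topology
open scoped ContDiff ComplexConjugate

noncomputable section

namespace CrackedWaveguide

/-- `F` is a smooth local defining function of `Ω` at the point `p`: near `p` the set `Ω` is
`{F < 0}`, and the differential of `F` at `p` is nonzero. -/
structure IsDefiningFunctionAt (Ω : Set (ℝ × ℝ)) (F : ℝ × ℝ → ℝ) (p : ℝ × ℝ) : Prop where
  smooth : ContDiff ℝ ∞ F
  local_eq : ∀ᶠ q in 𝓝 p, q ∈ Ω ↔ F q < 0
  fderiv_ne_zero : fderiv ℝ F p ≠ 0

/-- Connected smooth planar domains that are invariant under the shift `(x, y) ↦ (x + 1, y)`, have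
bounded cells `Ω ∩ ([n, n+1] × ℝ)`, contain the points `(n, 0)`, and whose boundary is nowhere
tangent to the vertical lines `{n} × ℝ` (i.e. the direction `(0, 1)` is not in the kernel of the
differential of a defining function at boundary points lying on these lines). -/
structure IsWaveguide (Ω : Set (ℝ × ℝ)) : Prop where
  isOpen : IsOpen Ω
  isConnected : IsConnected Ω
  shift_mem_iff : ∀ x y : ℝ, (x + 1, y) ∈ Ω ↔ (x, y) ∈ Ω
  bounded_cell : ∀ n : ℤ, Bornology.IsBounded (Ω ∩ Icc (n : ℝ) (n + 1) ×ˢ univ)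
  window_mem : ∀ n : ℤ, ((n : ℝ), (0 : ℝ)) ∈ Ω
  smooth_boundary : ∀ p ∈ frontier Ω, ∃ F : ℝ × ℝ → ℝ, IsDefiningFunctionAt Ω F p
  non_tangent : ∀ p ∈ frontier Ω, (∃ n : ℤ, p.1 = n) →
    ∀ F : ℝ × ℝ → ℝ, IsDefiningFunctionAt Ω F p → fderiv ℝ F p (0, 1) ≠ 0

/-- The elementary cell `Ω ∩ ([0, 1] × ℝ)`; it contains the parts of the two vertical segments lying
in `Ω`. -/
def cell (Ω : Set (ℝ × ℝ)) : Set (ℝ × ℝ) := Ω ∩ Icc 0 1 ×ˢ univ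

/-- The open elementary cell `Ω ∩ ((0, 1) × ℝ)`. -/
def openCell (Ω : Set (ℝ × ℝ)) : Set (ℝ × ℝ) := Ω ∩ Ioo 0 1 ×ˢ univ

/-- `u` belongs to the Sobolev space `H¹(U)` and `(g₁, g₂)` is its weak gradient in `U`. -/
structure HasH1Gradient (U : Set (ℝ × ℝ)) (u g₁ g₂ : ℝ × ℝ → ℂ) : Prop where
  memLp : MemLp u 2 (volume.restrict U)
  memLp_fst : MemLp g₁ 2 (volume.restrict U)
  memLp_snd : MemLp g₂ 2 (volume.restrict U)
  weak_fst : ∀ φ : ℝ × ℝ → ℂ, ContDiff ℝ ∞ φ → HasCompactSupport φ → tsupport φ ⊆ U →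
    ∫ p in U, u p * fderiv ℝ φ p (1, 0) = -∫ p in U, g₁ p * φ p
  weak_snd : ∀ φ : ℝ × ℝ → ℂ, ContDiff ℝ ∞ φ → HasCompactSupport φ → tsupport φ ⊆ U →
    ∫ p in U, u p * fderiv ℝ φ p (0, 1) = -∫ p in U, g₂ p * φ p

/-- `u` is an eigenfunction, with eigenvalue `E`, of the Neumann Laplacian on `L²(U)`, the
self-adjoint operator of the form `∫ ∇v̄ · ∇u` with form domain `H¹(U)`. -/
def IsNeumannEigenfunction (U : Set (ℝ × ℝ)) (E : ℝ) (u : ℝ × ℝ → ℂ) : Prop :=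
  (¬ u =ᵐ[volume.restrict U] 0) ∧
  ∃ g₁ g₂ : ℝ × ℝ → ℂ, HasH1Gradient U u g₁ g₂ ∧
    ∀ v h₁ h₂ : ℝ × ℝ → ℂ, HasH1Gradient U v h₁ h₂ →
      ∫ p in U, (conj (h₁ p) * g₁ p + conj (h₂ p) * g₂ p) = E * ∫ p in U, conj (v p) * u p

/-- The measure `√(ε² - y²) dy` on `[-ε, ε]`. -/
def weightMeasure (ε : ℝ) : Measure ℝ :=
  (volume.restrict (Icc (-ε) ε)).withDensity fun y => ENNReal.ofReal (Real.sqrt (ε ^ 2 - y ^ 2))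

/-- The Hilbert space `X_ε` of functions with `∫_{-ε}^{ε} √(ε² - y²) |φ(y)|² dy < ∞`. -/
abbrev X (ε : ℝ) : Type := Lp ℂ 2 (weightMeasure ε)

/-- The space `Y_ε` of continuous functions on `[-ε, ε]` whose derivative lies in `X_ε`
(elements of `X_ε` are Lebesgue integrable on `[-ε, ε]`, so having the weak derivative `g ∈ X_ε`
means being a primitive of `g`). -/
def Y (ε : ℝ) : Set (Icc (-ε) ε → ℂ) :=
  {ψ | Continuous ψ ∧
    ∃ g : X ε, ∀ x y : Icc (-ε) ε, ψ y - ψ x = ∫ t in (x : ℝ)..(y : ℝ), g t}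

/-- The integral operator `L_ε` with kernel `log |x - y|` on `[-ε, ε]`. -/
def L (ε : ℝ) (f : X ε) : Icc (-ε) ε → ℂ :=
  fun x => ∫ y in (-ε)..ε, (Real.log |(x : ℝ) - y| : ℂ) * f y

/-- The inverse of `L_ε : X_ε → Y_ε`. It is meaningful when `L_ε` is a bijection onto `Y_ε`. -/
def Linv (ε : ℝ) (ψ : Icc (-ε) ε → ℂ) : X ε := Function.invFunOn (L ε) univ ψ

/-- The (unweighted) scalar product of `L²[-ε, ε]`, conjugate-linear in the first argument. -/
def pairing (ε : ℝ) (f g : ℝ → ℂ) : ℂ := ∫ y in (-ε)..ε, conj (f y) * g y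

/-- The function `u_θ(y) = u(0, y) - e^{iθ} u(1, y)`. -/
def uTheta (u : ℝ × ℝ → ℂ) (θ : ℝ) (y : ℝ) : ℂ :=
  u (0, y) - Complex.exp (Complex.I * θ) * u (1, y)

/-- The function `u_{θ,ε}`: the restriction of `u_θ` to `[-ε, ε]`. -/
def uThetaRestrict (u : ℝ × ℝ → ℂ) (θ ε : ℝ) : Icc (-ε) ε → ℂ := fun y => uTheta u θ y

end CrackedWaveguide

end

open MeasureTheory Set Filter Topology
open scoped ContDiff ComplexConjugate

noncomputable section

namespace CrackedWaveguide

/-! Two facts carry the proof: `L ε` is explicitly diagonal in Chebyshev bases, and the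
eigenfunction is Lipschitz along the two windows.

Diagonalization. One has log|x - y| = log(ε/2) - Σ_{n≥1} (2/n) T_n(x/ε) T_n(y/ε). Up to
normalization, the functions T_n(y/ε)/√(ε² - y²) form an orthonormal basis of `X ε`, and so do the
functions U_n(y/ε). Since T_n' = n U_{n-1}, the U-coefficients of (L f)' are the T-coefficients of
f, shifted by one and multiplied by -π (`L_sub_eq_integral`). All modes n ≥ 1 of f are therefore
controlled by the derivative of L f, with constants independent of ε. Only the mode n = 0 feels the
size of the interval, through the factor log(ε/2), which is nonzero for ε < 2. This gives
bijectivity (`bijOn_L`) and a norm bound for the inverse (`exists_L_eq`).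

Asymptotics. The constant c has the preimage c / (π log(ε/2) √(ε² - y²)), whose pairing with c is
|c|²/log(ε/2). A Lipschitz function vanishing at 0 has a derivative of norm O(ε) in `X ε`, hence a
preimage of norm O(ε). Both ε and the change from log(ε/2) to log ε cost only O(1/log² ε)
(`estimates_of_lipschitz`).

Regularity. Near a window the cell is a half-plane. A cut-off regularized logarithm v with pole at a
boundary point (c, t) has zero normal derivative on the flat side, so ∫ u (Δv + E v) = 0 although v
does not vanish there. As the regularization δ tends to 0, one part of Δv concentrates at the pole
and produces a positive multiple of u(c, t). The remaining part moves in L¹ by at most a constant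
times |t - s| when the pole moves from t to s, uniformly in δ. Hence u(c, ·) is Lipschitz
(`exists_lipschitz_boundary`). Since |e^{iθ}| = 1, every constant is uniform in θ. -/

/-! ### The weighted space `X ε` and integration against bounded functions -/

/-- The weight `√(ε² - y²)`. -/
def weight (ε y : ℝ) : ℝ := Real.sqrt (ε ^ 2 - y ^ 2)

lemma continuous_weight (ε : ℝ) : Continuous (weight ε) := by
  unfold weight; fun_prop

lemma weight_nonneg (ε y : ℝ) : 0 ≤ weight ε y := Real.sqrt_nonneg _

lemma weight_pos {ε y : ℝ} (hy : y ∈ Ioo (-ε) ε) : 0 < weight ε y :=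
  Real.sqrt_pos.2 (by nlinarith [hy.1, hy.2])

lemma weight_le {ε : ℝ} (hε : 0 ≤ ε) (y : ℝ) : weight ε y ≤ ε :=
  (Real.sqrt_le_left hε).2 (by nlinarith [sq_nonneg y])

lemma ae_mem_Ioo (ε : ℝ) : ∀ᵐ y ∂volume.restrict (Icc (-ε) ε), y ∈ Ioo (-ε) ε := by
  rw [← restrict_Ioo_eq_restrict_Icc]
  exact ae_restrict_mem measurableSet_Ioo

lemma weight_ne_zero_ae (ε : ℝ) : ∀ᵐ y ∂volume.restrict (Icc (-ε) ε), weight ε y ≠ 0 := by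
  filter_upwards [ae_mem_Ioo ε] with y hy using (weight_pos hy).ne'

lemma weightMeasure_absolutelyContinuous (ε : ℝ) :
    weightMeasure ε ≪ volume.restrict (Icc (-ε) ε) :=
  withDensity_absolutelyContinuous _ _

/-- The weight vanishes only at the endpoints, so both measures have the same null sets.
Almost-everywhere identities for representatives in `X ε` thereby pass to Lebesgue measure. -/
lemma absolutelyContinuous_weightMeasure (ε : ℝ) :
    volume.restrict (Icc (-ε) ε) ≪ weightMeasure ε := by
  refine withDensity_absolutelyContinuous' ?_ ?_
  · exact (continuous_weight ε).measurable.ennreal_ofReal.aemeasurable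
  · filter_upwards [ae_mem_Ioo ε] with y hy
    simpa [weight] using weight_pos hy

lemma integrable_weightMeasure_iff {ε : ℝ} {h : ℝ → ℂ} :
    Integrable h (weightMeasure ε) ↔
      Integrable (fun y => (weight ε y : ℂ) * h y) (volume.restrict (Icc (-ε) ε)) := by
  change Integrable h ((volume.restrict (Icc (-ε) ε)).withDensity
    fun y => ENNReal.ofReal (weight ε y)) ↔ _
  rw [integrable_withDensity_iff_integrable_smul'
    (continuous_weight ε).measurable.ennreal_ofReal (by simp)]
  refine integrable_congr (Eventually.of_forall fun y => ?_)
  simp [ENNReal.toReal_ofReal (weight_nonneg ε y)]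

lemma integral_weightMeasure {ε : ℝ} (hε : 0 ≤ ε) (h : ℝ → ℂ) :
    ∫ y, h y ∂weightMeasure ε = ∫ y in (-ε)..ε, (weight ε y : ℂ) * h y := by
  change ∫ y, h y ∂((volume.restrict (Icc (-ε) ε)).withDensity
    fun y => ENNReal.ofReal (weight ε y)) = _
  rw [integral_withDensity_eq_integral_toReal_smul
    (continuous_weight ε).measurable.ennreal_ofReal (by simp),
    intervalIntegral.integral_of_le (by linarith), ← integral_Icc_eq_integral_Ioc]
  refine integral_congr_ae (Eventually.of_forall fun y => ?_)
  simp [ENNReal.toReal_ofReal (weight_nonneg ε y)]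

instance isFiniteMeasure_weightMeasure (ε : ℝ) : IsFiniteMeasure (weightMeasure ε) := by
  have h : Integrable (fun _ : ℝ => (1 : ℂ)) (weightMeasure ε) := by
    rw [integrable_weightMeasure_iff]
    exact (((Complex.continuous_ofReal.comp (continuous_weight ε)).mul
      continuous_const).continuousOn.integrableOn_compact isCompact_Icc)
  exact (integrable_const_iff_isFiniteMeasure (by norm_num)).1 h

lemma weight_eq_mul {ε : ℝ} (hε : 0 < ε) (y : ℝ) :
    weight ε y = ε * Real.sqrt (1 - (y / ε) ^ 2) := by
  have h : ε ^ 2 - y ^ 2 = ε ^ 2 * (1 - (y / ε) ^ 2) := by field_simp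
  rw [weight, h, Real.sqrt_mul (sq_nonneg ε), Real.sqrt_sq hε.le]

/-- The measure dy/√(ε² - y²) is scale invariant: y = εz turns it into the Chebyshev measure. This
is why the constants below do not depend on ε. -/
lemma integral_div_weight {ε : ℝ} (hε : 0 < ε) (h : ℝ → ℝ) :
    ∫ y in (-ε)..ε, h (y / ε) / weight ε y = ∫ z, h z ∂Polynomial.Chebyshev.measureT := by
  rw [Polynomial.Chebyshev.integral_measureT]
  have := intervalIntegral.integral_comp_div (a := -ε) (b := ε)
    (fun z => h z * √(1 - z ^ 2)⁻¹) hε.ne'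
  rw [neg_div, div_self hε.ne'] at this
  rw [← inv_smul_eq_iff₀ hε.ne', ← intervalIntegral.integral_smul] at this
  rw [← this]
  refine intervalIntegral.integral_congr fun y _ => ?_
  simp only [weight_eq_mul hε, Real.sqrt_inv, smul_eq_mul]
  rw [div_eq_mul_inv, mul_inv]; ring

lemma integrable_inv_weight {ε : ℝ} (hε : 0 < ε) :
    Integrable (fun y => (weight ε y)⁻¹) (volume.restrict (Icc (-ε) ε)) := by
  have h := Polynomial.Chebyshev.intervalIntegrable_sqrt_one_sub_sq_inv.comp_mul_left (c := ε⁻¹)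
  have h2 := (h.const_mul ε⁻¹)
  rw [show (-1 : ℝ) / ε⁻¹ = -ε by field_simp, show (1 : ℝ) / ε⁻¹ = ε by field_simp,
    intervalIntegrable_iff_integrableOn_Icc_of_le (by linarith)] at h2
  refine h2.congr (Eventually.of_forall fun y => ?_)
  simp only [weight_eq_mul hε, Real.sqrt_inv, mul_inv]
  rw [inv_mul_eq_div ε y]

/-- The weighted square is weight · |k/weight|² = |k|²/weight, and 1/weight is integrable. -/
lemma memLp_div_weight {ε C : ℝ} (hε : 0 < ε) {k : ℝ → ℂ}
    (hk : AEStronglyMeasurable k (volume.restrict (Icc (-ε) ε)))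
    (hC : ∀ y ∈ Icc (-ε) ε, ‖k y‖ ≤ C) :
    MemLp (fun y => k y / weight ε y) 2 (weightMeasure ε) := by
  have hm : AEStronglyMeasurable (fun y => k y / weight ε y)
      (volume.restrict (Icc (-ε) ε)) := by
    refine (hk.aemeasurable.div ?_).aestronglyMeasurable
    exact (Complex.continuous_ofReal.comp (continuous_weight ε)).measurable.aemeasurable
  rw [memLp_two_iff_integrable_sq_norm (hm.mono_ac (weightMeasure_absolutelyContinuous ε))]
  have key : Integrable (fun y => ((‖k y / weight ε y‖ ^ 2 : ℝ) : ℂ)) (weightMeasure ε) := by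
    rw [integrable_weightMeasure_iff]
    refine Integrable.mono' ((integrable_inv_weight hε).const_mul (C ^ 2)) ?_ ?_
    · exact ((Complex.continuous_ofReal.comp (continuous_weight ε)).aestronglyMeasurable).mul
        (Complex.continuous_ofReal.comp_aestronglyMeasurable (hm.norm.pow 2))
    · filter_upwards [ae_mem_Ioo ε] with y hy
      have h1 := hC y (Ioo_subset_Icc_self hy)
      have h2 := weight_pos hy
      rw [norm_mul, Complex.norm_real, Complex.norm_real, norm_div, Complex.norm_real,
        Real.norm_of_nonneg h2.le, Real.norm_of_nonneg (by positivity)]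
      have h3 : ‖k y‖ ^ 2 ≤ C ^ 2 := by gcongr
      calc weight ε y * (‖k y‖ / weight ε y) ^ 2 = ‖k y‖ ^ 2 * (weight ε y)⁻¹ := by
            field_simp
        _ ≤ _ := by gcongr
  refine key.re.congr (Eventually.of_forall fun y => ?_)
  exact Complex.ofReal_re _

/-- The element `k / √(ε² - y²)` of `X ε`, which represents the functional `f ↦ ∫ k̄ f`. -/
def divWeight {ε : ℝ} (k : ℝ → ℂ)
    (hk : MemLp (fun y => k y / weight ε y) 2 (weightMeasure ε)) : X ε :=
  hk.toLp _

lemma coeFn_divWeight {ε : ℝ} {k : ℝ → ℂ}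
    (hk : MemLp (fun y => k y / weight ε y) 2 (weightMeasure ε)) :
    ⇑(divWeight k hk) =ᵐ[volume.restrict (Icc (-ε) ε)] fun y => k y / weight ε y :=
  (absolutelyContinuous_weightMeasure ε).ae_le hk.coeFn_toLp

lemma inner_eq_integral {ε : ℝ} (hε : 0 ≤ ε) (f g : X ε) :
    inner ℂ f g = ∫ y in (-ε)..ε, (weight ε y : ℂ) * (conj (f y) * g y) := by
  rw [L2.inner_def, integral_weightMeasure hε]
  simp [mul_comm]

lemma intervalIntegral_congr_ae_Icc {ε : ℝ} (hε : 0 ≤ ε) {f g : ℝ → ℂ}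
    (h : f =ᵐ[volume.restrict (Icc (-ε) ε)] g) :
    ∫ y in (-ε)..ε, f y = ∫ y in (-ε)..ε, g y := by
  rw [intervalIntegral.integral_of_le (by linarith), intervalIntegral.integral_of_le (by linarith),
    ← integral_Icc_eq_integral_Ioc, ← integral_Icc_eq_integral_Ioc]
  exact integral_congr_ae h

/-- The weight in the scalar product cancels the denominator. Unweighted integrals thus become
scalar products in `X ε`; this is applied to constants, Chebyshev polynomials, indicators and the
logarithmic kernel. -/
lemma inner_eq_integral_of_ae_eq {ε : ℝ} (hε : 0 ≤ ε) {F : X ε} {k : ℝ → ℂ}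
    (hF : ⇑F =ᵐ[volume.restrict (Icc (-ε) ε)] fun y => k y / weight ε y) (f : X ε) :
    inner ℂ F f = ∫ y in (-ε)..ε, conj (k y) * f y := by
  rw [inner_eq_integral hε]
  refine intervalIntegral_congr_ae_Icc hε ?_
  filter_upwards [hF, weight_ne_zero_ae ε] with y hy hw
  rw [hy, map_div₀, Complex.conj_ofReal]
  have : (weight ε y : ℂ) ≠ 0 := by exact_mod_cast hw
  field_simp

lemma integrable_mul_of_memLp_div_weight {ε : ℝ} {k : ℝ → ℂ}
    (hk : MemLp (fun y => k y / weight ε y) 2 (weightMeasure ε)) (f : X ε) :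
    Integrable (fun y => k y * f y) (volume.restrict (Icc (-ε) ε)) := by
  have h : Integrable (fun y => (k y / weight ε y) * f y) (weightMeasure ε) :=
    hk.integrable_mul (Lp.memLp f)
  rw [integrable_weightMeasure_iff] at h
  refine h.congr ?_
  filter_upwards [weight_ne_zero_ae ε] with y hw
  have : (weight ε y : ℂ) ≠ 0 := by exact_mod_cast hw
  field_simp

lemma memLp_one_div_weight {ε : ℝ} (hε : 0 < ε) :
    MemLp (fun y => (1 : ℂ) / weight ε y) 2 (weightMeasure ε) :=
  memLp_div_weight (k := fun _ => 1) (C := 1) hε aestronglyMeasurable_const (by simp)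

lemma integrable_coeFn {ε : ℝ} (hε : 0 < ε) (f : X ε) :
    Integrable f (volume.restrict (Icc (-ε) ε)) := by
  simpa using integrable_mul_of_memLp_div_weight (k := fun _ => 1) (memLp_one_div_weight hε) f

/-- Cauchy-Schwarz; √π is the norm of 1/weight in `X ε`, since the Chebyshev measure has mass π. -/
lemma norm_integral_mul_le {ε C : ℝ} (hε : 0 < ε) {k : ℝ → ℂ}
    (hk : AEStronglyMeasurable k (volume.restrict (Icc (-ε) ε)))
    (hC : ∀ y ∈ Icc (-ε) ε, ‖k y‖ ≤ C) (f : X ε) :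
    ‖∫ y in (-ε)..ε, conj (k y) * f y‖ ≤ C * Real.sqrt Real.pi * ‖f‖ := by
  have hk' := memLp_div_weight hε hk hC
  rw [← inner_eq_integral_of_ae_eq hε.le (coeFn_divWeight hk') f]
  refine (norm_inner_le_norm _ _).trans ?_
  gcongr
  have h0 : ∀ᵐ y ∂weightMeasure ε, y ∈ Ioo (-ε) ε :=
    (weightMeasure_absolutelyContinuous ε).ae_le (ae_mem_Ioo ε)
  refine (Lp.norm_le_mul_norm_of_ae_le_mul (g := divWeight _ (memLp_one_div_weight hε))
    (c := C) ?_).trans ?_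
  · filter_upwards [hk'.coeFn_toLp, (memLp_one_div_weight hε).coeFn_toLp, h0] with y h1 h2 hy
    rw [divWeight, divWeight, h1, h2, norm_div, norm_div, norm_one, mul_one_div]
    gcongr
    exact hC y (Ioo_subset_Icc_self hy)
  · have hC0 : 0 ≤ C := (norm_nonneg _).trans (hC 0 ⟨by linarith, hε.le⟩)
    gcongr
    apply Real.le_sqrt_of_sq_le
    rw [← inner_self_eq_norm_sq (𝕜 := ℂ), inner_eq_integral_of_ae_eq hε.le
      (coeFn_divWeight (memLp_one_div_weight hε)), intervalIntegral_congr_ae_Icc hε.le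
      (g := fun y => (((1 : ℝ) / weight ε y : ℝ) : ℂ)), intervalIntegral.integral_ofReal,
      integral_div_weight hε (fun _ => 1)]
    · have := Polynomial.Chebyshev.integral_eval_T_real_measureT_zero
      simp only [Polynomial.Chebyshev.T_zero, Polynomial.eval_one] at this
      rw [this]; simp
    · filter_upwards [coeFn_divWeight (memLp_one_div_weight hε)] with y hy
      rw [hy]; simp

/-! ### The two orthonormal Chebyshev bases of `X ε` -/

lemma intervalIntegrable_of_integrable_Icc {ε : ℝ} (hε : 0 ≤ ε) {h : ℝ → ℂ}
    (hh : Integrable h (volume.restrict (Icc (-ε) ε))) : IntervalIntegrable h volume (-ε) ε := by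
  rw [intervalIntegrable_iff_integrableOn_Icc_of_le (by linarith)]
  exact hh

lemma integral_polynomial_mul_eq_zero {ε : ℝ} (hε : 0 < ε) {h : ℝ → ℂ}
    (hh : Integrable h (volume.restrict (Icc (-ε) ε)))
    (h0 : ∀ n : ℕ, ∫ y in (-ε)..ε, (((y / ε) ^ n : ℝ) : ℂ) * h y = 0) (p : Polynomial ℝ) :
    ∫ y in (-ε)..ε, ((p.eval y : ℝ) : ℂ) * h y = 0 := by
  have hi := intervalIntegrable_of_integrable_Icc hε.le hh
  induction p using Polynomial.induction_on' with
  | add p q hp hq =>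
    simp only [Polynomial.eval_add, Complex.ofReal_add, add_mul]
    rw [intervalIntegral.integral_add, hp, hq, add_zero]
    · exact hi.continuousOn_mul (Complex.continuous_ofReal.comp p.continuous).continuousOn
    · exact hi.continuousOn_mul (Complex.continuous_ofReal.comp q.continuous).continuousOn
  | monomial n a =>
    have : ∀ y, (((Polynomial.monomial n a).eval y : ℝ) : ℂ) * h y
        = ((a * ε ^ n : ℝ) : ℂ) * ((((y / ε) ^ n : ℝ) : ℂ) * h y) := by
      intro y
      rw [Polynomial.eval_monomial, ← mul_assoc, ← Complex.ofReal_mul]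
      congr 2
      rw [div_pow]
      field_simp
    simp only [this]
    rw [intervalIntegral.integral_const_mul, h0, mul_zero]

/-- Vanishing moments annihilate polynomials, hence continuous functions by Weierstrass, and smooth
test functions already detect a locally integrable function. -/
lemma ae_eq_zero_of_integral_pow_mul_eq_zero {ε : ℝ} (hε : 0 < ε) {h : ℝ → ℂ}
    (hh : Integrable h (volume.restrict (Icc (-ε) ε)))
    (h0 : ∀ n : ℕ, ∫ y in (-ε)..ε, (((y / ε) ^ n : ℝ) : ℂ) * h y = 0) :
    h =ᵐ[volume.restrict (Icc (-ε) ε)] 0 := by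
  have hpoly := integral_polynomial_mul_eq_zero hε hh h0
  have hi := intervalIntegrable_of_integrable_Icc hε.le hh
  have hcont : ∀ φ : ℝ → ℝ, Continuous φ → ∫ y in (-ε)..ε, (φ y : ℂ) * h y = 0 := by
    intro φ hφ
    rw [← norm_le_zero_iff]
    refine le_of_forall_pos_le_add fun δ hδ => ?_
    set N : ℝ := ∫ y in (-ε)..ε, ‖h y‖ with hN
    have hN0 : 0 ≤ N := intervalIntegral.integral_nonneg (by linarith) fun _ _ => norm_nonneg _
    -- With N the L¹ norm of `h`, accuracy δ/(N + 1) makes the error at most δ even when N = 0.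
    obtain ⟨p, hp⟩ := exists_polynomial_near_of_continuousOn (-ε) ε φ hφ.continuousOn
      (δ / (N + 1)) (by positivity)
    have hsub : ∫ y in (-ε)..ε, (φ y : ℂ) * h y
        = ∫ y in (-ε)..ε, ((φ y - p.eval y : ℝ) : ℂ) * h y := by
      have : ∀ y, ((φ y - p.eval y : ℝ) : ℂ) * h y = (φ y : ℂ) * h y - ((p.eval y : ℝ) : ℂ) * h y := by
        intro y; push_cast; ring
      simp only [this]
      rw [intervalIntegral.integral_sub, hpoly p, sub_zero]
      · exact hi.continuousOn_mul (Complex.continuous_ofReal.comp hφ).continuousOn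
      · exact hi.continuousOn_mul (Complex.continuous_ofReal.comp p.continuous).continuousOn
    rw [hsub, zero_add]
    calc ‖∫ y in (-ε)..ε, ((φ y - p.eval y : ℝ) : ℂ) * h y‖
        ≤ ∫ y in (-ε)..ε, δ / (N + 1) * ‖h y‖ := by
          refine intervalIntegral.norm_integral_le_of_norm_le (by linarith) ?_
            (hi.norm.const_mul _)
          refine Eventually.of_forall fun y hy => ?_
          rw [norm_mul, Complex.norm_real, Real.norm_eq_abs, abs_sub_comm]
          gcongr
          exact (hp y (Ioc_subset_Icc_self hy)).le
      _ = δ / (N + 1) * N := by rw [intervalIntegral.integral_const_mul]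
      _ ≤ δ := by
          rw [div_mul_eq_mul_div, div_le_iff₀ (by positivity)]
          nlinarith
  have hind : Integrable ((Icc (-ε) ε).indicator h) :=
    (integrable_indicator_iff measurableSet_Icc).2 hh
  have := ae_eq_zero_of_integral_contDiff_smul_eq_zero hind.locallyIntegrable ?_
  · rw [EventuallyEq, ae_restrict_iff' measurableSet_Icc]
    filter_upwards [this] with y hy hmem
    simpa [hmem] using hy
  · intro g hg _
    have h1 : ∀ y, g y • (Icc (-ε) ε).indicator h y
        = (Icc (-ε) ε).indicator (fun y => (g y : ℂ) * h y) y := by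
      intro y
      by_cases hy : y ∈ Icc (-ε) ε <;> simp [hy]
    simp only [h1]
    rw [integral_indicator measurableSet_Icc, integral_Icc_eq_integral_Ioc,
      ← intervalIntegral.integral_of_le (by linarith)]
    exact hcont g hg.continuous

/-- The three-term recurrence trades a factor z for neighbouring indices, so orthogonality to all `P
n` forces all moments to vanish. The parameter `a` covers T_1 = z (a = 1) and U_1 = 2z (a = 1/2)
together. -/
lemma ae_eq_zero_of_integral_recurrence_eq_zero {ε a : ℝ} (hε : 0 < ε) {h : ℝ → ℂ}
    (hh : Integrable h (volume.restrict (Icc (-ε) ε))) {P : ℕ → ℝ → ℝ}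
    (hP : ∀ n, Continuous (P n)) (hP0 : ∀ z, P 0 z = 1) (hP1 : ∀ z, z * P 0 z = a * P 1 z)
    (hrec : ∀ n z, z * P (n + 1) z = (P (n + 2) z + P n z) / 2)
    (h0 : ∀ n : ℕ, ∫ y in (-ε)..ε, (P n (y / ε) : ℂ) * h y = 0) :
    h =ᵐ[volume.restrict (Icc (-ε) ε)] 0 := by
  have hi := intervalIntegrable_of_integrable_Icc hε.le hh
  have hint : ∀ k n : ℕ, IntervalIntegrable
      (fun y => (((y / ε) ^ k * P n (y / ε) : ℝ) : ℂ) * h y) volume (-ε) ε := fun k n =>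
    hi.continuousOn_mul (Complex.continuous_ofReal.comp
      (((continuous_id.div_const ε).pow k).mul ((hP n).comp
        (continuous_id.div_const ε)))).continuousOn
  -- Induction on k must hold for all n at once, because the recurrence moves n in both directions.
  have key : ∀ k n : ℕ, ∫ y in (-ε)..ε, (((y / ε) ^ k * P n (y / ε) : ℝ) : ℂ) * h y = 0 := by
    intro k
    induction k with
    | zero => intro n; simpa using h0 n
    | succ k ih =>
      rintro (_ | n)
      · have : ∀ y, (((y / ε) ^ (k + 1) * P 0 (y / ε) : ℝ) : ℂ) * h y
            = (a : ℂ) * ((((y / ε) ^ k * P 1 (y / ε) : ℝ) : ℂ) * h y) := by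
          intro y
          rw [pow_succ, mul_assoc, hP1]; push_cast; ring
        simp only [this]
        rw [intervalIntegral.integral_const_mul, ih, mul_zero]
      · have : ∀ y, (((y / ε) ^ (k + 1) * P (n + 1) (y / ε) : ℝ) : ℂ) * h y
            = (1 / 2 : ℂ) * ((((y / ε) ^ k * P (n + 2) (y / ε) : ℝ) : ℂ) * h y)
              + (1 / 2 : ℂ) * ((((y / ε) ^ k * P n (y / ε) : ℝ) : ℂ) * h y) := by
          intro y
          rw [pow_succ, mul_assoc, hrec]; push_cast; ring
        simp only [this]
        rw [intervalIntegral.integral_add ((hint _ _).const_mul _) ((hint _ _).const_mul _),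
          intervalIntegral.integral_const_mul, intervalIntegral.integral_const_mul, ih, ih]
        simp
  refine ae_eq_zero_of_integral_pow_mul_eq_zero hε hh fun n => ?_
  simpa [hP0] using key n 0

open Polynomial in
lemma eval_T_recurrence (n : ℕ) (z : ℝ) :
    z * (Chebyshev.T ℝ ((n + 1 : ℕ) : ℤ)).eval z
      = ((Chebyshev.T ℝ ((n + 2 : ℕ) : ℤ)).eval z + (Chebyshev.T ℝ (n : ℤ)).eval z) / 2 := by
  push_cast
  rw [Chebyshev.T_add_two]
  simp; ring

open Polynomial in
lemma eval_U_recurrence (n : ℕ) (z : ℝ) :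
    z * (Chebyshev.U ℝ ((n + 1 : ℕ) : ℤ)).eval z
      = ((Chebyshev.U ℝ ((n + 2 : ℕ) : ℤ)).eval z + (Chebyshev.U ℝ (n : ℤ)).eval z) / 2 := by
  push_cast
  rw [Chebyshev.U_add_two]
  simp; ring

/-- The Chebyshev polynomial of the first kind rescaled to `[-ε, ε]`. -/
def chebT (ε : ℝ) (n : ℕ) (y : ℝ) : ℝ := (Polynomial.Chebyshev.T ℝ (n : ℤ)).eval (y / ε)

/-- The Chebyshev polynomial of the second kind rescaled to `[-ε, ε]`. -/
def chebU (ε : ℝ) (n : ℕ) (y : ℝ) : ℝ := (Polynomial.Chebyshev.U ℝ (n : ℤ)).eval (y / ε)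

lemma continuous_chebT (ε : ℝ) (n : ℕ) : Continuous (chebT ε n) :=
  (Polynomial.continuous _).comp (continuous_id.div_const ε)

lemma continuous_chebU (ε : ℝ) (n : ℕ) : Continuous (chebU ε n) :=
  (Polynomial.continuous _).comp (continuous_id.div_const ε)

lemma abs_chebT_le_one {ε : ℝ} (hε : 0 < ε) (n : ℕ) {y : ℝ} (hy : y ∈ Icc (-ε) ε) :
    |chebT ε n y| ≤ 1 := by
  refine Polynomial.Chebyshev.abs_eval_T_real_le_one _ ?_
  rw [abs_div, abs_of_pos hε, div_le_one hε, abs_le]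
  exact hy

lemma hasDerivAt_chebT (ε : ℝ) (n : ℕ) (y : ℝ) :
    HasDerivAt (chebT ε (n + 1)) ((n + 1) * chebU ε n y / ε) y := by
  have h := ((Polynomial.Chebyshev.T ℝ ((n + 1 : ℕ) : ℤ)).hasDerivAt (y / ε)).comp y
    ((hasDerivAt_id y).div_const ε)
  rw [Polynomial.Chebyshev.T_derivative_eq_U] at h
  convert! h using 1
  simp [chebU]
  ring

/-- The normalization constant of `T_n` in `L²(dz / √(1 - z²))`. -/
def normT (n : ℕ) : ℝ := if n = 0 then (Real.sqrt Real.pi)⁻¹ else Real.sqrt (2 / Real.pi)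

lemma normT_pos (n : ℕ) : 0 < normT n := by
  unfold normT
  have := Real.pi_pos
  split_ifs <;> positivity

lemma normT_succ (n : ℕ) : normT (n + 1) = Real.sqrt (2 / Real.pi) := by simp [normT]

lemma memLp_basisT {ε : ℝ} (hε : 0 < ε) (n : ℕ) :
    MemLp (fun y => ((normT n * chebT ε n y : ℝ) : ℂ) / weight ε y) 2 (weightMeasure ε) := by
  refine memLp_div_weight (C := normT n) hε ?_ fun y hy => ?_
  · exact (Complex.continuous_ofReal.comp
      (continuous_const.mul (continuous_chebT ε n))).aestronglyMeasurable
  · rw [Complex.norm_real, norm_mul, Real.norm_of_nonneg (normT_pos n).le]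
    exact mul_le_of_le_one_right (normT_pos n).le (abs_chebT_le_one hε n hy)

/-- The normalized functions `T_n(y/ε) / √(ε² - y²)`. -/
def vecT {ε : ℝ} (hε : 0 < ε) (n : ℕ) : X ε := divWeight _ (memLp_basisT hε n)

lemma inner_vecT {ε : ℝ} (hε : 0 < ε) (n : ℕ) (f : X ε) :
    inner ℂ (vecT hε n) f = ∫ y in (-ε)..ε, ((normT n * chebT ε n y : ℝ) : ℂ) * f y := by
  rw [vecT, inner_eq_integral_of_ae_eq hε.le (coeFn_divWeight (memLp_basisT hε n))]
  simp only [Complex.conj_ofReal]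

lemma integral_T_mul_T (m n : ℕ) :
    ∫ z, (normT m * (Polynomial.Chebyshev.T ℝ (m : ℤ)).eval z)
      * (normT n * (Polynomial.Chebyshev.T ℝ (n : ℤ)).eval z) ∂Polynomial.Chebyshev.measureT
      = if m = n then 1 else 0 := by
  have hpi := Real.pi_pos
  simp_rw [mul_mul_mul_comm]
  rw [integral_const_mul]
  split_ifs with h
  · subst h
    rcases Nat.eq_zero_or_pos m with rfl | hm
    · simp only [Nat.cast_zero]
      rw [Polynomial.Chebyshev.integral_eval_T_real_mul_self_measureT_zero]
      simp only [normT, if_true]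
      rw [← mul_inv, Real.mul_self_sqrt hpi.le, inv_mul_cancel₀ hpi.ne']
    · rw [Polynomial.Chebyshev.integral_T_real_mul_self_measureT_of_ne_zero hm.ne']
      simp only [normT, hm.ne', if_false]
      rw [Real.mul_self_sqrt (by positivity)]
      field_simp
  · rw [Polynomial.Chebyshev.integral_eval_T_real_mul_eval_T_real_measureT_of_ne h, mul_zero]

lemma orthonormal_vecT {ε : ℝ} (hε : 0 < ε) : Orthonormal ℂ (vecT hε) := by
  rw [orthonormal_iff_ite]
  intro m n
  rw [inner_vecT, intervalIntegral_congr_ae_Icc hε.le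
    (g := fun y => ((((normT m * (Polynomial.Chebyshev.T ℝ (m : ℤ)).eval (y / ε))
      * (normT n * (Polynomial.Chebyshev.T ℝ (n : ℤ)).eval (y / ε))) / weight ε y : ℝ) : ℂ)),
    intervalIntegral.integral_ofReal, integral_div_weight hε (fun z =>
      (normT m * (Polynomial.Chebyshev.T ℝ (m : ℤ)).eval z)
      * (normT n * (Polynomial.Chebyshev.T ℝ (n : ℤ)).eval z)), integral_T_mul_T]
  · split_ifs <;> simp
  · filter_upwards [coeFn_divWeight (memLp_basisT hε n)] with y hy
    rw [vecT, hy]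
    simp only [chebT]
    push_cast
    ring

lemma orthogonal_vecT {ε : ℝ} (hε : 0 < ε) :
    (Submodule.span ℂ (Set.range (vecT hε)))ᗮ = ⊥ := by
  rw [Submodule.eq_bot_iff]
  intro f hf
  have h0 : ∀ n : ℕ, ∫ y in (-ε)..ε, (chebT ε n y : ℂ) * f y = 0 := by
    intro n
    have h := (Submodule.mem_orthogonal _ _).1 hf (vecT hε n)
      (Submodule.subset_span (Set.mem_range_self n))
    rw [inner_vecT] at h
    simp only [Complex.ofReal_mul, mul_assoc] at h
    rw [intervalIntegral.integral_const_mul] at h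
    exact (mul_eq_zero.1 h).resolve_left (by exact_mod_cast (normT_pos n).ne')
  have := ae_eq_zero_of_integral_recurrence_eq_zero (a := 1) hε (integrable_coeFn hε f)
    (P := fun n z => (Polynomial.Chebyshev.T ℝ (n : ℤ)).eval z)
    (fun n => Polynomial.continuous _) (by simp) (by simp) eval_T_recurrence h0
  exact (Lp.eq_zero_iff_ae_eq_zero).2 ((weightMeasure_absolutelyContinuous ε).ae_le this)

/-- The Hilbert basis of `X ε` formed by the normalized functions `T_n(y/ε) / √(ε² - y²)`. -/
def basisT {ε : ℝ} (hε : 0 < ε) : HilbertBasis ℕ ℂ (X ε) :=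
  HilbertBasis.mkOfOrthogonalEqBot (orthonormal_vecT hε) (orthogonal_vecT hε)

@[simp]
lemma coe_basisT {ε : ℝ} (hε : 0 < ε) : ⇑(basisT hε) = vecT hε :=
  HilbertBasis.coe_mkOfOrthogonalEqBot _ _

/-- The normalized function `U_n(y/ε)`. -/
def funU (ε : ℝ) (n : ℕ) (y : ℝ) : ℝ := Real.sqrt (2 / Real.pi) / ε * chebU ε n y

lemma continuous_funU (ε : ℝ) (n : ℕ) : Continuous (funU ε n) :=
  continuous_const.mul (continuous_chebU ε n)

lemma memLp_of_continuous {ε : ℝ} {k : ℝ → ℂ} (hk : Continuous k) :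
    MemLp k 2 (weightMeasure ε) := by
  obtain ⟨C, hC⟩ := isCompact_Icc.exists_bound_of_continuousOn (s := Icc (-ε) ε) hk.continuousOn
  refine MemLp.of_bound hk.aestronglyMeasurable C
    ((weightMeasure_absolutelyContinuous ε).ae_le ?_)
  filter_upwards [ae_mem_Ioo ε] with y hy using hC y (Ioo_subset_Icc_self hy)

/-- The normalized functions `U_n(y/ε)` as elements of `X ε`. -/
def vecU (ε : ℝ) (n : ℕ) : X ε :=
  (memLp_of_continuous (Complex.continuous_ofReal.comp (continuous_funU ε n))).toLp _

lemma coeFn_vecU (ε : ℝ) (n : ℕ) :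
    ⇑(vecU ε n) =ᵐ[volume.restrict (Icc (-ε) ε)] fun y => (funU ε n y : ℂ) :=
  (absolutelyContinuous_weightMeasure ε).ae_le (MemLp.coeFn_toLp _)

lemma inner_vecU {ε : ℝ} (hε : 0 < ε) (n : ℕ) (f : X ε) :
    inner ℂ (vecU ε n) f = ∫ y in (-ε)..ε, (funU ε n y : ℂ) * ((weight ε y : ℂ) * f y) := by
  rw [inner_eq_integral hε.le]
  refine intervalIntegral_congr_ae_Icc hε.le ?_
  filter_upwards [coeFn_vecU ε n] with y hy
  rw [hy, Complex.conj_ofReal]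
  ring

-- For z = cos t the integrand is sin((m+1)t) sin((n+1)t), which the addition formulas turn into a
-- difference of T-polynomials with known integrals.
open Polynomial Polynomial.Chebyshev in
lemma integral_U_mul_U (m n : ℕ) :
    ∫ z, (1 - z ^ 2) * ((U ℝ (m : ℤ)).eval z * (U ℝ (n : ℤ)).eval z) ∂measureT
      = if m = n then Real.pi / 2 else 0 := by
  have h : ∫ z, (1 - z ^ 2) * ((U ℝ (m : ℤ)).eval z * (U ℝ (n : ℤ)).eval z) ∂measureT
      = ∫ z, (1 / 2) * ((T ℝ ((m : ℤ) - n)).eval z - (T ℝ ((m : ℤ) + n + 2)).eval z)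
        ∂measureT := by
    rw [integral_measureT_eq_integral_cos, integral_measureT_eq_integral_cos]
    refine intervalIntegral.integral_congr fun t _ => ?_
    simp only [T_real_cos]
    have h1 := U_real_cos t m
    have h2 := U_real_cos t n
    have h3 : (1 - Real.cos t ^ 2) * ((U ℝ (m : ℤ)).eval (Real.cos t)
        * (U ℝ (n : ℤ)).eval (Real.cos t))
        = Real.sin ((m + 1) * t) * Real.sin ((n + 1) * t) := by
      push_cast at h1 h2
      rw [← h1, ← h2, ← Real.sin_sq]; ring
    rw [h3]
    push_cast
    rw [show ((m : ℝ) - n) * t = (m + 1) * t - (n + 1) * t by ring,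
      show ((m : ℝ) + n + 2) * t = (m + 1) * t + (n + 1) * t by ring,
      Real.cos_sub, Real.cos_add]
    ring
  rw [h, integral_const_mul, integral_sub (integrable_measureT (by fun_prop))
    (integrable_measureT (by fun_prop)), integral_eval_T_real_measureT_of_ne_zero
    (n := (m : ℤ) + n + 2) (by omega)]
  split_ifs with hmn
  · subst hmn
    rw [sub_self, integral_eval_T_real_measureT_zero]
    ring
  · rw [integral_eval_T_real_measureT_of_ne_zero (by omega)]
    simp

lemma orthonormal_vecU {ε : ℝ} (hε : 0 < ε) : Orthonormal ℂ (vecU ε) := by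
  rw [orthonormal_iff_ite]
  intro m n
  have hpi := Real.pi_pos
  rw [inner_vecU hε, intervalIntegral_congr_ae_Icc hε.le
    (g := fun y => (((2 / Real.pi) * ((1 - (y / ε) ^ 2) *
      ((Polynomial.Chebyshev.U ℝ (m : ℤ)).eval (y / ε)
      * (Polynomial.Chebyshev.U ℝ (n : ℤ)).eval (y / ε))) / weight ε y : ℝ) : ℂ)),
    intervalIntegral.integral_ofReal, integral_div_weight hε (fun z => (2 / Real.pi) *
      ((1 - z ^ 2) * ((Polynomial.Chebyshev.U ℝ (m : ℤ)).eval z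
      * (Polynomial.Chebyshev.U ℝ (n : ℤ)).eval z))), integral_const_mul, integral_U_mul_U]
  · split_ifs
    · rw [show 2 / Real.pi * (Real.pi / 2) = 1 by field_simp]
      simp
    · simp
  · filter_upwards [coeFn_vecU ε n, ae_mem_Ioo ε] with y hy hmem
    have hw := weight_pos hmem
    have hw2 : weight ε y * weight ε y = ε ^ 2 - y ^ 2 :=
      Real.mul_self_sqrt (by nlinarith [hmem.1, hmem.2])
    rw [hy, ← Complex.ofReal_mul, ← Complex.ofReal_mul]
    congr 1
    have h1 : (1 - (y / ε) ^ 2) = weight ε y * weight ε y / ε ^ 2 := by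
      rw [hw2]; field_simp
    have h2 : Real.sqrt (2 / Real.pi) * Real.sqrt (2 / Real.pi) = 2 / Real.pi :=
      Real.mul_self_sqrt (by positivity)
    rw [h1, ← h2]
    simp only [funU, chebU]
    field_simp

lemma orthogonal_vecU {ε : ℝ} (hε : 0 < ε) :
    (Submodule.span ℂ (Set.range (vecU ε)))ᗮ = ⊥ := by
  rw [Submodule.eq_bot_iff]
  intro f hf
  have hpi := Real.pi_pos
  have h0 : ∀ n : ℕ, ∫ y in (-ε)..ε, (chebU ε n y : ℂ) * ((weight ε y : ℂ) * f y) = 0 := by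
    intro n
    have h := (Submodule.mem_orthogonal _ _).1 hf (vecU ε n)
      (Submodule.subset_span (Set.mem_range_self n))
    rw [inner_vecU hε] at h
    simp only [funU, Complex.ofReal_mul, mul_assoc] at h
    rw [intervalIntegral.integral_const_mul] at h
    refine (mul_eq_zero.1 h).resolve_left ?_
    have : Real.sqrt (2 / Real.pi) / ε ≠ 0 := by positivity
    exact_mod_cast this
  have := ae_eq_zero_of_integral_recurrence_eq_zero (a := 1 / 2) hε
    (integrable_weightMeasure_iff.1 ((Lp.memLp f).integrable (by norm_num)))
    (P := fun n z => (Polynomial.Chebyshev.U ℝ (n : ℤ)).eval z)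
    (fun n => Polynomial.continuous _) (by simp) (by simp) eval_U_recurrence h0
  refine (Lp.eq_zero_iff_ae_eq_zero).2 ((weightMeasure_absolutelyContinuous ε).ae_le ?_)
  filter_upwards [this, weight_ne_zero_ae ε] with y hy hw
  simpa [hw] using hy

/-- The Hilbert basis of `X ε` formed by the normalized functions `U_n(y/ε)`. -/
def basisU {ε : ℝ} (hε : 0 < ε) : HilbertBasis ℕ ℂ (X ε) :=
  HilbertBasis.mkOfOrthogonalEqBot (orthonormal_vecU hε) (orthogonal_vecU hε)

@[simp]
lemma coe_basisU {ε : ℝ} (hε : 0 < ε) : ⇑(basisU hε) = vecU ε :=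
  HilbertBasis.coe_mkOfOrthogonalEqBot _ _

/-! ### The Chebyshev expansion of the logarithmic kernel -/

/-- Dirichlet's test gives convergence on the unit circle away from 1; Abel's limit theorem
identifies the sum with the radial limit of the Taylor series inside the disc. -/
lemma tendsto_sum_pow_div_neg_log {z : ℂ} (hz : ‖z‖ = 1) (hz1 : z ≠ 1) :
    Tendsto (fun N => ∑ n ∈ Finset.range N, z ^ (n + 1) / ((n : ℂ) + 1)) atTop
      (𝓝 (-Complex.log (1 - z))) := by
  have hsub : 0 < ‖z - 1‖ := norm_pos_iff.2 (sub_ne_zero.2 hz1)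
  have hcau : CauchySeq fun N => ∑ n ∈ Finset.range N, (1 / ((n : ℝ) + 1)) • z ^ (n + 1) := by
    refine Antitone.cauchySeq_series_mul_of_tendsto_zero_of_bounded (b := 2 / ‖z - 1‖) ?_
      tendsto_one_div_add_atTop_nhds_zero_nat ?_
    · intro m n hmn
      have : (m : ℝ) ≤ n := by exact_mod_cast hmn
      simp only
      gcongr
    · intro n
      simp_rw [pow_succ, ← Finset.sum_mul]
      rw [geom_sum_eq hz1, norm_mul, norm_div, hz, mul_one]
      gcongr
      refine (norm_sub_le _ _).trans ?_
      rw [norm_pow, hz]; norm_num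
  obtain ⟨l, hl⟩ := cauchySeq_tendsto_of_complete hcau
  have hl' : Tendsto (fun N => ∑ n ∈ Finset.range N, z ^ (n + 1) / ((n : ℂ) + 1)) atTop (𝓝 l) := by
    refine hl.congr fun N => Finset.sum_congr rfl fun n _ => ?_
    rw [Complex.real_smul]; push_cast; ring
  have hl2 : Tendsto (fun N => ∑ n ∈ Finset.range N, z ^ n / (n : ℂ)) atTop (𝓝 l) := by
    rw [← tendsto_add_atTop_iff_nat 1]
    refine hl'.congr fun N => ?_
    rw [Finset.sum_range_succ']
    simp
  have habel := Complex.tendsto_tsum_powerSeries_nhdsWithin_lt hl2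
  rw [tendsto_map'_iff] at habel
  -- This keeps 1 - z off the branch cut, so the principal logarithm is continuous there.
  have hre : 0 < (1 - z).re := by
    have h1 : z.re ≤ 1 := by rw [← hz]; exact Complex.re_le_norm z
    have h2 : z.re ≠ 1 := by
      intro h
      apply hz1
      have h3 : z.re ^ 2 + z.im ^ 2 = 1 := by
        have := Complex.sq_norm z
        rw [hz, Complex.normSq_apply] at this
        nlinarith
      rw [h] at h3
      apply Complex.ext
      · simpa using h
      · simp only [Complex.one_im]; nlinarith
    simp only [Complex.sub_re, Complex.one_re, sub_pos]
    exact lt_of_le_of_ne h1 h2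
  have hlim : Tendsto (fun r : ℝ => -Complex.log (1 - z * r)) (𝓝[<] 1)
      (𝓝 (-Complex.log (1 - z))) := by
    have hc : ContinuousAt (fun r : ℝ => -Complex.log (1 - z * r)) 1 := by
      refine ContinuousAt.neg (ContinuousAt.clog (by fun_prop) ?_)
      left; simpa using hre
    have := hc.tendsto
    simp only [Complex.ofReal_one, mul_one] at this
    exact this.mono_left nhdsWithin_le_nhds
  have heq : (fun r : ℝ => -Complex.log (1 - z * r)) =ᶠ[𝓝[<] 1]
      ((fun w => ∑' n : ℕ, z ^ n / (n : ℂ) * w ^ n) ∘ Complex.ofReal) := by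
    have h0 : ∀ᶠ r : ℝ in 𝓝[<] 1, r ∈ Ioo (0 : ℝ) 1 := Ioo_mem_nhdsLT (by norm_num)
    filter_upwards [h0] with r hr
    have hs := Complex.hasSum_taylorSeries_neg_log (z := z * r) (by
      rw [norm_mul, hz, one_mul, Complex.norm_real, Real.norm_of_nonneg hr.1.le]; exact hr.2)
    rw [← hs.tsum_eq]
    refine tsum_congr fun n => ?_
    rw [mul_pow]; ring
  have := tendsto_nhds_unique (hlim.congr' heq) habel
  rw [this]
  exact hl'

/-- Write 2 cos(ns) cos(nt) = Re(z₁ⁿ + z₂ⁿ) with z₁ = e^{i(s+t)} and z₂ = e^{i(s-t)}. The sum is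
then log|(1 - z₁)(1 - z₂)|, and the product equals e^{is} · 2(cos s - cos t). -/
lemma tendsto_sum_cos_mul_cos {s t : ℝ} (hst : Real.cos s ≠ Real.cos t) :
    Tendsto (fun N => ∑ n ∈ Finset.range N,
      -(2 * Real.cos (((n : ℝ) + 1) * s) * Real.cos (((n : ℝ) + 1) * t) / ((n : ℝ) + 1))) atTop
      (𝓝 (Real.log |2 * (Real.cos s - Real.cos t)|)) := by
  set z₁ : ℂ := Complex.exp ((s + t : ℝ) * Complex.I) with hz₁
  set z₂ : ℂ := Complex.exp ((s - t : ℝ) * Complex.I) with hz₂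
  have hprod : (1 - z₁) * (1 - z₂)
      = Complex.exp (s * Complex.I) * ((2 * (Real.cos s - Real.cos t) : ℝ) : ℂ) := by
    have e1 : z₁ = Complex.exp (s * Complex.I) * Complex.exp (t * Complex.I) := by
      rw [hz₁, ← Complex.exp_add]; push_cast; ring_nf
    have e2 : z₂ = Complex.exp (s * Complex.I) * Complex.exp (-(t * Complex.I)) := by
      rw [hz₂, ← Complex.exp_add]; push_cast; ring_nf
    have e3 : Complex.exp (t * Complex.I) * Complex.exp (-(t * Complex.I)) = 1 := by
      rw [← Complex.exp_add]; simp
    have e4 : Complex.exp (s * Complex.I) * Complex.exp (-(s * Complex.I)) = 1 := by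
      rw [← Complex.exp_add]; simp
    have c1 : ((Real.cos s : ℝ) : ℂ)
        = (Complex.exp (s * Complex.I) + Complex.exp (-(s * Complex.I))) / 2 := by
      rw [Complex.ofReal_cos, Complex.cos]; ring_nf
    have c2 : ((Real.cos t : ℝ) : ℂ)
        = (Complex.exp (t * Complex.I) + Complex.exp (-(t * Complex.I))) / 2 := by
      rw [Complex.ofReal_cos, Complex.cos]; ring_nf
    rw [Complex.ofReal_mul, Complex.ofReal_sub, c1, c2, e1, e2]
    push_cast
    linear_combination (Complex.exp (s * Complex.I)) ^ 2 * e3 - e4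
  have hne : (1 - z₁) * (1 - z₂) ≠ 0 := by
    rw [hprod]
    refine mul_ne_zero (Complex.exp_ne_zero _) ?_
    exact_mod_cast mul_ne_zero two_ne_zero (sub_ne_zero.2 hst)
  have h1 : z₁ ≠ 1 := fun h => by simp [h] at hne
  have h2 : z₂ ≠ 1 := fun h => by simp [h] at hne
  have n1 : ‖z₁‖ = 1 := Complex.norm_exp_ofReal_mul_I _
  have n2 : ‖z₂‖ = 1 := Complex.norm_exp_ofReal_mul_I _
  have hlim := ((tendsto_sum_pow_div_neg_log n1 h1).add (tendsto_sum_pow_div_neg_log n2 h2)).neg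
  have hre := (Complex.continuous_re.tendsto _).comp hlim
  have hval : (-(-Complex.log (1 - z₁) + -Complex.log (1 - z₂))).re
      = Real.log |2 * (Real.cos s - Real.cos t)| := by
    rw [neg_add, neg_neg, neg_neg, Complex.add_re, Complex.log_re, Complex.log_re,
      ← Real.log_mul, ← norm_mul, hprod, norm_mul, Complex.norm_exp_ofReal_mul_I, one_mul,
      Complex.norm_real, Real.norm_eq_abs]
    · exact norm_ne_zero_iff.2 (left_ne_zero_of_mul hne)
    · exact norm_ne_zero_iff.2 (right_ne_zero_of_mul hne)
  rw [hval] at hre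
  refine hre.congr fun N => ?_
  simp only [Function.comp_apply]
  rw [← Finset.sum_add_distrib, ← Finset.sum_neg_distrib, Complex.re_sum]
  refine Finset.sum_congr rfl fun n _ => ?_
  have p1 : z₁ ^ (n + 1) = Complex.exp (((((n : ℝ) + 1) * s + (n + 1) * t : ℝ) : ℂ) * Complex.I) := by
    rw [hz₁, ← Complex.exp_nat_mul]; push_cast; ring_nf
  have p2 : z₂ ^ (n + 1) = Complex.exp (((((n : ℝ) + 1) * s - (n + 1) * t : ℝ) : ℂ) * Complex.I) := by
    rw [hz₂, ← Complex.exp_nat_mul]; push_cast; ring_nf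
  have hden : ((n : ℂ) + 1) = (((n : ℝ) + 1 : ℝ) : ℂ) := by push_cast; rfl
  rw [p1, p2, hden, ← add_div, Complex.neg_re, Complex.div_ofReal_re, Complex.add_re,
    Complex.exp_ofReal_mul_I_re, Complex.exp_ofReal_mul_I_re, Real.cos_add, Real.cos_sub]
  ring

/-- This sequence dominates the kernel coefficients for every x and every ε simultaneously, since
|T_n| ≤ 1 on [-1, 1]. -/
lemma memℓp_pi_mul_normT_div : Memℓp (fun n : ℕ => Real.pi * normT n / n) 2 := by
  refine memℓp_gen ?_
  have hs : Summable fun n : ℕ => 2 * Real.pi * (1 / (n : ℝ) ^ 2) :=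
    (Real.summable_one_div_nat_pow.2 (by norm_num)).mul_left _
  refine hs.congr fun n => ?_
  have hpi := Real.pi_pos
  rcases n with _ | n
  · simp
  · have h : Real.sqrt (2 / Real.pi) ^ 2 = 2 / Real.pi := Real.sq_sqrt (by positivity)
    rw [normT_succ, ENNReal.toReal_ofNat, Real.rpow_ofNat, Real.norm_eq_abs, sq_abs, div_pow,
      mul_pow, h]
    field_simp

/-- The coefficients of `log |x - y| / √(ε² - y²)`, except the one at `0`. -/
def logCoeff (ε x : ℝ) (n : ℕ) : ℝ := -(Real.pi * normT n / n * chebT ε n x)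

lemma abs_logCoeff_le {ε : ℝ} (hε : 0 < ε) (x : Icc (-ε) ε) (n : ℕ) :
    |logCoeff ε x n| ≤ Real.pi * normT n / n := by
  have h0 : 0 ≤ Real.pi * normT n / n := by
    have := (normT_pos n).le; have := Real.pi_pos; positivity
  rw [logCoeff, abs_neg, abs_mul, abs_of_nonneg h0]
  exact mul_le_of_le_one_right h0 (abs_chebT_le_one hε n x.2)

lemma memℓp_logCoeff {ε : ℝ} (hε : 0 < ε) (x : Icc (-ε) ε) :
    Memℓp (fun n => (logCoeff ε x n : ℂ)) 2 := by
  refine memℓp_pi_mul_normT_div.mono fun n => ?_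
  rw [Complex.norm_real]
  exact abs_logCoeff_le hε x n

/-- The coefficients of `log |x - y| / √(ε² - y²)`, except the one at `0`, as an `ℓ²` sequence. -/
def logSeq {ε : ℝ} (hε : 0 < ε) (x : Icc (-ε) ε) : lp (fun _ : ℕ => ℂ) 2 :=
  ⟨_, memℓp_logCoeff hε x⟩

/-- The function `log |x - y| / √(ε² - y²)` as an element of `X ε`. -/
def logKernel {ε : ℝ} (hε : 0 < ε) (x : Icc (-ε) ε) : X ε :=
  ((Real.pi * normT 0 * Real.log (ε / 2) : ℝ) : ℂ) • vecT hε 0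
    + (basisT hε).repr.symm (logSeq hε x)

lemma chebT_eq_cos {ε : ℝ} (hε : 0 < ε) (n : ℕ) {x : ℝ} (hx : x ∈ Icc (-ε) ε) :
    chebT ε n x = Real.cos (n * Real.arccos (x / ε)) := by
  have h1 : -1 ≤ x / ε := by rw [le_div_iff₀ hε]; linarith [hx.1]
  have h2 : x / ε ≤ 1 := by rw [div_le_one hε]; exact hx.2
  have := Polynomial.Chebyshev.T_real_cos (Real.arccos (x / ε)) (n : ℤ)
  rw [Real.cos_arccos h1 h2] at this
  simpa [chebT] using this

/-- Put x = ε cos s and y = ε cos t, so that x - y = (ε/2) · 2(cos s - cos t). The summand at n = 0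
is zero because division by zero yields zero. -/
lemma tendsto_sum_chebT {ε : ℝ} (hε : 0 < ε) {x y : ℝ} (hx : x ∈ Icc (-ε) ε)
    (hy : y ∈ Icc (-ε) ε) (hxy : x ≠ y) :
    Tendsto (fun N => Real.log (ε / 2) + ∑ n ∈ Finset.range N,
      -(2 * chebT ε n x * chebT ε n y / n)) atTop (𝓝 (Real.log |x - y|)) := by
  have c : ∀ z ∈ Icc (-ε) ε, Real.cos (Real.arccos (z / ε)) = z / ε := fun z hz =>
    Real.cos_arccos (by rw [le_div_iff₀ hε]; linarith [hz.1]) (by rw [div_le_one hε]; exact hz.2)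
  have hne : Real.cos (Real.arccos (x / ε)) ≠ Real.cos (Real.arccos (y / ε)) := by
    rw [c x hx, c y hy]
    intro h
    exact hxy (by field_simp at h; exact h)
  have h := (tendsto_sum_cos_mul_cos hne).const_add (Real.log (ε / 2))
  have hval : Real.log (ε / 2) + Real.log |2 * (Real.cos (Real.arccos (x / ε))
      - Real.cos (Real.arccos (y / ε)))| = Real.log |x - y| := by
    rw [← Real.log_mul (by positivity)
      (abs_ne_zero.2 (mul_ne_zero two_ne_zero (sub_ne_zero.2 hne))), c x hx, c y hy,
      ← abs_of_pos (show 0 < ε / 2 by positivity), ← abs_mul]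
    congr 2
    field_simp
  rw [hval] at h
  rw [← tendsto_add_atTop_iff_nat 1]
  refine h.congr fun N => ?_
  rw [Finset.sum_range_succ']
  simp only [Nat.cast_zero, div_zero, neg_zero, add_zero]
  congr 1
  refine Finset.sum_congr rfl fun n _ => ?_
  rw [chebT_eq_cos hε _ hx, chebT_eq_cos hε _ hy]
  push_cast
  rfl

lemma coeFn_sum {ε : ℝ} (s : Finset ℕ) (F : ℕ → X ε) :
    ⇑(∑ n ∈ s, F n) =ᵐ[weightMeasure ε] fun y => ∑ n ∈ s, F n y := by
  classical
  induction s using Finset.induction_on with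
  | empty => simpa only [Finset.sum_empty] using! Lp.coeFn_zero ℂ 2 (weightMeasure ε)
  | insert n s hn ih =>
    rw [Finset.sum_insert hn]
    filter_upwards [Lp.coeFn_add (F n) (∑ n ∈ s, F n), ih] with y h1 h2
    rw [h1, Finset.sum_insert hn, Pi.add_apply, h2]

lemma pi_mul_normT_zero_mul_normT_zero : Real.pi * normT 0 * normT 0 = 1 := by
  have hpi := Real.pi_pos
  simp only [normT, if_true]
  rw [mul_assoc, ← mul_inv, Real.mul_self_sqrt hpi.le, mul_inv_cancel₀ hpi.ne']

/-- The partial sums converge in `X ε` to the element defined by the coefficients, so a subsequence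
converges almost everywhere. Pointwise they converge to the logarithm off y = x, and the two limits
must agree. -/
lemma coeFn_logKernel {ε : ℝ} (hε : 0 < ε) (x : Icc (-ε) ε) :
    ⇑(logKernel hε x) =ᵐ[volume.restrict (Icc (-ε) ε)]
      fun y => ((Real.log |(x : ℝ) - y| : ℝ) : ℂ) / weight ε y := by
  refine (absolutelyContinuous_weightMeasure ε).ae_le ?_
  have hpi := Real.pi_pos
  set F : ℕ → X ε := fun N => ((Real.pi * normT 0 * Real.log (ε / 2) : ℝ) : ℂ) • vecT hε 0
    + ∑ n ∈ Finset.range N, logSeq hε x n • vecT hε n with hF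
  have hlim : Tendsto F atTop (𝓝 (logKernel hε x)) := by
    have := ((basisT hε).hasSum_repr_symm (logSeq hε x)).tendsto_sum_nat
    simp only [coe_basisT] at this
    exact this.const_add _
  obtain ⟨ns, hns, hae⟩ := (tendstoInMeasure_of_tendsto_Lp hlim).exists_seq_tendsto_ae
  have hcoe : ∀ᵐ y ∂weightMeasure ε, ∀ N, F N y
      = ((Real.log (ε / 2) + ∑ n ∈ Finset.range N,
          -(2 * chebT ε n x * chebT ε n y / n) : ℝ) : ℂ) / weight ε y := by
    rw [ae_all_iff]
    intro N
    have hT : ∀ᵐ y ∂weightMeasure ε, ∀ n, vecT hε n y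
        = ((normT n * chebT ε n y : ℝ) : ℂ) / weight ε y :=
      ae_all_iff.2 fun n => (memLp_basisT hε n).coeFn_toLp
    have hS : ∀ᵐ y ∂weightMeasure ε, ∀ n, (logSeq hε x n • vecT hε n : X ε) y
        = logSeq hε x n * vecT hε n y :=
      ae_all_iff.2 fun n => Lp.coeFn_smul _ _
    filter_upwards [Lp.coeFn_add (((Real.pi * normT 0 * Real.log (ε / 2) : ℝ) : ℂ) • vecT hε 0)
      (∑ n ∈ Finset.range N, logSeq hε x n • vecT hε n),
      Lp.coeFn_smul ((Real.pi * normT 0 * Real.log (ε / 2) : ℝ) : ℂ) (vecT hε 0),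
      coeFn_sum (Finset.range N) (fun n => logSeq hε x n • vecT hε n), hT, hS]
      with y h1 h2 h3 h4 h5
    rw [hF]
    simp only
    rw [h1, Pi.add_apply, h2, h3, Pi.smul_apply, h4, smul_eq_mul, Complex.ofReal_add, add_div]
    congr 1
    · rw [← mul_div_assoc, ← Complex.ofReal_mul]
      congr 2
      have hT0 : chebT ε 0 y = 1 := by simp [chebT]
      rw [hT0]
      linear_combination Real.log (ε / 2) * pi_mul_normT_zero_mul_normT_zero
    · rw [Complex.ofReal_sum, Finset.sum_div]
      refine Finset.sum_congr rfl fun n _ => ?_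
      rw [h5, h4]
      change ((logCoeff ε x n : ℝ) : ℂ) * _ = _
      rw [← mul_div_assoc, ← Complex.ofReal_mul]
      congr 2
      -- At n = 0 both sides vanish by division by zero; otherwise π · normT(n)² = 2.
      rcases n with _ | n
      · simp [logCoeff]
      · have h : Real.sqrt (2 / Real.pi) * Real.sqrt (2 / Real.pi) = 2 / Real.pi :=
          Real.mul_self_sqrt (by positivity)
        have h' : Real.pi * (Real.sqrt (2 / Real.pi) * Real.sqrt (2 / Real.pi)) = 2 := by
          rw [h]; field_simp
        rw [logCoeff, normT_succ]
        linear_combination -(chebT ε (n + 1) x * chebT ε (n + 1) y / ((n + 1 : ℕ) : ℝ)) * h'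
  have h0 : ∀ᵐ y ∂weightMeasure ε, y ∈ Ioo (-ε) ε :=
    (weightMeasure_absolutelyContinuous ε).ae_le (ae_mem_Ioo ε)
  have hx : ∀ᵐ y ∂weightMeasure ε, y ≠ (x : ℝ) := by
    refine (weightMeasure_absolutelyContinuous ε).ae_le (ae_restrict_of_ae ?_)
    simp [ae_iff, measure_singleton]
  filter_upwards [hae, hcoe, h0, hx] with y h1 h2 h3 h4
  refine tendsto_nhds_unique h1 ?_
  simp only [h2]
  have h5 := (tendsto_sum_chebT hε x.2 (Ioo_subset_Icc_self h3) (Ne.symm h4)).comp hns.tendsto_atTop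
  exact ((Complex.continuous_ofReal.tendsto _).comp h5).div_const _

/-! ### The operator `L ε` in the Chebyshev bases -/

lemma L_eq_inner {ε : ℝ} (hε : 0 < ε) (f : X ε) (x : Icc (-ε) ε) :
    L ε f x = inner ℂ (logKernel hε x) f := by
  rw [inner_eq_integral_of_ae_eq hε.le (coeFn_logKernel hε x)]
  simp only [Complex.conj_ofReal, L]

/-- The unbounded factor log(ε/2) is isolated in the zero mode, which contributes a constant
function of x; the other modes see a kernel bounded uniformly in ε. -/
lemma L_eq_add {ε : ℝ} (hε : 0 < ε) (f : X ε) (x : Icc (-ε) ε) :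
    L ε f x = ((Real.pi * normT 0 * Real.log (ε / 2) : ℝ) : ℂ) * (basisT hε).repr f 0
      + inner ℂ (logSeq hε x) ((basisT hε).repr f) := by
  rw [L_eq_inner hε, logKernel, inner_add_left, inner_smul_left, Complex.conj_ofReal,
    ← (basisT hε).repr.inner_map_map ((basisT hε).repr.symm (logSeq hε x)) f,
    LinearIsometryEquiv.apply_symm_apply, (basisT hε).repr_apply_apply, coe_basisT]

lemma hasSum_inner_logSeq {ε : ℝ} (hε : 0 < ε) (c : lp (fun _ : ℕ => ℂ) 2) (x : Icc (-ε) ε) :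
    HasSum (fun n => (logCoeff ε x n : ℂ) * c n) (inner ℂ (logSeq hε x) c) := by
  have e : (fun n => (logCoeff ε x n : ℂ) * c n) = fun n => inner ℂ (logSeq hε x n) (c n) := by
    funext n
    change _ = c n * conj ((logCoeff ε x n : ℝ) : ℂ)
    rw [Complex.conj_ofReal, mul_comm]
  rw [e]
  exact lp.hasSum_inner (logSeq hε x) c

/-- The kernel of the functional `g ↦ ∫_x^y g`. -/
def signedIndicator (x y t : ℝ) : ℂ :=
  (Ioc x y).indicator (fun _ => 1) t - (Ioc y x).indicator (fun _ => 1) t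

lemma memLp_signedIndicator {ε : ℝ} (hε : 0 < ε) (x y : ℝ) :
    MemLp (fun t => signedIndicator x y t / weight ε t) 2 (weightMeasure ε) := by
  refine memLp_div_weight (C := 2) hε ?_ fun t _ => ?_
  · exact ((measurable_const.indicator measurableSet_Ioc).sub
      (measurable_const.indicator measurableSet_Ioc)).aestronglyMeasurable
  · refine (norm_sub_le _ _).trans ?_
    have h : ∀ a b : ℝ, ‖(Ioc a b).indicator (fun _ => (1 : ℂ)) t‖ ≤ 1 := fun a b => by
      refine (norm_indicator_le_norm_self _ _).trans (by simp)
    linarith [h x y, h y x]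

lemma inner_divWeight_signedIndicator {ε : ℝ} (hε : 0 < ε) (x y : Icc (-ε) ε) (g : X ε) :
    inner ℂ (divWeight _ (memLp_signedIndicator hε x y)) g = ∫ t in (x : ℝ)..(y : ℝ), g t := by
  rw [inner_eq_integral_of_ae_eq hε.le (coeFn_divWeight (memLp_signedIndicator hε x y)),
    intervalIntegral.integral_of_le (by linarith), intervalIntegral]
  have hg := (integrable_coeFn hε g).mono_measure
    (Measure.restrict_mono Ioc_subset_Icc_self le_rfl)
  have hsub : ∀ a b : Icc (-ε) ε, Ioc (a : ℝ) b ∩ Ioc (-ε) ε = Ioc (a : ℝ) b := fun a b =>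
    inter_eq_left.2 (Ioc_subset_Ioc a.2.1 b.2.2)
  have h : ∀ t, conj (signedIndicator x y t) * g t
      = (Ioc (x : ℝ) y).indicator g t - (Ioc (y : ℝ) x).indicator g t := by
    intro t
    by_cases h1 : t ∈ Ioc (x : ℝ) y <;> by_cases h2 : t ∈ Ioc (y : ℝ) x <;>
      simp [signedIndicator, h1, h2]
  simp only [h]
  rw [integral_sub (hg.indicator measurableSet_Ioc) (hg.indicator measurableSet_Ioc),
    integral_indicator measurableSet_Ioc, integral_indicator measurableSet_Ioc,
    Measure.restrict_restrict measurableSet_Ioc, Measure.restrict_restrict measurableSet_Ioc,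
    hsub, hsub]

/-- This is T_{n+1}' = (n+1) U_n, rescaled: the primitives of the second basis are, up to constants,
the polynomials in the numerators of the first. -/
lemma integral_vecU {ε : ℝ} (hε : 0 < ε) (n : ℕ) (x y : Icc (-ε) ε) :
    ∫ t in (x : ℝ)..(y : ℝ), vecU ε n t
      = ((normT (n + 1) / (n + 1 : ℕ) * (chebT ε (n + 1) y - chebT ε (n + 1) x) : ℝ) : ℂ) := by
  have h1 : ∫ t in (x : ℝ)..(y : ℝ), vecU ε n t = ∫ t in (x : ℝ)..(y : ℝ), (funU ε n t : ℂ) := by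
    refine intervalIntegral.integral_congr_ae ?_
    have h := coeFn_vecU ε n
    rw [EventuallyEq, ae_restrict_iff' measurableSet_Icc] at h
    filter_upwards [h] with t ht hmem
    refine ht ?_
    have := uIoc_subset_uIcc hmem
    exact (convex_Icc (-ε) ε).ordConnected.uIcc_subset x.2 y.2 this
  rw [h1, intervalIntegral.integral_ofReal]
  congr 1
  rw [mul_sub]
  refine intervalIntegral.integral_eq_sub_of_hasDerivAt
    (f := fun t => normT (n + 1) / (n + 1 : ℕ) * chebT ε (n + 1) t) (fun t _ => ?_)
    ((continuous_funU ε n).intervalIntegrable _ _)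
  convert! (hasDerivAt_chebT ε n t).const_mul (normT (n + 1) / (n + 1 : ℕ)) using 1
  rw [funU, normT_succ]
  push_cast
  field_simp

lemma hasSum_integral_repr_symm {ε : ℝ} (hε : 0 < ε) (c : lp (fun _ : ℕ => ℂ) 2)
    (x y : Icc (-ε) ε) :
    HasSum (fun n : ℕ => c n * ((normT (n + 1) / (n + 1 : ℕ)
      * (chebT ε (n + 1) y - chebT ε (n + 1) x) : ℝ) : ℂ))
      (∫ t in (x : ℝ)..(y : ℝ), (basisU hε).repr.symm c t) := by
  have h := ((basisU hε).hasSum_repr_symm c).mapL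
    (innerSL ℂ (divWeight _ (memLp_signedIndicator hε x y)))
  simp only [innerSL_apply_apply, inner_smul_right, coe_basisU] at h
  simp only [inner_divWeight_signedIndicator hε, integral_vecU hε] at h
  exact h

/-- If the `T`-coefficients of `f` are, up to the factor `-1/π` and an index shift, the
`U`-coefficients of `g`, then `g` is the derivative of `L f`. -/
lemma L_sub_eq_integral {ε : ℝ} (hε : 0 < ε) {f g : X ε}
    (h : ∀ n, (basisU hε).repr g n = -(Real.pi : ℂ) * (basisT hε).repr f (n + 1))
    (x y : Icc (-ε) ε) :
    L ε f y - L ε f x = ∫ t in (x : ℝ)..(y : ℝ), g t := by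
  have h1 := hasSum_integral_repr_symm hε ((basisU hε).repr g) x y
  rw [LinearIsometryEquiv.symm_apply_apply] at h1
  have h2 := (hasSum_inner_logSeq hε ((basisT hε).repr f) y).sub
    (hasSum_inner_logSeq hε ((basisT hε).repr f) x)
  -- The term n = 0 is zero, so dropping it aligns the T-index n + 1 with the U-index n.
  rw [← hasSum_nat_add_iff' 1] at h2
  simp only [Finset.range_one, Finset.sum_singleton] at h2
  rw [L_eq_add hε, L_eq_add hε, add_sub_add_left_eq_sub]
  have h3 : ∀ z, logCoeff ε z 0 = 0 := by intro z; simp [logCoeff]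
  simp only [h3, Complex.ofReal_zero, zero_mul, sub_zero] at h2
  refine h2.unique ?_
  convert! h1 using 2 with n
  rw [h]
  simp only [logCoeff]
  push_cast
  ring

/-- By Lebesgue differentiation `g` is almost everywhere the derivative of its primitive, here the
zero function. -/
lemma eq_zero_of_integral_eq_zero {ε : ℝ} (hε : 0 < ε) {g : X ε}
    (hg : ∀ x y : Icc (-ε) ε, ∫ t in (x : ℝ)..(y : ℝ), g t = 0) : g = 0 := by
  have hi := intervalIntegrable_of_integrable_Icc hε.le (integrable_coeFn hε g)
  refine (Lp.eq_zero_iff_ae_eq_zero).2 ((weightMeasure_absolutelyContinuous ε).ae_le ?_)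
  have h := hi.ae_hasDerivAt_integral
  rw [uIcc_of_le (by linarith)] at h
  filter_upwards [ae_restrict_of_ae h, ae_mem_Ioo ε] with y hy hmem
  have hl : (-ε : ℝ) ∈ Icc (-ε) ε := ⟨le_rfl, by linarith⟩
  have hd := hy (Ioo_subset_Icc_self hmem) (-ε) hl
  have h0 : (fun x => ∫ t in (-ε)..x, g t) =ᶠ[𝓝 y] fun _ => 0 := by
    filter_upwards [Ioo_mem_nhds hmem.1 hmem.2] with x hx
    exact hg ⟨-ε, hl⟩ ⟨x, Ioo_subset_Icc_self hx⟩
  exact hd.unique ((hasDerivAt_const y (0 : ℂ)).congr_of_eventuallyEq h0)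

lemma memℓp_comp_succ (c : lp (fun _ : ℕ => ℂ) 2) (a : ℂ) :
    Memℓp (fun n => a * c (n + 1)) 2 := by
  refine Memℓp.const_mul (memℓp_gen ?_) a
  exact (summable_nat_add_iff 1).2 ((lp.memℓp c).summable (by norm_num))

lemma exists_derivative {ε : ℝ} (hε : 0 < ε) (f : X ε) :
    ∃ g : X ε, ∀ n, (basisU hε).repr g n = -(Real.pi : ℂ) * (basisT hε).repr f (n + 1) :=
  ⟨(basisU hε).repr.symm ⟨_, memℓp_comp_succ ((basisT hε).repr f) (-(Real.pi : ℂ))⟩,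
    fun n => by rw [LinearIsometryEquiv.apply_symm_apply]⟩

lemma continuous_of_sub_eq_integral {ε : ℝ} (hε : 0 < ε) {ψ : Icc (-ε) ε → ℂ} {g : X ε}
    (h : ∀ x y : Icc (-ε) ε, ψ y - ψ x = ∫ t in (x : ℝ)..(y : ℝ), g t) : Continuous ψ := by
  have hl : (-ε : ℝ) ∈ Icc (-ε) ε := ⟨le_rfl, by linarith⟩
  have hψ : ψ = fun y : Icc (-ε) ε => ψ ⟨-ε, hl⟩ + ∫ t in (-ε)..(y : ℝ), g t := by
    funext y
    rw [← h ⟨-ε, hl⟩ y]; ring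
  have hc := intervalIntegral.continuousOn_primitive_interval (f := g) (a := -ε) (b := ε)
    (μ := volume) (by rw [uIcc_of_le (by linarith)]; exact integrable_coeFn hε g)
  rw [uIcc_of_le (by linarith)] at hc
  rw [hψ]
  exact continuous_const.add (continuousOn_iff_continuous_domRestrict.1 hc)

/-! ### Bijectivity of `L ε` and a bound for its inverse -/

lemma L_mem_Y {ε : ℝ} (hε : 0 < ε) (f : X ε) : L ε f ∈ Y ε := by
  obtain ⟨g, hg⟩ := exists_derivative hε f
  have h := L_sub_eq_integral hε hg
  exact ⟨continuous_of_sub_eq_integral hε h, g, h⟩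

lemma pi_mul_normT_zero_mul_log_ne_zero {ε : ℝ} (hε : 0 < ε) (hε2 : ε < 2) :
    Real.pi * normT 0 * Real.log (ε / 2) ≠ 0 := by
  have := Real.log_neg (show 0 < ε / 2 by positivity) (by linarith)
  exact mul_ne_zero (mul_pos Real.pi_pos (normT_pos 0)).ne' this.ne

/-- A vanishing derivative of L f kills the modes n ≥ 1; the value of L f at one point then kills
the zero mode, because log(ε/2) ≠ 0. At ε = 2 this last step would fail. -/
lemma L_injective {ε : ℝ} (hε : 0 < ε) (hε2 : ε < 2) : Function.Injective (L ε) := by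
  intro f₁ f₂ h
  set f := f₁ - f₂ with hf
  have hL : ∀ x, L ε f x = 0 := by
    intro x
    rw [L_eq_inner hε, hf, inner_sub_right, ← L_eq_inner hε, ← L_eq_inner hε, h, sub_self]
  obtain ⟨g, hg⟩ := exists_derivative hε f
  have hg0 : g = 0 := eq_zero_of_integral_eq_zero hε fun x y => by
    rw [← L_sub_eq_integral hε hg, hL, hL, sub_self]
  have hpi : (Real.pi : ℂ) ≠ 0 := by exact_mod_cast Real.pi_pos.ne'
  have hsucc : ∀ n, (basisT hε).repr f (n + 1) = 0 := by
    intro n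
    have := hg n
    rw [hg0, map_zero] at this
    simpa [hpi] using this.symm
  have hx0 : (0 : ℝ) ∈ Icc (-ε) ε := ⟨by linarith, hε.le⟩
  have hinner : inner ℂ (logSeq hε ⟨0, hx0⟩) ((basisT hε).repr f) = 0 := by
    refine (hasSum_inner_logSeq hε ((basisT hε).repr f) ⟨0, hx0⟩).unique ?_
    convert! (hasSum_zero : HasSum (fun _ : ℕ => (0 : ℂ)) 0) using 2 with n
    rcases n with _ | n
    · simp [logCoeff]
    · rw [hsucc, mul_zero]
  have hzero : (basisT hε).repr f 0 = 0 := by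
    have := hL ⟨0, hx0⟩
    rw [L_eq_add hε, hinner, add_zero] at this
    refine (mul_eq_zero.1 this).resolve_left ?_
    exact_mod_cast pi_mul_normT_zero_mul_log_ne_zero hε hε2
  have : (basisT hε).repr f = 0 := by
    ext n
    rcases n with _ | n
    · exact hzero
    · exact hsucc n
  have hf0 : f = 0 := (basisT hε).repr.map_eq_zero_iff.1 this
  exact sub_eq_zero.1 hf0

/-- A bound for the functionals `f ↦ (L f)(x)` on the orthogonal complement of `vecT 0`. -/
def logBound : ℝ := ‖(⟨_, memℓp_pi_mul_normT_div⟩ : lp (fun _ : ℕ => ℝ) 2)‖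

lemma norm_logSeq_le {ε : ℝ} (hε : 0 < ε) (x : Icc (-ε) ε) : ‖logSeq hε x‖ ≤ logBound := by
  refine lp.norm_mono (by norm_num) fun n => ?_
  change ‖((logCoeff ε x n : ℝ) : ℂ)‖ ≤ ‖Real.pi * normT n / n‖
  rw [Complex.norm_real]
  exact (abs_logCoeff_le hε x n).trans (le_abs_self _)

lemma memℓp_shift (c : lp (fun _ : ℕ => ℂ) 2) :
    Memℓp (fun n : ℕ => if n = 0 then 0 else c (n - 1)) 2 := by
  refine memℓp_gen ((summable_nat_add_iff 1).1 ?_)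
  simpa using (lp.memℓp c).summable (by norm_num)

/-- The `ℓ²` sequence `0, c 0, c 1, …`. -/
def shiftSeq (c : lp (fun _ : ℕ => ℂ) 2) : lp (fun _ : ℕ => ℂ) 2 := ⟨_, memℓp_shift c⟩

lemma norm_shiftSeq (c : lp (fun _ : ℕ => ℂ) 2) : ‖shiftSeq c‖ = ‖c‖ := by
  have h2 : (0 : ℝ) < (2 : ENNReal).toReal := by norm_num
  rw [lp.norm_eq_tsum_rpow h2, lp.norm_eq_tsum_rpow h2,
    ((lp.memℓp (shiftSeq c)).summable h2).tsum_eq_zero_add]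
  congr 1
  simp [shiftSeq]

/-- The modes n ≥ 1 are read off from the derivative `g`, and the zero mode is fixed by matching the
value at `x₀`. Keeping `x₀` free lets the first term of the bound vanish when ψ has a zero. -/
lemma exists_L_eq {ε : ℝ} (hε : 0 < ε) (hε2 : ε < 2) {ψ : Icc (-ε) ε → ℂ} {g : X ε}
    (hψ : ∀ x y : Icc (-ε) ε, ψ y - ψ x = ∫ t in (x : ℝ)..(y : ℝ), g t) (x₀ : Icc (-ε) ε) :
    ∃ f : X ε, L ε f = ψ ∧ ‖f‖ ≤ (‖ψ x₀‖ + logBound * ‖g‖)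
      / |Real.pi * normT 0 * Real.log (ε / 2)| + ‖g‖ := by
  have hpi := Real.pi_gt_three
  set k : ℝ := Real.pi * normT 0 * Real.log (ε / 2) with hk
  have hk0 : (k : ℂ) ≠ 0 := by exact_mod_cast pi_mul_normT_zero_mul_log_ne_zero hε hε2
  set c : lp (fun _ : ℕ => ℂ) 2 := (-(Real.pi : ℂ)⁻¹) • shiftSeq ((basisU hε).repr g) with hc
  have hcn : ‖c‖ ≤ ‖g‖ := by
    rw [hc, norm_smul, norm_shiftSeq, LinearIsometryEquiv.norm_map, norm_neg, norm_inv,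
      Complex.norm_real, Real.norm_of_nonneg Real.pi_pos.le]
    refine mul_le_of_le_one_left (norm_nonneg _) (inv_le_one_of_one_le₀ (by linarith))
  -- The unique zero mode for which L f and ψ agree at `x₀`.
  set β : ℂ := (ψ x₀ - inner ℂ (logSeq hε x₀) c) / k with hβ
  have hrepr : (basisT hε).repr (β • vecT hε 0 + (basisT hε).repr.symm c)
      = β • lp.single 2 0 (1 : ℂ) + c := by
    rw [map_add, LinearIsometryEquiv.apply_symm_apply, map_smul, ← coe_basisT,
      HilbertBasis.repr_self]
  set f : X ε := β • vecT hε 0 + (basisT hε).repr.symm c with hf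
  have hsucc : ∀ n, (basisT hε).repr f (n + 1) = -(Real.pi : ℂ)⁻¹ * (basisU hε).repr g n := by
    intro n
    rw [hrepr]
    change β * lp.single (E := fun _ => ℂ) 2 0 (1 : ℂ) (n + 1)
      + -(Real.pi : ℂ)⁻¹ * (if n + 1 = 0 then 0 else (basisU hε).repr g (n + 1 - 1)) = _
    simp [lp.single_apply]
  have hder : ∀ n, (basisU hε).repr g n = -(Real.pi : ℂ) * (basisT hε).repr f (n + 1) := by
    intro n
    have : (Real.pi : ℂ) ≠ 0 := by exact_mod_cast Real.pi_pos.ne'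
    rw [hsucc]
    field_simp
  have hsub := L_sub_eq_integral hε hder
  have hx₀ : L ε f x₀ = ψ x₀ := by
    rw [L_eq_add hε, hrepr, inner_add_right, inner_smul_right, lp.inner_single_right]
    have h1 : (logSeq hε x₀) 0 = 0 := by simp [logSeq, logCoeff]
    have h2 : (β • lp.single 2 0 (1 : ℂ) + c : lp (fun _ : ℕ => ℂ) 2) 0 = β := by
      change β * lp.single (E := fun _ => ℂ) 2 0 (1 : ℂ) 0
        + -(Real.pi : ℂ)⁻¹ * (if 0 = 0 then 0 else (basisU hε).repr g (0 - 1)) = _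
      simp
    rw [h2, h1, inner_zero_left, mul_zero, zero_add, hβ]
    field_simp
    ring
  refine ⟨f, ?_, ?_⟩
  · funext y
    have h1 := hsub x₀ y
    rw [← hψ x₀ y, hx₀] at h1
    exact sub_left_injective h1
  · have hβn : ‖β‖ ≤ (‖ψ x₀‖ + logBound * ‖g‖) / |k| := by
      rw [hβ, norm_div, Complex.norm_real, Real.norm_eq_abs]
      gcongr
      refine (norm_sub_le _ _).trans ?_
      gcongr
      refine (norm_inner_le_norm _ _).trans ?_
      exact mul_le_mul (norm_logSeq_le hε x₀) hcn (norm_nonneg _) (norm_nonneg _)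
    rw [hf]
    refine (norm_add_le _ _).trans (add_le_add ?_ ?_)
    · rw [norm_smul, (orthonormal_vecT hε).1, mul_one]
      exact hβn
    · rw [LinearIsometryEquiv.norm_map]
      exact hcn

lemma bijOn_L {ε : ℝ} (hε : 0 < ε) (hε2 : ε < 2) : BijOn (L ε) univ (Y ε) := by
  refine ⟨fun f _ => L_mem_Y hε f, (L_injective hε hε2).injOn, ?_⟩
  rintro ψ ⟨-, g, hg⟩
  obtain ⟨f, hf, -⟩ := exists_L_eq hε hε2 hg ⟨0, by linarith, hε.le⟩
  exact ⟨f, mem_univ _, hf⟩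

lemma Linv_L {ε : ℝ} (hε : 0 < ε) (hε2 : ε < 2) (f : X ε) : Linv ε (L ε f) = f :=
  (L_injective hε hε2).injOn.leftInvOn_invFunOn (mem_univ f)

/-! ### Asymptotics of the inverse on Lipschitz functions -/

/-- Real and imaginary parts are absolutely continuous with derivatives bounded by M. The factor ε
is the square root of the total mass of the weight. -/
lemma exists_derivative_of_lipschitz {ε M : ℝ} (hε : 0 < ε) (hM : 0 ≤ M) {ψ : ℝ → ℂ}
    (hψ : ∀ x ∈ Icc (-ε) ε, ∀ y ∈ Icc (-ε) ε, ‖ψ x - ψ y‖ ≤ M * |x - y|) :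
    ∃ g : X ε, (∀ x y : Icc (-ε) ε, ψ y - ψ x = ∫ t in (x : ℝ)..(y : ℝ), g t) ∧
      ‖g‖ ≤ 4 * M * ε := by
  have hre : LipschitzOnWith M.toNNReal (fun t => (ψ t).re) (Icc (-ε) ε) := by
    refine LipschitzOnWith.of_dist_le_mul fun x hx y hy => ?_
    rw [Real.coe_toNNReal M hM, Real.dist_eq, Real.dist_eq, ← Complex.sub_re]
    exact (Complex.abs_re_le_norm _).trans (hψ x hx y hy)
  have him : LipschitzOnWith M.toNNReal (fun t => (ψ t).im) (Icc (-ε) ε) := by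
    refine LipschitzOnWith.of_dist_le_mul fun x hx y hy => ?_
    rw [Real.coe_toNNReal M hM, Real.dist_eq, Real.dist_eq, ← Complex.sub_im]
    exact (Complex.abs_im_le_norm _).trans (hψ x hx y hy)
  set g₀ : ℝ → ℂ := fun t => ((deriv (fun t => (ψ t).re) t : ℝ) : ℂ)
    + ((deriv (fun t => (ψ t).im) t : ℝ) : ℂ) * Complex.I with hg₀
  have hbound : ∀ᵐ t ∂weightMeasure ε, ‖g₀ t‖ ≤ 2 * M := by
    refine (weightMeasure_absolutelyContinuous ε).ae_le ?_
    filter_upwards [ae_mem_Ioo ε] with t ht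
    have hn := Icc_mem_nhds ht.1 ht.2
    have h1 := norm_deriv_le_of_lipschitzOn hn hre
    have h2 := norm_deriv_le_of_lipschitzOn hn him
    rw [Real.coe_toNNReal M hM] at h1 h2
    refine (norm_add_le _ _).trans ?_
    rw [norm_mul, Complex.norm_I, mul_one, Complex.norm_real, Complex.norm_real]
    linarith
  have hmeas : AEStronglyMeasurable g₀ (weightMeasure ε) :=
    ((Complex.measurable_ofReal.comp (measurable_deriv _)).add
      ((Complex.measurable_ofReal.comp (measurable_deriv _)).mul_const _)).aestronglyMeasurable
  have hmem : MemLp g₀ 2 (weightMeasure ε) := MemLp.of_bound hmeas _ hbound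
  have hcoe : ⇑(hmem.toLp g₀) =ᵐ[volume.restrict (Icc (-ε) ε)] g₀ :=
    (absolutelyContinuous_weightMeasure ε).ae_le hmem.coeFn_toLp
  refine ⟨hmem.toLp g₀, fun x y => ?_, ?_⟩
  · have hsub : uIcc (x : ℝ) y ⊆ Icc (-ε) ε :=
      (convex_Icc (-ε) ε).ordConnected.uIcc_subset x.2 y.2
    have h1 := (hre.mono hsub).absolutelyContinuousOnInterval
    have h2 := (him.mono hsub).absolutelyContinuousOnInterval
    have h3 : ∫ t in (x : ℝ)..(y : ℝ), (hmem.toLp g₀) t = ∫ t in (x : ℝ)..(y : ℝ), g₀ t := by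
      refine intervalIntegral.integral_congr_ae ?_
      rw [EventuallyEq, ae_restrict_iff' measurableSet_Icc] at hcoe
      filter_upwards [hcoe] with t ht hmem
      exact ht (hsub (uIoc_subset_uIcc hmem))
    rw [h3, hg₀, intervalIntegral.integral_add, intervalIntegral.integral_mul_const,
      intervalIntegral.integral_ofReal, intervalIntegral.integral_ofReal,
      h1.integral_deriv_eq_sub, h2.integral_deriv_eq_sub]
    · apply Complex.ext <;> simp
    · have h := h1.intervalIntegrable_deriv
      exact ⟨h.1.ofReal, h.2.ofReal⟩
    · have h := h2.intervalIntegrable_deriv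
      exact IntervalIntegrable.mul_const ⟨h.1.ofReal, h.2.ofReal⟩ _
  · have hn := Lp.norm_le_of_ae_bound (f := hmem.toLp g₀) (C := 2 * M) (by positivity)
      (by filter_upwards [hmem.coeFn_toLp, hbound] with t h1 h2; rw [h1]; exact h2)
    -- The weight is at most ε on an interval of length 2ε.
    have hμ : (weightMeasure ε).real univ ≤ 2 * ε ^ 2 := by
      have h1 : ((weightMeasure ε).real univ : ℂ) = ∫ _, (1 : ℂ) ∂weightMeasure ε := by
        simp
      rw [integral_weightMeasure hε.le] at h1
      have h2 : ‖∫ y in (-ε)..ε, (weight ε y : ℂ) * 1‖ ≤ ε * |ε - -ε| := by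
        refine intervalIntegral.norm_integral_le_of_norm_le_const fun y _ => ?_
        rw [mul_one, Complex.norm_real, Real.norm_of_nonneg (weight_nonneg ε y)]
        exact weight_le hε.le y
      rw [← h1, Complex.norm_real, Real.norm_of_nonneg measureReal_nonneg,
        abs_of_pos (by linarith)] at h2
      linarith
    refine hn.trans ?_
    have h4 : ((weightMeasure ε).real univ) ^ (2 : ENNReal).toReal⁻¹ ≤ 2 * ε := by
      rw [ENNReal.toReal_ofNat, ← one_div, ← Real.sqrt_eq_rpow]
      refine (Real.sqrt_le_left (by positivity)).2 ?_
      nlinarith [sq_nonneg ε]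
    have h5 : (measureUnivNNReal (weightMeasure ε) : ℝ) = (weightMeasure ε).real univ := rfl
    rw [h5]
    calc _ ≤ 2 * ε * (2 * M) := by gcongr
      _ = _ := by ring

lemma pairing_eq_inner {ε : ℝ} (hε : 0 < ε) {φ : ℝ → ℂ}
    (hφ : MemLp (fun y => φ y / weight ε y) 2 (weightMeasure ε)) (f : X ε) :
    pairing ε f φ = inner ℂ f (divWeight φ hφ) := by
  rw [← inner_conj_symm, inner_eq_integral_of_ae_eq hε.le (coeFn_divWeight hφ), pairing,
    intervalIntegral.integral_of_le (by linarith), intervalIntegral.integral_of_le (by linarith),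
    ← integral_conj]
  refine integral_congr_ae (Eventually.of_forall fun y => ?_)
  simp [mul_comm]

lemma norm_pairing_le {ε S : ℝ} (hε : 0 < ε) {φ : ℝ → ℂ}
    (hφ : AEStronglyMeasurable φ (volume.restrict (Icc (-ε) ε)))
    (hS : ∀ y ∈ Icc (-ε) ε, ‖φ y‖ ≤ S) (f : X ε) :
    ‖pairing ε f φ‖ ≤ S * Real.sqrt Real.pi * ‖f‖ := by
  have h := memLp_div_weight hε hφ hS
  rw [pairing_eq_inner hε h, ← inner_conj_symm, RCLike.norm_conj,
    inner_eq_integral_of_ae_eq hε.le (coeFn_divWeight h)]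
  exact norm_integral_mul_le hε hφ hS f

lemma pairing_add_left {ε : ℝ} (hε : 0 < ε) {φ : ℝ → ℂ}
    (hφ : MemLp (fun y => φ y / weight ε y) 2 (weightMeasure ε)) (f g : X ε) (a : ℂ) :
    pairing ε (a • f + g : X ε) φ = conj a * pairing ε f φ + pairing ε g φ := by
  rw [pairing_eq_inner hε hφ, pairing_eq_inner hε hφ, pairing_eq_inner hε hφ, inner_add_left,
    inner_smul_left]

lemma pairing_add_right {ε : ℝ} (hε : 0 < ε) {φ₁ φ₂ : ℝ → ℂ}
    (h₁ : MemLp (fun y => φ₁ y / weight ε y) 2 (weightMeasure ε))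
    (h₂ : MemLp (fun y => φ₂ y / weight ε y) 2 (weightMeasure ε)) (f : X ε) :
    pairing ε f (fun y => φ₁ y + φ₂ y) = pairing ε f φ₁ + pairing ε f φ₂ := by
  have h : ∀ φ : ℝ → ℂ, MemLp (fun y => φ y / weight ε y) 2 (weightMeasure ε) →
      IntervalIntegrable (fun y => conj (f y) * φ y) volume (-ε) ε := fun φ hφ => by
    refine intervalIntegrable_of_integrable_Icc hε.le ?_
    have h' : MemLp (fun y => conj (φ y) / weight ε y) 2 (weightMeasure ε) := by
      convert! hφ.star using 1
      funext y
      simp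
    have := (Complex.conjCLE.toContinuousLinearMap.integrable_comp
      (integrable_mul_of_memLp_div_weight h' f))
    refine this.congr (Eventually.of_forall fun y => ?_)
    simp [mul_comm]
  simp only [pairing, mul_add]
  exact intervalIntegral.integral_add (h _ h₁) (h _ h₂)

/-- The arcsine density has constant logarithmic potential on the interval; it inverts `L ε` on
constants. -/
lemma L_vecT_zero {ε : ℝ} (hε : 0 < ε) (x : Icc (-ε) ε) :
    L ε (vecT hε 0) x = ((Real.pi * normT 0 * Real.log (ε / 2) : ℝ) : ℂ) := by
  have h : (basisT hε).repr (vecT hε 0) = lp.single 2 0 (1 : ℂ) := by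
    rw [← coe_basisT, HilbertBasis.repr_self]
  have h1 : (logSeq hε x) 0 = 0 := by simp [logSeq, logCoeff]
  rw [L_eq_add hε, h, lp.inner_single_right, h1, inner_zero_left, add_zero]
  simp

lemma pairing_vecT_zero_one {ε : ℝ} (hε : 0 < ε) (c : ℂ) :
    pairing ε (vecT hε 0) (fun _ => c) = ((Real.pi * normT 0 : ℝ) : ℂ) * c := by
  have h1 : pairing ε (vecT hε 0) (fun _ => c)
      = ∫ y in (-ε)..ε, ((normT 0 / weight ε y : ℝ) : ℂ) * c := by
    refine intervalIntegral_congr_ae_Icc hε.le ?_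
    filter_upwards [coeFn_divWeight (memLp_basisT hε 0)] with y hy
    rw [vecT, hy, map_div₀, Complex.conj_ofReal, Complex.conj_ofReal]
    simp [chebT]
  rw [h1, intervalIntegral.integral_mul_const, intervalIntegral.integral_ofReal,
    integral_div_weight hε (fun _ => normT 0)]
  have := Polynomial.Chebyshev.integral_eval_T_real_measureT_zero
  simp only [Polynomial.Chebyshev.T_zero, Polynomial.eval_one] at this
  have h2 : ∫ _, normT 0 ∂Polynomial.Chebyshev.measureT
      = normT 0 * ∫ _, (1 : ℝ) ∂Polynomial.Chebyshev.measureT := by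
    rw [← integral_const_mul, mul_one]
  rw [h2, this, mul_comm Real.pi]

lemma one_le_pi_mul_normT_zero : 1 ≤ Real.pi * normT 0 := by
  have h := pi_mul_normT_zero_mul_normT_zero
  have hpi := Real.pi_gt_three
  nlinarith [normT_pos 0, sq_nonneg (normT 0 - 1), mul_pos Real.pi_pos (normT_pos 0)]

/-- Apply |x log x| < 1 to x = √ε and square. -/
lemma mul_sq_log_le {ε : ℝ} (hε : 0 < ε) (hε1 : ε < 1) : ε * |Real.log ε| ^ 2 ≤ 4 := by
  have hs : 0 < Real.sqrt ε := Real.sqrt_pos.2 hε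
  have h := Real.abs_log_mul_self_lt (Real.sqrt ε) hs (Real.sqrt_le_one.2 hε1.le)
  rw [Real.log_sqrt hε.le, abs_mul, abs_div, abs_of_pos hs, abs_two] at h
  have h2 : |Real.log ε| * Real.sqrt ε ≤ 2 := by linarith
  have h3 : (|Real.log ε| * Real.sqrt ε) ^ 2 ≤ 2 ^ 2 := by gcongr
  rw [mul_pow, Real.sq_sqrt hε.le] at h3
  linarith

/-- Split ψ = ψ(0) + (ψ - ψ(0)). The constant inverts to a multiple of `vecT hε 0` of size O(1/|log
ε|) and gives the leading term; the rest has a preimage of norm O(ε). All constants involve only M,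
S and `logBound`. -/
lemma estimates_of_lipschitz {ε M S : ℝ} (hε : 0 < ε) (hε1 : ε < 1) (hM : 0 ≤ M) {ψ : ℝ → ℂ}
    (hψ : ∀ x ∈ Icc (-ε) ε, ∀ y ∈ Icc (-ε) ε, ‖ψ x - ψ y‖ ≤ M * |x - y|) (hS : ‖ψ 0‖ ≤ S) :
    (fun y : Icc (-ε) ε => ψ y) ∈ Y ε ∧
    ‖pairing ε (Linv ε fun y => ψ y) ψ - ((‖ψ 0‖ ^ 2 / Real.log ε : ℝ) : ℂ)‖
      ≤ (S ^ 2 + 4 * (2 * S * (M * Real.sqrt Real.pi)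
        + (S + M) * Real.sqrt Real.pi * ((2 * logBound + 1) * (4 * M)))) / |Real.log ε| ^ 2 ∧
    ∀ B : X ε →L[ℂ] X ε, ‖pairing ε (B (Linv ε fun y => ψ y)) ψ‖
      ≤ ((S + M) * Real.sqrt Real.pi * (S + (2 * logBound + 1) * (4 * M)))
        * ‖B‖ / |Real.log ε| := by
  have hS0 : 0 ≤ S := (norm_nonneg _).trans hS
  have hb0 : 0 ≤ logBound := norm_nonneg _
  have hzero : (0 : ℝ) ∈ Icc (-ε) ε := ⟨by linarith, hε.le⟩
  obtain ⟨g, hg, hgn⟩ := exists_derivative_of_lipschitz hε hM hψ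
  have hY : (fun y : Icc (-ε) ε => ψ y) ∈ Y ε := ⟨continuous_of_sub_eq_integral hε hg, g, hg⟩
  have hlog : Real.log ε < 0 := Real.log_neg hε hε1
  have hlog2 : Real.log (ε / 2) = Real.log ε - Real.log 2 :=
    Real.log_div hε.ne' two_ne_zero
  have hl2 : 0 < Real.log 2 := Real.log_pos one_lt_two
  have hl2' := Real.log_two_gt_d9
  have hl2'' := Real.log_two_lt_d9
  set k : ℝ := Real.pi * normT 0 * Real.log (ε / 2) with hk
  have hkneg : k < 0 := mul_neg_of_pos_of_neg (mul_pos Real.pi_pos (normT_pos 0)) (by linarith)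
  -- Here π · normT(0) = √π ≥ 1 and |log(ε/2)| exceeds |log ε|.
  have hk1 : |Real.log ε| ≤ |k| := by
    rw [abs_of_neg hlog, abs_of_neg hkneg, hk]
    nlinarith [one_le_pi_mul_normT_zero]
  -- From ε < 1, |log(ε/2)| ≥ log 2 > 1/2; this removes k from the bound on `f₁`.
  have hk2 : 1 / 2 ≤ |k| := by
    rw [abs_of_neg hkneg, hk]
    nlinarith [one_le_pi_mul_normT_zero]
  -- decomposition of `ψ`
  obtain ⟨f₁, hf₁, hf₁n⟩ := exists_L_eq hε (by linarith)
    (ψ := fun y : Icc (-ε) ε => ψ y - ψ 0) (g := g) (by intro x y; rw [← hg]; ring) ⟨0, hzero⟩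
  have hf₁n' : ‖f₁‖ ≤ (2 * logBound + 1) * (4 * M) * ε := by
    refine hf₁n.trans ?_
    -- The base point is 0, where ψ - ψ(0) vanishes, so only the O(ε) norm of `g` remains.
    simp only [sub_self, norm_zero, zero_add]
    rw [← hk]
    have : logBound * ‖g‖ / |k| ≤ 2 * (logBound * ‖g‖) := by
      rw [div_le_iff₀ (by linarith)]
      nlinarith [mul_nonneg hb0 (norm_nonneg g)]
    nlinarith [norm_nonneg g, mul_le_mul_of_nonneg_left hgn hb0]
  set a : ℂ := ψ 0 / k with ha
  have hkC : (k : ℂ) ≠ 0 := by exact_mod_cast hkneg.ne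
  have hLf : L ε (a • vecT hε 0 + f₁) = fun y : Icc (-ε) ε => ψ y := by
    funext y
    rw [L_eq_inner hε, inner_add_right, inner_smul_right, ← L_eq_inner hε, ← L_eq_inner hε,
      L_vecT_zero, hf₁, ← hk, ha]
    field_simp
    ring
  have hinv : Linv ε (fun y : Icc (-ε) ε => ψ y) = a • vecT hε 0 + f₁ := by
    rw [← hLf, Linv_L hε (by linarith)]
  have han : ‖a‖ ≤ S / |Real.log ε| := by
    rw [ha, norm_div, Complex.norm_real, Real.norm_eq_abs]
    have : 0 < |Real.log ε| := abs_pos.2 hlog.ne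
    gcongr
  -- bounds and measurability of `ψ`
  have hcont : ContinuousOn ψ (Icc (-ε) ε) := continuousOn_iff_continuous_domRestrict.2 hY.1
  have hmeas : AEStronglyMeasurable ψ (volume.restrict (Icc (-ε) ε)) :=
    hcont.aestronglyMeasurable measurableSet_Icc
  have hdiff : ∀ y ∈ Icc (-ε) ε, ‖ψ y - ψ 0‖ ≤ M * ε := fun y hy => by
    refine (hψ y hy 0 hzero).trans ?_
    gcongr
    rw [sub_zero, abs_le]
    exact hy
  have hsup : ∀ y ∈ Icc (-ε) ε, ‖ψ y‖ ≤ S + M := fun y hy => by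
    have h1 := hdiff y hy
    have h2 : ‖ψ y‖ ≤ ‖ψ y - ψ 0‖ + ‖ψ 0‖ := by
      simpa using norm_add_le (ψ y - ψ 0) (ψ 0)
    nlinarith
  have hmeas1 : AEStronglyMeasurable (fun y => ψ y - ψ 0) (volume.restrict (Icc (-ε) ε)) :=
    hmeas.sub aestronglyMeasurable_const
  have hLp := memLp_div_weight hε hmeas hsup
  have hLp1 := memLp_div_weight hε hmeas1 hdiff
  have hLp0 := memLp_div_weight (k := fun _ => ψ 0) (C := S) hε aestronglyMeasurable_const
    (fun _ _ => hS)
  have hpos : 0 < |Real.log ε| := abs_pos.2 hlog.ne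
  have hε4 : ε ≤ 4 / |Real.log ε| ^ 2 := by
    rw [le_div_iff₀ (by positivity)]
    exact mul_sq_log_le hε hε1
  have hε5 : ε ≤ 1 / |Real.log ε| := by
    rw [le_div_iff₀ hpos]
    have := Real.abs_log_mul_self_lt ε hε hε1.le
    rw [abs_mul, abs_of_pos hε] at this
    linarith
  refine ⟨hY, ?_, fun B => ?_⟩
  · rw [hinv, pairing_add_left hε hLp]
    have hsplit : pairing ε (vecT hε 0) ψ
        = ((Real.pi * normT 0 : ℝ) : ℂ) * ψ 0 + pairing ε (vecT hε 0) (fun y => ψ y - ψ 0) := by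
      rw [← pairing_vecT_zero_one hε, ← pairing_add_right hε hLp0 hLp1]
      congr 1
      funext y
      ring
    have hmain : conj a * (((Real.pi * normT 0 : ℝ) : ℂ) * ψ 0)
        = ((‖ψ 0‖ ^ 2 / Real.log (ε / 2) : ℝ) : ℂ) := by
      rw [ha, map_div₀, Complex.conj_ofReal]
      have h1 : conj (ψ 0) * ψ 0 = ((‖ψ 0‖ ^ 2 : ℝ) : ℂ) := by
        rw [mul_comm, Complex.mul_conj, Complex.normSq_eq_norm_sq]
      have h2 : Real.pi * normT 0 / k = 1 / Real.log (ε / 2) := by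
        rw [hk]
        have h3 : Real.log (ε / 2) ≠ 0 := by linarith
        have h4 := (normT_pos 0).ne'
        field_simp
      calc conj (ψ 0) / k * (((Real.pi * normT 0 : ℝ) : ℂ) * ψ 0)
          = (conj (ψ 0) * ψ 0) * ((Real.pi * normT 0 / k : ℝ) : ℂ) := by push_cast; ring
        _ = _ := by rw [h1, h2, ← Complex.ofReal_mul, mul_one_div]
    rw [hsplit, mul_add, hmain]
    -- The difference is |ψ(0)|² log 2 / (log(ε/2) log ε), and log 2 < 1.
    have hA : ‖((‖ψ 0‖ ^ 2 / Real.log (ε / 2) : ℝ) : ℂ) - ((‖ψ 0‖ ^ 2 / Real.log ε : ℝ) : ℂ)‖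
        ≤ S ^ 2 / |Real.log ε| ^ 2 := by
      rw [← Complex.ofReal_sub, Complex.norm_real, Real.norm_eq_abs]
      have hd : ‖ψ 0‖ ^ 2 / Real.log (ε / 2) - ‖ψ 0‖ ^ 2 / Real.log ε
          = ‖ψ 0‖ ^ 2 * Real.log 2 / (Real.log (ε / 2) * Real.log ε) := by
        have h3 : Real.log (ε / 2) ≠ 0 := by linarith
        have h4 := hlog.ne
        field_simp
        rw [hlog2]; ring
      rw [hd, abs_div, abs_mul, abs_of_nonneg (sq_nonneg _), abs_of_pos hl2, abs_mul, sq |Real.log ε|]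
      have h6 : |Real.log ε| ≤ |Real.log (ε / 2)| := by
        rw [abs_of_neg hlog, abs_of_neg (by linarith)]; linarith
      have h7 : ‖ψ 0‖ ^ 2 * Real.log 2 ≤ S ^ 2 := by
        have : ‖ψ 0‖ ^ 2 ≤ S ^ 2 := by gcongr
        nlinarith [sq_nonneg ‖ψ 0‖]
      gcongr
    have hB : ‖conj a * pairing ε (vecT hε 0) (fun y => ψ y - ψ 0)‖
        ≤ 2 * S * (M * Real.sqrt Real.pi) * (4 / |Real.log ε| ^ 2) := by
      have h1 := norm_pairing_le hε hmeas1 hdiff (vecT hε 0)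
      rw [(orthonormal_vecT hε).1, mul_one] at h1
      have h2 : ‖a‖ ≤ 2 * S := by
        rw [ha, norm_div, Complex.norm_real, Real.norm_eq_abs, div_le_iff₀ (by linarith)]
        nlinarith [norm_nonneg (ψ 0)]
      rw [norm_mul, RCLike.norm_conj]
      calc ‖a‖ * ‖pairing ε (vecT hε 0) (fun y => ψ y - ψ 0)‖
          ≤ 2 * S * (M * ε * Real.sqrt Real.pi) := by gcongr
        _ = 2 * S * (M * Real.sqrt Real.pi) * ε := by ring
        _ ≤ _ := by gcongr
    have hC : ‖pairing ε f₁ ψ‖ ≤ (S + M) * Real.sqrt Real.pi * ((2 * logBound + 1) * (4 * M))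
        * (4 / |Real.log ε| ^ 2) := by
      refine (norm_pairing_le hε hmeas hsup f₁).trans ?_
      calc (S + M) * Real.sqrt Real.pi * ‖f₁‖
          ≤ (S + M) * Real.sqrt Real.pi * ((2 * logBound + 1) * (4 * M) * ε) := by gcongr
        _ = (S + M) * Real.sqrt Real.pi * ((2 * logBound + 1) * (4 * M)) * ε := by ring
        _ ≤ _ := by gcongr
    calc _ = ‖(((‖ψ 0‖ ^ 2 / Real.log (ε / 2) : ℝ) : ℂ) - ((‖ψ 0‖ ^ 2 / Real.log ε : ℝ) : ℂ))
          + conj a * pairing ε (vecT hε 0) (fun y => ψ y - ψ 0) + pairing ε f₁ ψ‖ := by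
            congr 1; ring
      _ ≤ _ := norm_add₃_le
      _ ≤ S ^ 2 / |Real.log ε| ^ 2 + 2 * S * (M * Real.sqrt Real.pi) * (4 / |Real.log ε| ^ 2)
          + (S + M) * Real.sqrt Real.pi * ((2 * logBound + 1) * (4 * M))
            * (4 / |Real.log ε| ^ 2) := by gcongr
      _ = _ := by ring
  · refine (norm_pairing_le hε hmeas hsup _).trans ?_
    have hf : ‖a • vecT hε 0 + f₁‖ ≤ (S + (2 * logBound + 1) * (4 * M)) * (1 / |Real.log ε|) := by
      refine (norm_add_le _ _).trans ?_
      rw [norm_smul, (orthonormal_vecT hε).1, mul_one]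
      have : ‖f₁‖ ≤ (2 * logBound + 1) * (4 * M) * (1 / |Real.log ε|) :=
        hf₁n'.trans (by gcongr)
      rw [add_mul, mul_one_div]
      gcongr
    rw [hinv]
    calc (S + M) * Real.sqrt Real.pi * ‖B (a • vecT hε 0 + f₁)‖
        ≤ (S + M) * Real.sqrt Real.pi * (‖B‖ * ((S + (2 * logBound + 1) * (4 * M))
          * (1 / |Real.log ε|))) := by
          gcongr
          exact (B.le_opNorm _).trans (by gcongr)
      _ = _ := by ring

/-! ### Testing the Neumann problem up to a flat part of the boundary -/

lemma fderiv_ofReal_comp {v : ℝ × ℝ → ℝ} (hv : Differentiable ℝ v) (p e : ℝ × ℝ) :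
    fderiv ℝ (fun q => (v q : ℂ)) p e = (fderiv ℝ v p e : ℂ) := by
  have h := (Complex.ofRealCLM.hasFDerivAt (x := v p)).comp p (hv p).hasFDerivAt
  have h2 : HasFDerivAt (fun q => (v q : ℂ)) (Complex.ofRealCLM.comp (fderiv ℝ v p)) p := h
  rw [h2.fderiv]
  rfl

lemma contDiff_ofReal_comp {v : ℝ × ℝ → ℝ} (hv : ContDiff ℝ ∞ v) :
    ContDiff ℝ ∞ (fun p => (v p : ℂ)) :=
  Complex.ofRealCLM.contDiff.comp hv

lemma contDiff_fderiv_apply {v : ℝ × ℝ → ℝ} (hv : ContDiff ℝ ∞ v) (e : ℝ × ℝ) :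
    ContDiff ℝ ∞ (fun p => fderiv ℝ v p e) :=
  (hv.fderiv_right (m := ∞) (by norm_cast)).clm_apply contDiff_const

lemma hasCompactSupport_ofReal_comp {v : ℝ × ℝ → ℝ} (hv : HasCompactSupport v) :
    HasCompactSupport (fun p => (v p : ℂ)) :=
  hv.comp_left (g := fun x : ℝ => (x : ℂ)) Complex.ofReal_zero

lemma setIntegral_mul_fderiv_eq {U : Set (ℝ × ℝ)} {v : ℝ × ℝ → ℝ} (hv : ContDiff ℝ ∞ v)
    (hvc : HasCompactSupport v) {φ : ℝ × ℝ → ℂ} (hφ : ContDiff ℝ ∞ φ) (hφc : HasCompactSupport φ)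
    (hφU : tsupport φ ⊆ U) (e : ℝ × ℝ) :
    ∫ p in U, (v p : ℂ) * fderiv ℝ φ p e = -∫ p in U, (fderiv ℝ v p e : ℂ) * φ p := by
  have hvd := hv.differentiable (by norm_num)
  have hφd := hφ.differentiable (by norm_num)
  have hV := (contDiff_ofReal_comp hv).continuous
  have hV' : Continuous fun p => (fderiv ℝ v p e : ℂ) :=
    (contDiff_ofReal_comp (contDiff_fderiv_apply hv e)).continuous
  have hφ' : Continuous fun p => fderiv ℝ φ p e :=
    ((hφ.continuous_fderiv (by norm_num)).clm_apply continuous_const)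
  rw [setIntegral_eq_integral_of_forall_compl_eq_zero, setIntegral_eq_integral_of_forall_compl_eq_zero]
  · have h := integral_mul_fderiv_eq_neg_fderiv_mul_of_integrable (μ := volume)
      (f := fun p => (v p : ℂ)) (g := φ) (v := e) ?_ ?_ ?_ ?_ (fun p _ => hφd p)
    · rw [h]
      simp only [fderiv_ofReal_comp hvd]
    · simp only [fderiv_ofReal_comp hvd]
      exact (hV'.mul hφ.continuous).integrable_of_hasCompactSupport hφc.mul_left
    · exact (hV.mul hφ').integrable_of_hasCompactSupport
        (hasCompactSupport_ofReal_comp hvc).mul_right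
    · exact (hV.mul hφ.continuous).integrable_of_hasCompactSupport hφc.mul_left
    · exact fun p _ => (contDiff_ofReal_comp hv).differentiable (by norm_num) p
  · intro p hp
    rw [image_eq_zero_of_notMem_tsupport (fun h => hp (hφU h)), mul_zero]
  · intro p hp
    rw [fderiv_of_notMem_tsupport ℝ (fun h => hp (hφU h))]
    simp

/-- The support of `v` may cross the boundary of `U`: only the test functions of the weak gradient
must be supported inside. The Neumann condition enters the proof through such `v`. -/
lemma hasH1Gradient_of_contDiff (U : Set (ℝ × ℝ)) {v : ℝ × ℝ → ℝ} (hv : ContDiff ℝ ∞ v)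
    (hvc : HasCompactSupport v) :
    HasH1Gradient U (fun p => (v p : ℂ)) (fun p => (fderiv ℝ v p (1, 0) : ℂ))
      (fun p => (fderiv ℝ v p (0, 1) : ℂ)) := by
  have key : ∀ w : ℝ × ℝ → ℝ, ContDiff ℝ ∞ w → HasCompactSupport w →
      MemLp (fun p => (w p : ℂ)) 2 (volume.restrict U) := fun w hw hwc =>
    ((contDiff_ofReal_comp hw).continuous.memLp_of_hasCompactSupport
      (hasCompactSupport_ofReal_comp hwc)).restrict U
  refine ⟨key v hv hvc, key _ (contDiff_fderiv_apply hv _) (hvc.fderiv_apply ℝ _),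
    key _ (contDiff_fderiv_apply hv _) (hvc.fderiv_apply ℝ _), fun φ h1 h2 h3 => ?_,
    fun φ h1 h2 h3 => ?_⟩
  · exact setIntegral_mul_fderiv_eq hv hvc h1 h2 h3 _
  · exact setIntegral_mul_fderiv_eq hv hvc h1 h2 h3 _

/-- Near the point `(c, 0)` the set `U` is the half-plane `0 < σ (x - c)`. -/
structure IsHalfPlaneNear (U : Set (ℝ × ℝ)) (c σ r : ℝ) : Prop where
  pos : 0 < r
  ne_zero : σ ≠ 0
  mem_iff : ∀ p : ℝ × ℝ, |p.1 - c| < r → |p.2| < r → (p ∈ U ↔ 0 < σ * (p.1 - c))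

/-- The open square of radius `r` around `(c, 0)`. -/
def square (c r : ℝ) : Set (ℝ × ℝ) := {p | |p.1 - c| < r ∧ |p.2| < r}

/-- A smooth cutoff that vanishes for `σ (x - c) ≤ 1 / s` and equals `1` for
`σ (x - c) ≥ 2 / s`. -/
def sideCutoff (c σ s : ℝ) (p : ℝ × ℝ) : ℝ := Real.smoothTransition (s * (σ * (p.1 - c)) - 1)

lemma contDiff_sideCutoff (c σ s : ℝ) : ContDiff ℝ ∞ (sideCutoff c σ s) :=
  Real.smoothTransition.contDiff.comp (by fun_prop)

lemma fderiv_sideCutoff (c σ s : ℝ) (p e : ℝ × ℝ) :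
    fderiv ℝ (sideCutoff c σ s) p e
      = deriv Real.smoothTransition (s * (σ * (p.1 - c)) - 1) * (s * (σ * e.1)) := by
  have h1 : HasFDerivAt (fun q : ℝ × ℝ => s * (σ * (q.1 - c)) - 1)
      (s • (σ • ContinuousLinearMap.fst ℝ ℝ ℝ)) p :=
    ((((ContinuousLinearMap.fst ℝ ℝ ℝ).hasFDerivAt.sub_const c).const_mul σ).const_mul s).sub_const 1
  have h2 := (Real.smoothTransition.contDiff (n := 1)).differentiable (by norm_num)
    (s * (σ * (p.1 - c)) - 1)
  have h3 := h2.hasDerivAt.comp_hasFDerivAt p h1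
  have h4 : HasFDerivAt (sideCutoff c σ s) _ p := h3
  rw [h4.fderiv]
  simp

lemma exists_bound_deriv_smoothTransition :
    ∃ D : ℝ, 0 ≤ D ∧ (∀ x, |deriv Real.smoothTransition x| ≤ D) ∧
      ∀ x, 1 < x → deriv Real.smoothTransition x = 0 := by
  have hc : Continuous (deriv Real.smoothTransition) :=
    (Real.smoothTransition.contDiff (n := 1)).continuous_deriv le_rfl
  obtain ⟨D, hD⟩ := isCompact_Icc.exists_bound_of_continuousOn (s := Icc (0 : ℝ) 1) hc.continuousOn
  have h1 : ∀ x, 1 < x → deriv Real.smoothTransition x = 0 := by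
    intro x hx
    have : Real.smoothTransition =ᶠ[𝓝 x] fun _ => 1 := by
      filter_upwards [lt_mem_nhds hx] with y hy using Real.smoothTransition.one_of_one_le hy.le
    rw [this.deriv_eq, deriv_const]
  have h0 : ∀ x, x < 0 → deriv Real.smoothTransition x = 0 := by
    intro x hx
    have : Real.smoothTransition =ᶠ[𝓝 x] fun _ => 0 := by
      filter_upwards [gt_mem_nhds hx] with y hy using Real.smoothTransition.zero_of_nonpos hy.le
    rw [this.deriv_eq, deriv_const]
  have hD0 : 0 ≤ D := (norm_nonneg _).trans (hD 0 (by simp))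
  refine ⟨D, hD0, fun x => ?_, h1⟩
  by_cases hx : x ∈ Icc (0 : ℝ) 1
  · exact hD x hx
  · rcases not_and_or.1 hx with h | h
    · rw [h0 x (not_le.1 h), abs_zero]; exact hD0
    · rw [h1 x (not_le.1 h), abs_zero]; exact hD0

/-- Weak derivatives in `U` may be tested with functions that do not vanish on the flat part of the
boundary, if they vanish there to first order or the derivative is tangential. -/
lemma integral_mul_fderiv_eq_of_halfPlane {U : Set (ℝ × ℝ)} {c σ r C : ℝ}
    (hUm : MeasurableSet U) (hU : IsHalfPlaneNear U c σ r) {u g : ℝ × ℝ → ℂ} {e : ℝ × ℝ}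
    (hu : IntegrableOn u U) (hg : IntegrableOn g U)
    (hweak : ∀ φ : ℝ × ℝ → ℂ, ContDiff ℝ ∞ φ → HasCompactSupport φ → tsupport φ ⊆ U →
      ∫ p in U, u p * fderiv ℝ φ p e = -∫ p in U, g p * φ p)
    {w : ℝ × ℝ → ℝ} (hw : ContDiff ℝ ∞ w) (hwc : HasCompactSupport w)
    (hwU : tsupport w ⊆ square c r) (hC : ∀ p, |w p| * |e.1| ≤ C * |p.1 - c|) :
    ∫ p in U, u p * (fderiv ℝ w p e : ℂ) = -∫ p in U, g p * (w p : ℂ) := by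
  obtain ⟨D, hD0, hD, hD1⟩ := exists_bound_deriv_smoothTransition
  have hσ : 0 < |σ| := abs_pos.2 hU.ne_zero
  have hwd := hw.differentiable (by norm_num)
  -- Multiplying `w` by η_n makes it admissible; the layer where η_n differs from 1 shrinks to the
  -- flat boundary as n grows.
  set η : ℕ → ℝ × ℝ → ℝ := fun n => sideCutoff c σ ((n : ℝ) + 1) with hη
  have hηd : ∀ n, Differentiable ℝ (η n) := fun n =>
    (contDiff_sideCutoff c σ _).differentiable (by norm_num)
  have hη01 : ∀ n p, |η n p| ≤ 1 := fun n p => by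
    rw [hη]
    simp only [sideCutoff]
    rw [abs_of_nonneg (Real.smoothTransition.nonneg _)]
    exact Real.smoothTransition.le_one _
  have hprod : ∀ n, ContDiff ℝ ∞ fun p => η n p * w p := fun n =>
    (contDiff_sideCutoff c σ _).mul hw
  have hfd : ∀ n p, fderiv ℝ (fun q => η n q * w q) p e
      = η n p * fderiv ℝ w p e + w p * fderiv ℝ (η n) p e := by
    intro n p
    rw [fderiv_fun_mul (hηd n p) (hwd p)]
    simp
  have hsupp : ∀ n, tsupport (fun p => ((η n p * w p : ℝ) : ℂ)) ⊆ U := by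
    intro n p hp
    have h1 : p ∈ tsupport w := by
      refine closure_mono ?_ hp
      intro q hq h0
      apply hq
      simp only [h0, mul_zero, Complex.ofReal_zero]
    have h2 : 1 ≤ ((n : ℝ) + 1) * (σ * (p.1 - c)) := by
      have hcl : IsClosed {q : ℝ × ℝ | 1 ≤ ((n : ℝ) + 1) * (σ * (q.1 - c))} :=
        isClosed_le continuous_const (by fun_prop)
      refine closure_minimal ?_ hcl hp
      intro q hq
      by_contra hlt
      apply hq
      have : η n q = 0 := Real.smoothTransition.zero_of_nonpos (by
        simp only [mem_ofPred_eq, not_le] at hlt; linarith)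
      simp only [this, zero_mul, Complex.ofReal_zero]
    have h3 := hwU h1
    refine (hU.mem_iff p h3.1 h3.2).2 ?_
    by_contra h4
    have : ((n : ℝ) + 1) * (σ * (p.1 - c)) ≤ 0 :=
      mul_nonpos_of_nonneg_of_nonpos (by positivity) (not_lt.1 h4)
    linarith
  have hid : ∀ n, ∫ p in U, u p * ((η n p * fderiv ℝ w p e + w p * fderiv ℝ (η n) p e : ℝ) : ℂ)
      = -∫ p in U, g p * ((η n p * w p : ℝ) : ℂ) := by
    intro n
    have := hweak _ (contDiff_ofReal_comp (hprod n))
      (hasCompactSupport_ofReal_comp (HasCompactSupport.mul_left hwc)) (hsupp n)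
    rw [← this]
    congr 1
    funext p
    rw [fderiv_ofReal_comp ((hprod n).differentiable (by norm_num)), hfd]
  -- on `U`, either `w` vanishes near `p` or the cutoff is eventually `1` near `p`
  have hlarge : ∀ p ∈ U, p ∈ tsupport w → ∀ᶠ n : ℕ in atTop, 2 < ((n : ℝ) + 1) * (σ * (p.1 - c)) := by
    intro p hp hpw
    have h3 := hwU hpw
    have hpos := (hU.mem_iff p h3.1 h3.2).1 hp
    have := (tendsto_natCast_atTop_atTop (R := ℝ)).atTop_add (tendsto_const_nhds (x := (1 : ℝ)))
    exact (this.atTop_mul_const hpos).eventually_gt_atTop 2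
  have hηone : ∀ p ∈ U, p ∈ tsupport w → ∀ᶠ n in atTop, η n p = 1 ∧ fderiv ℝ (η n) p e = 0 := by
    intro p hp hpw
    filter_upwards [hlarge p hp hpw] with n hn
    refine ⟨Real.smoothTransition.one_of_one_le (by linarith), ?_⟩
    simp only [hη]
    rw [fderiv_sideCutoff, hD1 _ (by linarith), zero_mul]
  have hwbd : ∃ W, ∀ p, ‖w p‖ ≤ W := hw.continuous.bounded_above_of_compact_support hwc
  have hwbd' : ∃ W, ∀ p, ‖fderiv ℝ w p e‖ ≤ W :=
    (contDiff_fderiv_apply hw e).continuous.bounded_above_of_compact_support (hwc.fderiv_apply ℝ e)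
  obtain ⟨W, hW⟩ := hwbd
  obtain ⟨W', hW'⟩ := hwbd'
  have hlim1 : Tendsto (fun n => ∫ p in U, g p * ((η n p * w p : ℝ) : ℂ)) atTop
      (𝓝 (∫ p in U, g p * (w p : ℂ))) := by
    refine tendsto_integral_of_dominated_convergence (fun p => ‖g p‖ * W) ?_
      (hg.norm.mul_const W) ?_ ?_
    · intro n
      exact hg.aestronglyMeasurable.mul
        (contDiff_ofReal_comp (hprod n)).continuous.aestronglyMeasurable
    · intro n
      refine Eventually.of_forall fun p => ?_
      rw [norm_mul, Complex.norm_real, norm_mul]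
      gcongr
      calc ‖η n p‖ * ‖w p‖ ≤ 1 * W := by
            gcongr
            · exact hη01 n p
            · exact hW p
        _ = W := one_mul W
    · filter_upwards [ae_restrict_mem hUm] with p hp
      refine tendsto_const_nhds.congr' ?_
      by_cases hpw : p ∈ tsupport w
      · filter_upwards [hηone p hp hpw] with n hn
        rw [hn.1, one_mul]
      · filter_upwards with n
        rw [image_eq_zero_of_notMem_tsupport hpw, mul_zero]
  -- The derivative of η_n is of order n, but it lives where |ξ| ≤ 2, that is |x - c| = O(1/n), and
  -- there |w| |e.1| ≤ C |x - c| compensates. The product stays bounded, as dominated convergence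
  -- requires.
  have hcut : ∀ n p, |w p * fderiv ℝ (η n) p e| ≤ D * (2 * |C|) := by
    intro n p
    simp only [hη]
    rw [fderiv_sideCutoff]
    set ξ := ((n : ℝ) + 1) * (σ * (p.1 - c)) with hξ
    have hn : (0 : ℝ) < (n : ℝ) + 1 := by positivity
    by_cases h2 : |ξ| ≤ 2
    · have h3 : |w p| * |e.1| * (((n : ℝ) + 1) * |σ|) ≤ 2 * |C| := by
        have h4 : |ξ| = ((n : ℝ) + 1) * |σ| * |p.1 - c| := by
          rw [hξ, abs_mul, abs_mul, abs_of_pos hn]; ring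
        calc |w p| * |e.1| * (((n : ℝ) + 1) * |σ|)
            ≤ C * |p.1 - c| * (((n : ℝ) + 1) * |σ|) := by
              exact mul_le_mul_of_nonneg_right (hC p) (by positivity)
          _ ≤ |C| * |p.1 - c| * (((n : ℝ) + 1) * |σ|) := by gcongr; exact le_abs_self C
          _ = |C| * |ξ| := by rw [h4]; ring
          _ ≤ 2 * |C| := by nlinarith [abs_nonneg C]
      calc |w p * (deriv Real.smoothTransition (ξ - 1) * (((n : ℝ) + 1) * (σ * e.1)))|
          = |deriv Real.smoothTransition (ξ - 1)| * (|w p| * |e.1| * (((n : ℝ) + 1) * |σ|)) := by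
            simp only [abs_mul, abs_of_pos hn]; ring
        _ ≤ _ := by gcongr; exact hD _
    · have h0 : deriv Real.smoothTransition (ξ - 1) = 0 := by
        rcases lt_abs.1 (not_le.1 h2) with h | h
        · exact hD1 _ (by linarith)
        · have : Real.smoothTransition =ᶠ[𝓝 (ξ - 1)] fun _ => 0 := by
            filter_upwards [gt_mem_nhds (show ξ - 1 < 0 by linarith)] with y hy
              using Real.smoothTransition.zero_of_nonpos hy.le
          rw [this.deriv_eq, deriv_const]
      rw [h0]
      simp only [zero_mul, mul_zero, abs_zero]
      positivity
  have hlim2 : Tendsto (fun n => ∫ p in U,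
      u p * ((η n p * fderiv ℝ w p e + w p * fderiv ℝ (η n) p e : ℝ) : ℂ)) atTop
      (𝓝 (∫ p in U, u p * (fderiv ℝ w p e : ℂ))) := by
    refine tendsto_integral_of_dominated_convergence (fun p => ‖u p‖ * (W' + D * (2 * |C|))) ?_
      (hu.norm.mul_const _) ?_ ?_
    · intro n
      refine hu.aestronglyMeasurable.mul ?_
      have h := (contDiff_ofReal_comp (contDiff_fderiv_apply (hprod n) e)).continuous
      simp only [hfd] at h
      exact h.aestronglyMeasurable
    · intro n
      refine Eventually.of_forall fun p => ?_
      rw [norm_mul, Complex.norm_real]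
      gcongr
      refine (norm_add_le _ _).trans (add_le_add ?_ (hcut n p))
      rw [norm_mul]
      calc ‖η n p‖ * ‖fderiv ℝ w p e‖ ≤ 1 * W' := by
            gcongr
            · exact hη01 n p
            · exact hW' p
        _ = W' := one_mul W'
    · filter_upwards [ae_restrict_mem hUm] with p hp
      refine tendsto_const_nhds.congr' ?_
      by_cases hpw : p ∈ tsupport w
      · filter_upwards [hηone p hp hpw] with n hn
        rw [hn.1, hn.2, one_mul, mul_zero, add_zero]
      · filter_upwards with n
        rw [image_eq_zero_of_notMem_tsupport hpw, fderiv_of_notMem_tsupport ℝ hpw]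
        simp
  refine tendsto_nhds_unique hlim2 ?_
  simp only [hid]
  exact hlim1.neg

/-- Neumann eigenfunctions satisfy the eigenvalue equation in the very weak sense up to a flat part
of the boundary, when tested with functions of vanishing normal derivative. -/
lemma integral_laplacian_eq_zero {U : Set (ℝ × ℝ)} {c σ r C E : ℝ}
    (hUm : MeasurableSet U) (hUf : volume U ≠ ⊤) (hU : IsHalfPlaneNear U c σ r) {u : ℝ × ℝ → ℂ}
    (hu : IsNeumannEigenfunction U E u) {v : ℝ × ℝ → ℝ} (hv : ContDiff ℝ ∞ v)
    (hvc : HasCompactSupport v) (hvU : tsupport v ⊆ square c r)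
    (hC : ∀ p, |fderiv ℝ v p (1, 0)| ≤ C * |p.1 - c|) :
    ∫ p in U, u p * ((fderiv ℝ (fun q => fderiv ℝ v q (1, 0)) p (1, 0)
      + fderiv ℝ (fun q => fderiv ℝ v q (0, 1)) p (0, 1) + E * v p : ℝ) : ℂ) = 0 := by
  obtain ⟨-, g₁, g₂, hgrad, heq⟩ := hu
  have : IsFiniteMeasure (volume.restrict U) := ⟨by simpa using hUf.lt_top⟩
  have hui : IntegrableOn u U := hgrad.memLp.integrable (by norm_num)
  have hg₁i : IntegrableOn g₁ U := hgrad.memLp_fst.integrable (by norm_num)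
  have hg₂i : IntegrableOn g₂ U := hgrad.memLp_snd.integrable (by norm_num)
  have hsub : ∀ e, tsupport (fun q => fderiv ℝ v q e) ⊆ square c r := fun e =>
    (tsupport_fderiv_apply_subset ℝ e).trans hvU
  -- In the normal direction the first-order vanishing of ∂₁v on the flat boundary is needed.
  have h1 := integral_mul_fderiv_eq_of_halfPlane (C := C) hUm hU hui hg₁i hgrad.weak_fst
    (contDiff_fderiv_apply hv (1, 0)) (hvc.fderiv_apply ℝ _) (hsub _) (fun p => by simpa using hC p)
  -- The direction (0, 1) is tangential, so its first component is zero and C = 0 works for any `v`.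
  have h2 := integral_mul_fderiv_eq_of_halfPlane (C := 0) hUm hU hui hg₂i hgrad.weak_snd
    (contDiff_fderiv_apply hv (0, 1)) (hvc.fderiv_apply ℝ _) (hsub _) (fun p => by simp)
  have h3 := heq _ _ _ (hasH1Gradient_of_contDiff U hv hvc)
  have hint : ∀ (f : ℝ × ℝ → ℂ) (w : ℝ × ℝ → ℝ), IntegrableOn f U → ContDiff ℝ ∞ w →
      HasCompactSupport w → IntegrableOn (fun p => f p * (w p : ℂ)) U := by
    intro f w hf hw hwc
    obtain ⟨W, hW⟩ := hw.continuous.bounded_above_of_compact_support hwc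
    refine hf.mul_bdd (c := W) (contDiff_ofReal_comp hw).continuous.aestronglyMeasurable ?_
    exact Eventually.of_forall fun p => by rw [Complex.norm_real]; exact hW p
  have hv1 := contDiff_fderiv_apply hv (1, 0)
  have hv2 := contDiff_fderiv_apply hv (0, 1)
  have hv1c : HasCompactSupport fun q => fderiv ℝ v q (1, 0) := hvc.fderiv_apply ℝ _
  have hv2c : HasCompactSupport fun q => fderiv ℝ v q (0, 1) := hvc.fderiv_apply ℝ _
  have h4 : ∫ p in U, (conj ((fderiv ℝ v p (1, 0) : ℝ) : ℂ) * g₁ p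
      + conj ((fderiv ℝ v p (0, 1) : ℝ) : ℂ) * g₂ p)
      = (∫ p in U, g₁ p * (fderiv ℝ v p (1, 0) : ℂ))
        + ∫ p in U, g₂ p * (fderiv ℝ v p (0, 1) : ℂ) := by
    rw [← integral_add (hint _ _ hg₁i hv1 hv1c) (hint _ _ hg₂i hv2 hv2c)]
    congr 1
    funext p
    rw [Complex.conj_ofReal, Complex.conj_ofReal]
    ring
  have h5 : ∫ p in U, conj ((v p : ℝ) : ℂ) * u p = ∫ p in U, u p * (v p : ℂ) := by
    congr 1
    funext p
    rw [Complex.conj_ofReal, mul_comm]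
  rw [h4, h5] at h3
  have h6 : ∫ p in U, u p * ((fderiv ℝ (fun q => fderiv ℝ v q (1, 0)) p (1, 0)
      + fderiv ℝ (fun q => fderiv ℝ v q (0, 1)) p (0, 1) + E * v p : ℝ) : ℂ)
      = (∫ p in U, u p * (fderiv ℝ (fun q => fderiv ℝ v q (1, 0)) p (1, 0) : ℂ))
        + (∫ p in U, u p * (fderiv ℝ (fun q => fderiv ℝ v q (0, 1)) p (0, 1) : ℂ))
        + E * ∫ p in U, u p * (v p : ℂ) := by
    have i1 := hint u _ hui (contDiff_fderiv_apply hv1 (1, 0)) (hv1c.fderiv_apply ℝ _)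
    have i2 := hint u _ hui (contDiff_fderiv_apply hv2 (0, 1)) (hv2c.fderiv_apply ℝ _)
    have i3 := hint u _ hui hv hvc
    rw [← integral_const_mul, ← integral_add i1 i2, ← integral_add ?_ (i3.const_mul _)]
    rotate_left
    · exact i1.add i2
    congr 1
    funext p
    push_cast
    ring
  rw [h6, h1, h2, ← h3]
  ring

/-! ### Regularized logarithmic potentials with a pole on the boundary -/

/-- `a` is a smooth function, equal to `1` on `[-ρ, ρ]` and to `0` outside `[-2ρ, 2ρ]`. -/
structure IsCutoff (a : ℝ → ℝ) (ρ : ℝ) : Prop where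
  pos : 0 < ρ
  contDiff : ContDiff ℝ ∞ a
  eq_one : ∀ x, |x| ≤ ρ → a x = 1
  eq_zero : ∀ x, 2 * ρ ≤ |x| → a x = 0
  abs_le_one : ∀ x, |a x| ≤ 1

lemma exists_isCutoff {ρ : ℝ} (hρ : 0 < ρ) : ∃ a, IsCutoff a ρ := by
  let b : ContDiffBump (0 : ℝ) := ⟨ρ, 2 * ρ, hρ, by linarith⟩
  refine ⟨b, hρ, b.contDiff, fun x hx => ?_, fun x hx => ?_, fun x => ?_⟩
  · exact b.one_of_mem_closedBall (by simpa using hx)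
  · exact b.zero_of_le_dist (by simpa using hx)
  · rw [abs_of_nonneg b.nonneg]; exact b.le_one

lemma fderiv_apply_one_zero {v : ℝ × ℝ → ℝ} {p : ℝ × ℝ} (hv : DifferentiableAt ℝ v p) {d : ℝ}
    (h : HasDerivAt (fun x => v (x, p.2)) d p.1) : fderiv ℝ v p (1, 0) = d := by
  have h1 : HasDerivAt (fun x : ℝ => (x, p.2)) ((1 : ℝ), (0 : ℝ)) p.1 :=
    (hasDerivAt_id p.1).prodMk (hasDerivAt_const _ _)
  exact (HasFDerivAt.comp_hasDerivAt p.1 (f := fun x : ℝ => (x, p.2)) hv.hasFDerivAt h1).unique h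

lemma fderiv_apply_zero_one {v : ℝ × ℝ → ℝ} {p : ℝ × ℝ} (hv : DifferentiableAt ℝ v p) {d : ℝ}
    (h : HasDerivAt (fun y => v (p.1, y)) d p.2) : fderiv ℝ v p (0, 1) = d := by
  have h1 : HasDerivAt (fun y : ℝ => (p.1, y)) ((0 : ℝ), (1 : ℝ)) p.2 :=
    (hasDerivAt_const _ _).prodMk (hasDerivAt_id p.2)
  exact (HasFDerivAt.comp_hasDerivAt p.2 (f := fun y : ℝ => (p.1, y)) hv.hasFDerivAt h1).unique h

lemma hasDerivAt_log_sq_add {N : ℝ} (hN : 0 < N) (n x : ℝ) :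
    HasDerivAt (fun x => Real.log ((x - n) ^ 2 + N)) (2 * (x - n) / ((x - n) ^ 2 + N)) x := by
  have h : HasDerivAt (fun x => (x - n) ^ 2 + N) (2 * (x - n)) x := by
    convert! (((hasDerivAt_id x).sub_const n).pow 2).add_const N using 1
    simp
  exact h.log (by positivity)

lemma hasDerivAt_comp_sub {a : ℝ → ℝ} (ha : ContDiff ℝ ∞ a) (m x : ℝ) :
    HasDerivAt (fun x => a (x - m)) (deriv a (x - m)) x :=
  ((ha.differentiable (by norm_num) (x - m)).hasDerivAt).comp_sub_const x m

lemma hasDerivAt_cutoff_mul_log {a : ℝ → ℝ} (ha : ContDiff ℝ ∞ a) {N : ℝ} (hN : 0 < N)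
    (m n x : ℝ) :
    HasDerivAt (fun x => a (x - m) * Real.log ((x - n) ^ 2 + N))
      (deriv a (x - m) * Real.log ((x - n) ^ 2 + N)
        + a (x - m) * (2 * (x - n) / ((x - n) ^ 2 + N))) x :=
  (hasDerivAt_comp_sub ha m x).mul (hasDerivAt_log_sq_add hN n x)

lemma hasDerivAt_deriv_cutoff_mul_log {a : ℝ → ℝ} (ha : ContDiff ℝ ∞ a) {N : ℝ} (hN : 0 < N)
    (m n x : ℝ) :
    HasDerivAt (fun x => deriv a (x - m) * Real.log ((x - n) ^ 2 + N)
        + a (x - m) * (2 * (x - n) / ((x - n) ^ 2 + N)))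
      (deriv (deriv a) (x - m) * Real.log ((x - n) ^ 2 + N)
        + 2 * deriv a (x - m) * (2 * (x - n) / ((x - n) ^ 2 + N))
        + a (x - m) * (2 / ((x - n) ^ 2 + N) - 4 * (x - n) ^ 2 / ((x - n) ^ 2 + N) ^ 2)) x := by
  have ha' : ContDiff ℝ ∞ (deriv a) := (contDiff_infty_iff_deriv.1 ha).2
  have h0 : (x - n) ^ 2 + N ≠ 0 := by positivity
  have h1 : HasDerivAt (fun x => (x - n) ^ 2 + N) (2 * (x - n)) x := by
    convert! (((hasDerivAt_id x).sub_const n).pow 2).add_const N using 1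
    simp
  have h2 : HasDerivAt (fun x => 2 * (x - n)) 2 x := by
    simpa using ((hasDerivAt_id x).sub_const n).const_mul 2
  convert! (hasDerivAt_cutoff_mul_log ha' hN m n x).add
    ((hasDerivAt_comp_sub ha m x).mul (h2.div h1 h0)) using 1
  simp only [Pi.div_apply]
  field_simp
  ring

/-- The regularized squared distance to the point `(c, t)`. -/
def distSq (c t δ : ℝ) (p : ℝ × ℝ) : ℝ := (p.1 - c) ^ 2 + (p.2 - t) ^ 2 + δ ^ 2

lemma distSq_pos {δ : ℝ} (hδ : 0 < δ) (c t : ℝ) (p : ℝ × ℝ) : 0 < distSq c t δ p := by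
  unfold distSq; positivity

/-- A localized and regularized logarithmic potential with pole at `(c, t)`. -/
def logPotential (a : ℝ → ℝ) (c t δ : ℝ) (p : ℝ × ℝ) : ℝ :=
  a (p.1 - c) * a p.2 * Real.log (distSq c t δ p)

/-- The part of `Δ v + E v` without a singularity of order two at `(c, t)`, where `v` is the
localized logarithmic potential. -/
def remainder (a : ℝ → ℝ) (E c t δ : ℝ) (p : ℝ × ℝ) : ℝ :=
  (deriv (deriv a) (p.1 - c) * a p.2 + a (p.1 - c) * deriv (deriv a) p.2
      + E * (a (p.1 - c) * a p.2)) * Real.log (distSq c t δ p)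
    + 4 * (deriv a (p.1 - c) * a p.2) * ((p.1 - c) / distSq c t δ p)
    + 4 * (a (p.1 - c) * deriv a p.2) * ((p.2 - t) / distSq c t δ p)

variable {a : ℝ → ℝ} {ρ : ℝ} {c t δ : ℝ}

lemma contDiff_distSq (c t δ : ℝ) : ContDiff ℝ ∞ (distSq c t δ) := by
  unfold distSq; fun_prop

lemma contDiff_logPotential (ha : IsCutoff a ρ) (hδ : 0 < δ) (c t : ℝ) :
    ContDiff ℝ ∞ (logPotential a c t δ) := by
  have h1 : ContDiff ℝ ∞ fun p : ℝ × ℝ => a (p.1 - c) := ha.contDiff.comp (by fun_prop)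
  have h2 : ContDiff ℝ ∞ fun p : ℝ × ℝ => a p.2 := ha.contDiff.comp (by fun_prop)
  exact (h1.mul h2).mul ((contDiff_distSq c t δ).log fun p => (distSq_pos hδ c t p).ne')

lemma tsupport_logPotential_subset (ha : IsCutoff a ρ) (c t δ : ℝ) :
    tsupport (logPotential a c t δ) ⊆ Icc (c - 2 * ρ) (c + 2 * ρ) ×ˢ Icc (-(2 * ρ)) (2 * ρ) := by
  refine closure_minimal ?_ (isClosed_Icc.prod isClosed_Icc)
  intro p hp
  have h1 : |p.1 - c| < 2 * ρ := by
    by_contra h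
    exact hp (by simp [logPotential, ha.eq_zero _ (not_lt.1 h)])
  have h2 : |p.2| < 2 * ρ := by
    by_contra h
    exact hp (by simp [logPotential, ha.eq_zero _ (not_lt.1 h)])
  rw [abs_lt] at h1 h2
  exact ⟨⟨by linarith, by linarith⟩, by linarith, by linarith⟩

lemma hasCompactSupport_logPotential (ha : IsCutoff a ρ) (c t δ : ℝ) :
    HasCompactSupport (logPotential a c t δ) :=
  (isCompact_Icc.prod isCompact_Icc).of_isClosed_subset (isClosed_tsupport _)
    (tsupport_logPotential_subset ha c t δ)

lemma fderiv_logPotential_fst (ha : IsCutoff a ρ) (hδ : 0 < δ) (p : ℝ × ℝ) :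
    fderiv ℝ (logPotential a c t δ) p (1, 0) = a p.2 * (deriv a (p.1 - c)
        * Real.log ((p.1 - c) ^ 2 + ((p.2 - t) ^ 2 + δ ^ 2))
        + a (p.1 - c) * (2 * (p.1 - c) / ((p.1 - c) ^ 2 + ((p.2 - t) ^ 2 + δ ^ 2)))) := by
  refine fderiv_apply_one_zero ((contDiff_logPotential ha hδ c t).differentiable (by norm_num) p) ?_
  convert! (hasDerivAt_cutoff_mul_log ha.contDiff (N := (p.2 - t) ^ 2 + δ ^ 2) (by positivity)
    c c p.1).const_mul (a p.2) using 1
  funext x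
  simp only [logPotential, distSq, add_assoc]
  ring

lemma fderiv_logPotential_snd (ha : IsCutoff a ρ) (hδ : 0 < δ) (p : ℝ × ℝ) :
    fderiv ℝ (logPotential a c t δ) p (0, 1) = a (p.1 - c) * (deriv a (p.2 - 0)
        * Real.log ((p.2 - t) ^ 2 + ((p.1 - c) ^ 2 + δ ^ 2))
        + a (p.2 - 0) * (2 * (p.2 - t) / ((p.2 - t) ^ 2 + ((p.1 - c) ^ 2 + δ ^ 2)))) := by
  refine fderiv_apply_zero_one ((contDiff_logPotential ha hδ c t).differentiable (by norm_num) p) ?_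
  convert! (hasDerivAt_cutoff_mul_log ha.contDiff (N := (p.1 - c) ^ 2 + δ ^ 2) (by positivity)
    0 t p.2).const_mul (a (p.1 - c)) using 1
  funext y
  simp only [logPotential, distSq, sub_zero]
  rw [mul_assoc]
  congr 3
  ring

/-- Where no cutoff is differentiated, the Laplacian of log(r² + δ²) in the plane is 4δ²/(r² + δ²)².
Every other term carries a derivative of a cutoff or the factor E. -/
lemma laplacian_logPotential (ha : IsCutoff a ρ) (hδ : 0 < δ) (E : ℝ) (p : ℝ × ℝ) :
    fderiv ℝ (fun q => fderiv ℝ (logPotential a c t δ) q (1, 0)) p (1, 0)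
      + fderiv ℝ (fun q => fderiv ℝ (logPotential a c t δ) q (0, 1)) p (0, 1)
      + E * logPotential a c t δ p
      = a (p.1 - c) * a p.2 * (4 * δ ^ 2 / distSq c t δ p ^ 2) + remainder a E c t δ p := by
  have hv := contDiff_logPotential ha hδ c t
  have h1 : fderiv ℝ (fun q => fderiv ℝ (logPotential a c t δ) q (1, 0)) p (1, 0)
      = a p.2 * (deriv (deriv a) (p.1 - c) * Real.log ((p.1 - c) ^ 2 + ((p.2 - t) ^ 2 + δ ^ 2))
        + 2 * deriv a (p.1 - c) * (2 * (p.1 - c) / ((p.1 - c) ^ 2 + ((p.2 - t) ^ 2 + δ ^ 2)))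
        + a (p.1 - c) * (2 / ((p.1 - c) ^ 2 + ((p.2 - t) ^ 2 + δ ^ 2))
          - 4 * (p.1 - c) ^ 2 / ((p.1 - c) ^ 2 + ((p.2 - t) ^ 2 + δ ^ 2)) ^ 2)) := by
    refine fderiv_apply_one_zero ((contDiff_fderiv_apply hv _).differentiable (by norm_num) p) ?_
    simp only [fderiv_logPotential_fst ha hδ]
    exact (hasDerivAt_deriv_cutoff_mul_log ha.contDiff (N := (p.2 - t) ^ 2 + δ ^ 2)
      (by positivity) c c p.1).const_mul (a p.2)
  have h2 : fderiv ℝ (fun q => fderiv ℝ (logPotential a c t δ) q (0, 1)) p (0, 1)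
      = a (p.1 - c) * (deriv (deriv a) (p.2 - 0)
          * Real.log ((p.2 - t) ^ 2 + ((p.1 - c) ^ 2 + δ ^ 2))
        + 2 * deriv a (p.2 - 0) * (2 * (p.2 - t) / ((p.2 - t) ^ 2 + ((p.1 - c) ^ 2 + δ ^ 2)))
        + a (p.2 - 0) * (2 / ((p.2 - t) ^ 2 + ((p.1 - c) ^ 2 + δ ^ 2))
          - 4 * (p.2 - t) ^ 2 / ((p.2 - t) ^ 2 + ((p.1 - c) ^ 2 + δ ^ 2)) ^ 2)) := by
    refine fderiv_apply_zero_one ((contDiff_fderiv_apply hv _).differentiable (by norm_num) p) ?_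
    simp only [fderiv_logPotential_snd ha hδ]
    exact (hasDerivAt_deriv_cutoff_mul_log ha.contDiff (N := (p.1 - c) ^ 2 + δ ^ 2)
      (by positivity) 0 t p.2).const_mul (a (p.1 - c))
  have hR := distSq_pos hδ c t p
  have e1 : (p.1 - c) ^ 2 + ((p.2 - t) ^ 2 + δ ^ 2) = distSq c t δ p := by
    unfold distSq; ring
  have e2 : (p.2 - t) ^ 2 + ((p.1 - c) ^ 2 + δ ^ 2) = distSq c t δ p := by
    unfold distSq; ring
  -- Eliminating δ² in favour of the regularized squared distance leaves a rational identity.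
  have e3 : δ ^ 2 = distSq c t δ p - (p.1 - c) ^ 2 - (p.2 - t) ^ 2 := by
    unfold distSq; ring
  rw [h1, h2, e1, e2, sub_zero, e3, logPotential, remainder]
  field_simp
  ring

/-- The pole lies on the line x = c, so the logarithm is even in x - c, and the cutoff is constant
near that line. The normal derivative therefore vanishes there, and being smooth with compact
support it is Lipschitz. The constant may depend on δ, as it is only used qualitatively. -/
lemma exists_abs_fderiv_logPotential_le (ha : IsCutoff a ρ) (hδ : 0 < δ) (c t : ℝ) :
    ∃ C, ∀ p, |fderiv ℝ (logPotential a c t δ) p (1, 0)| ≤ C * |p.1 - c| := by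
  have hv := contDiff_logPotential ha hδ c t
  have hv1 := contDiff_fderiv_apply hv (1, 0)
  have hvc : HasCompactSupport fun q => fderiv ℝ (logPotential a c t δ) q (1, 0) :=
    (hasCompactSupport_logPotential ha c t δ).fderiv_apply ℝ _
  obtain ⟨C, hC⟩ := ContDiff.lipschitzWith_of_hasCompactSupport hvc hv1 (by norm_num)
  refine ⟨C, fun p => ?_⟩
  have h0 : fderiv ℝ (logPotential a c t δ) (c, p.2) (1, 0) = 0 := by
    rw [fderiv_logPotential_fst ha hδ]
    have : deriv a 0 = 0 := by
      have h1 : a =ᶠ[𝓝 0] fun _ => 1 := by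
        filter_upwards [Metric.ball_mem_nhds (0 : ℝ) ha.pos] with x hx
        exact ha.eq_one x (by simpa using (Metric.mem_ball.1 hx).le)
      rw [h1.deriv_eq, deriv_const]
    simp [this]
  have := hC.dist_le_mul p (c, p.2)
  rw [h0, dist_zero_right, Real.norm_eq_abs] at this
  refine this.trans_eq ?_
  congr 1
  simp [Prod.dist_eq, Real.dist_eq]

lemma integral_logPotential_eq {U : Set (ℝ × ℝ)} {σ r E : ℝ}
    (hUm : MeasurableSet U) (hUf : volume U ≠ ⊤) (hU : IsHalfPlaneNear U c σ r) {u : ℝ × ℝ → ℂ}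
    (hu : IsNeumannEigenfunction U E u) (ha : IsCutoff a ρ) (hρ : 2 * ρ < r) (hδ : 0 < δ) (t : ℝ) :
    ∫ p in U, u p * ((a (p.1 - c) * a p.2 * (4 * δ ^ 2 / distSq c t δ p ^ 2)
      + remainder a E c t δ p : ℝ) : ℂ) = 0 := by
  obtain ⟨C, hC⟩ := exists_abs_fderiv_logPotential_le ha hδ c t
  have hsub : tsupport (logPotential a c t δ) ⊆ square c r := by
    refine (tsupport_logPotential_subset ha c t δ).trans fun p hp => ?_
    obtain ⟨⟨h1, h2⟩, h3, h4⟩ := hp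
    exact ⟨abs_lt.2 ⟨by linarith, by linarith⟩, abs_lt.2 ⟨by linarith, by linarith⟩⟩
  have := integral_laplacian_eq_zero hUm hUf hU hu (contDiff_logPotential ha hδ c t)
    (hasCompactSupport_logPotential ha c t δ) hsub hC
  simpa only [laplacian_logPotential ha hδ] using this

/-! ### Lipschitz dependence of the remainder on the pole -/

lemma sqrt_add_sq_sub_le {A y z : ℝ} (hA : 0 < A) :
    Real.sqrt (A + y ^ 2) - Real.sqrt (A + z ^ 2) ≤ |y - z| := by
  have h1 : Real.sqrt (A + z ^ 2) ^ 2 = A + z ^ 2 := Real.sq_sqrt (by positivity)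
  have h2 : |z| ≤ Real.sqrt (A + z ^ 2) := Real.le_sqrt_of_sq_le (by rw [sq_abs]; linarith)
  rw [sub_le_iff_le_add]
  refine (Real.sqrt_le_left (by positivity)).2 ?_
  have h3 : y ^ 2 = (y - z) ^ 2 + 2 * (y - z) * z + z ^ 2 := by ring
  have h4 : (y - z) * z ≤ |y - z| * |z| := by rw [← abs_mul]; exact le_abs_self _
  nlinarith [sq_abs (y - z), abs_nonneg (y - z), mul_le_mul_of_nonneg_left h2 (abs_nonneg (y - z))]

/-- Apply log x ≤ x - 1 to the ratio of the square roots, in both orders; the sum of the two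
inverses covers both signs. -/
lemma abs_log_sub_log_le {A y z : ℝ} (hA : 0 < A) :
    |Real.log (A + y ^ 2) - Real.log (A + z ^ 2)|
      ≤ 2 * |y - z| * ((Real.sqrt (A + y ^ 2))⁻¹ + (Real.sqrt (A + z ^ 2))⁻¹) := by
  have key : ∀ y z : ℝ, Real.log (A + y ^ 2) - Real.log (A + z ^ 2)
      ≤ 2 * |y - z| * (Real.sqrt (A + z ^ 2))⁻¹ := by
    intro y z
    have hy : 0 < Real.sqrt (A + y ^ 2) := Real.sqrt_pos.2 (by positivity)
    have hz : 0 < Real.sqrt (A + z ^ 2) := Real.sqrt_pos.2 (by positivity)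
    have h1 : Real.log (A + y ^ 2) = 2 * Real.log (Real.sqrt (A + y ^ 2)) := by
      rw [Real.log_sqrt (by positivity)]; ring
    have h2 : Real.log (A + z ^ 2) = 2 * Real.log (Real.sqrt (A + z ^ 2)) := by
      rw [Real.log_sqrt (by positivity)]; ring
    have h3 : Real.log (Real.sqrt (A + y ^ 2)) - Real.log (Real.sqrt (A + z ^ 2))
        ≤ (Real.sqrt (A + y ^ 2) - Real.sqrt (A + z ^ 2)) * (Real.sqrt (A + z ^ 2))⁻¹ := by
      rw [← Real.log_div hy.ne' hz.ne', sub_mul, mul_inv_cancel₀ hz.ne', ← div_eq_mul_inv]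
      exact Real.log_le_sub_one_of_pos (by positivity)
    have h4 : (Real.sqrt (A + y ^ 2) - Real.sqrt (A + z ^ 2)) * (Real.sqrt (A + z ^ 2))⁻¹
        ≤ |y - z| * (Real.sqrt (A + z ^ 2))⁻¹ := by
      gcongr
      exact sqrt_add_sq_sub_le hA
    rw [h1, h2]
    linarith
  have hy : 0 ≤ 2 * |y - z| * (Real.sqrt (A + y ^ 2))⁻¹ := by positivity
  have hz : 0 ≤ 2 * |y - z| * (Real.sqrt (A + z ^ 2))⁻¹ := by positivity
  rw [abs_le, mul_add]
  constructor
  · have := key z y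
    rw [abs_sub_comm] at this
    linarith
  · linarith [key y z]

/-- The inequality behind it is x²(y + z)² ≤ (x² + y²)(x² + z²), whose two sides differ by (x² -
yz)². -/
lemma abs_div_sub_div_le {x y z B d : ℝ} (hB : 0 ≤ B) (hd : 0 < d) (hy : d ≤ x ^ 2 + y ^ 2 + B)
    (hz : d ≤ x ^ 2 + z ^ 2 + B) :
    |x / (x ^ 2 + y ^ 2 + B) - x / (x ^ 2 + z ^ 2 + B)| ≤ |y - z| / d := by
  set P := x ^ 2 + y ^ 2 + B
  set Q := x ^ 2 + z ^ 2 + B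
  have hP : 0 < P := hd.trans_le hy
  have hQ : 0 < Q := hd.trans_le hz
  have h1 : x / P - x / Q = -((y - z) * (x * (y + z)) / (P * Q)) := by
    rw [div_sub_div _ _ hP.ne' hQ.ne', ← neg_div]
    congr 1
    simp only [P, Q]; ring
  have h2 : |x * (y + z)| ≤ Real.sqrt (P * Q) := by
    refine Real.abs_le_sqrt ?_
    simp only [P, Q]
    nlinarith [sq_nonneg (x ^ 2 - y * z), sq_nonneg x, sq_nonneg y, sq_nonneg z,
      mul_nonneg hB (sq_nonneg x), mul_nonneg hB (sq_nonneg y), mul_nonneg hB (sq_nonneg z)]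
  have hsq : Real.sqrt (P * Q) * Real.sqrt (P * Q) = P * Q := Real.mul_self_sqrt (by positivity)
  have h3 : d ≤ Real.sqrt (P * Q) := Real.le_sqrt_of_sq_le (by nlinarith)
  have hpos : 0 < Real.sqrt (P * Q) := hd.trans_le h3
  rw [h1, abs_neg, abs_div, abs_mul, abs_of_pos (mul_pos hP hQ), ← hsq]
  calc |y - z| * |x * (y + z)| / (Real.sqrt (P * Q) * Real.sqrt (P * Q))
      ≤ |y - z| * Real.sqrt (P * Q) / (Real.sqrt (P * Q) * Real.sqrt (P * Q)) := by gcongr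
    _ = |y - z| / Real.sqrt (P * Q) := by field_simp
    _ ≤ _ := by gcongr

/-- Here (B - yz)² ≤ (y² + B)(z² + B), the difference being B(y + z)². -/
lemma abs_div_sub_div_le' {y z B d : ℝ} (hB : 0 ≤ B) (hd : 0 < d) (hy : d ≤ y ^ 2 + B)
    (hz : d ≤ z ^ 2 + B) :
    |y / (y ^ 2 + B) - z / (z ^ 2 + B)| ≤ |y - z| / d := by
  set P := y ^ 2 + B
  set Q := z ^ 2 + B
  have hP : 0 < P := hd.trans_le hy
  have hQ : 0 < Q := hd.trans_le hz
  have h1 : y / P - z / Q = (y - z) * (B - y * z) / (P * Q) := by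
    rw [div_sub_div _ _ hP.ne' hQ.ne']
    congr 1
    simp only [P, Q]; ring
  have h2 : |B - y * z| ≤ Real.sqrt (P * Q) := by
    refine Real.abs_le_sqrt ?_
    simp only [P, Q]
    nlinarith [mul_nonneg hB (sq_nonneg (y + z))]
  have hsq : Real.sqrt (P * Q) * Real.sqrt (P * Q) = P * Q := Real.mul_self_sqrt (by positivity)
  have h3 : d ≤ Real.sqrt (P * Q) := Real.le_sqrt_of_sq_le (by nlinarith)
  have hpos : 0 < Real.sqrt (P * Q) := hd.trans_le h3
  rw [h1, abs_div, abs_mul, abs_of_pos (mul_pos hP hQ), ← hsq]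
  calc |y - z| * |B - y * z| / (Real.sqrt (P * Q) * Real.sqrt (P * Q))
      ≤ |y - z| * Real.sqrt (P * Q) / (Real.sqrt (P * Q) * Real.sqrt (P * Q)) := by gcongr
    _ = |y - z| / Real.sqrt (P * Q) := by field_simp
    _ ≤ _ := by gcongr

variable {s E : ℝ}

lemma IsCutoff.eventuallyEq_zero (ha : IsCutoff a ρ) {x : ℝ} (hx : 2 * ρ < |x|) :
    a =ᶠ[𝓝 x] fun _ => 0 := by
  filter_upwards [continuous_abs.continuousAt.eventually_const_lt hx] with y hy using ha.eq_zero y hy.le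

lemma IsCutoff.deriv_eq_zero_of_lt (ha : IsCutoff a ρ) {x : ℝ} (hx : |x| < ρ) : deriv a x = 0 := by
  have h : a =ᶠ[𝓝 x] fun _ => 1 := by
    filter_upwards [continuous_abs.continuousAt.eventually_lt_const hx] with y hy
      using ha.eq_one y hy.le
  rw [h.deriv_eq, deriv_const]

lemma IsCutoff.deriv_eq_zero (ha : IsCutoff a ρ) {x : ℝ} (hx : 2 * ρ < |x|) : deriv a x = 0 := by
  rw [(ha.eventuallyEq_zero hx).deriv_eq, deriv_const]

lemma IsCutoff.deriv_deriv_eq_zero (ha : IsCutoff a ρ) {x : ℝ} (hx : 2 * ρ < |x|) :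
    deriv (deriv a) x = 0 := by
  rw [(ha.eventuallyEq_zero hx).deriv.deriv_eq]
  simp

lemma IsCutoff.contDiff_deriv (ha : IsCutoff a ρ) : ContDiff ℝ ∞ (deriv a) :=
  (contDiff_infty_iff_deriv.1 ha.contDiff).2

lemma IsCutoff.continuous_deriv_deriv (ha : IsCutoff a ρ) : Continuous (deriv (deriv a)) :=
  (contDiff_infty_iff_deriv.1 ha.contDiff_deriv).2.continuous

lemma IsCutoff.exists_bound (ha : IsCutoff a ρ) :
    ∃ A, 0 ≤ A ∧ (∀ x, |deriv a x| ≤ A) ∧ ∀ x, |deriv (deriv a) x| ≤ A := by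
  have hρ := ha.pos
  obtain ⟨A₁, h₁⟩ := isCompact_Icc.exists_bound_of_continuousOn (s := Icc (-(2 * ρ)) (2 * ρ))
    ha.contDiff_deriv.continuous.continuousOn
  obtain ⟨A₂, h₂⟩ := isCompact_Icc.exists_bound_of_continuousOn (s := Icc (-(2 * ρ)) (2 * ρ))
    ha.continuous_deriv_deriv.continuousOn
  have h0 : (0 : ℝ) ∈ Icc (-(2 * ρ)) (2 * ρ) := ⟨by linarith, by linarith⟩
  have hA₁ : 0 ≤ A₁ := (norm_nonneg _).trans (h₁ 0 h0)
  refine ⟨max A₁ A₂, le_max_of_le_left hA₁, fun x => ?_, fun x => ?_⟩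
  · by_cases hx : 2 * ρ < |x|
    · rw [ha.deriv_eq_zero hx, abs_zero]; exact le_max_of_le_left hA₁
    · exact (h₁ x (abs_le.1 (not_lt.1 hx))).trans (le_max_left _ _)
  · by_cases hx : 2 * ρ < |x|
    · rw [ha.deriv_deriv_eq_zero hx, abs_zero]; exact le_max_of_le_left hA₁
    · exact (h₂ x (abs_le.1 (not_lt.1 hx))).trans (le_max_right _ _)

lemma remainder_eq_zero (ha : IsCutoff a ρ) {p : ℝ × ℝ}
    (hp : 2 * ρ < |p.1 - c| ∨ 2 * ρ < |p.2|) : remainder a E c t δ p = 0 := by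
  rcases hp with h | h
  · simp [remainder, ha.eq_zero _ h.le, ha.deriv_eq_zero h, ha.deriv_deriv_eq_zero h]
  · simp [remainder, ha.eq_zero _ h.le, ha.deriv_eq_zero h, ha.deriv_deriv_eq_zero h]

lemma continuous_remainder (ha : IsCutoff a ρ) (hδ : 0 < δ) (E c t : ℝ) :
    Continuous (remainder a E c t δ) := by
  have hR := (contDiff_distSq c t δ).continuous
  have hR0 : ∀ p, distSq c t δ p ≠ 0 := fun p => (distSq_pos hδ c t p).ne'
  have h0 := ha.contDiff.continuous
  have h1 := ha.contDiff_deriv.continuous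
  have h2 := ha.continuous_deriv_deriv
  have hl : Continuous fun p => Real.log (distSq c t δ p) := hR.log hR0
  have hx : Continuous fun p : ℝ × ℝ => (p.1 - c) / distSq c t δ p :=
    (by fun_prop : Continuous fun p : ℝ × ℝ => p.1 - c).div hR hR0
  have hy : Continuous fun p : ℝ × ℝ => (p.2 - t) / distSq c t δ p :=
    (by fun_prop : Continuous fun p : ℝ × ℝ => p.2 - t).div hR hR0
  unfold remainder
  fun_prop

/-- Only the logarithm is differenced near the poles, at the price of the integrable singularity
1/r. The quotients are multiplied by derivatives of the cutoffs, hence live at distance at least ρ/2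
from both poles. No constant involves δ. -/
lemma abs_remainder_sub_le (ha : IsCutoff a ρ) {A : ℝ} (hA : 0 ≤ A) (hA₁ : ∀ x, |deriv a x| ≤ A)
    (hA₂ : ∀ x, |deriv (deriv a) x| ≤ A) (hδ : 0 < δ) (ht : |t| ≤ ρ / 2) (hs : |s| ≤ ρ / 2)
    (p : ℝ × ℝ) :
    |remainder a E c t δ p - remainder a E c s δ p| ≤ (2 * (2 * A + |E|) + 20 * A / ρ ^ 2) * |t - s|
      * ((Real.sqrt (distSq c t δ p))⁻¹ + (Real.sqrt (distSq c s δ p))⁻¹ + 1) := by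
  have hρ := ha.pos
  have hy : |(p.2 - t) - (p.2 - s)| = |t - s| := by
    rw [abs_sub_comm t s]; congr 1; ring
  set I := (Real.sqrt (distSq c t δ p))⁻¹ + (Real.sqrt (distSq c s δ p))⁻¹ with hI
  have hI0 : 0 ≤ I := by positivity
  have hlog : |Real.log (distSq c t δ p) - Real.log (distSq c s δ p)| ≤ 2 * |t - s| * I := by
    have h := abs_log_sub_log_le (A := (p.1 - c) ^ 2 + δ ^ 2) (y := p.2 - t) (z := p.2 - s)
      (by positivity)
    have e : ∀ τ, (p.1 - c) ^ 2 + δ ^ 2 + (p.2 - τ) ^ 2 = distSq c τ δ p := fun τ => by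
      unfold distSq; ring
    rwa [e, e, hy] at h
  have hm : |deriv (deriv a) (p.1 - c) * a p.2 + a (p.1 - c) * deriv (deriv a) p.2
      + E * (a (p.1 - c) * a p.2)| ≤ 2 * A + |E| := by
    refine (abs_add_three _ _ _).trans ?_
    simp only [abs_mul]
    have e1 : |deriv (deriv a) (p.1 - c)| * |a p.2| ≤ A * 1 := by
      gcongr
      exacts [hA₂ _, ha.abs_le_one _]
    have e2 : |a (p.1 - c)| * |deriv (deriv a) p.2| ≤ 1 * A := by
      gcongr
      exacts [ha.abs_le_one _, hA₂ _]
    have e3 : |E| * (|a (p.1 - c)| * |a p.2|) ≤ |E| * (1 * 1) := by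
      gcongr
      exacts [ha.abs_le_one _, ha.abs_le_one _]
    linarith
  have hb2 : |4 * (deriv a (p.1 - c) * a p.2)
      * ((p.1 - c) / distSq c t δ p - (p.1 - c) / distSq c s δ p)| ≤ 4 * A * |t - s| / ρ ^ 2 := by
    by_cases hX : |p.1 - c| < ρ
    · rw [ha.deriv_eq_zero_of_lt hX]
      simp only [zero_mul, mul_zero, abs_zero]
      positivity
    · have hX2 : ρ ^ 2 ≤ (p.1 - c) ^ 2 := by
        rw [← sq_abs (p.1 - c)]
        have := not_lt.1 hX
        gcongr
      have h := abs_div_sub_div_le (x := p.1 - c) (y := p.2 - t) (z := p.2 - s) (B := δ ^ 2)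
        (d := ρ ^ 2) (by positivity) (by positivity) (by nlinarith [sq_nonneg (p.2 - t), sq_nonneg δ])
        (by nlinarith [sq_nonneg (p.2 - s), sq_nonneg δ])
      rw [hy] at h
      rw [abs_mul, abs_mul, abs_mul, abs_of_pos (by norm_num : (0 : ℝ) < 4)]
      calc 4 * (|deriv a (p.1 - c)| * |a p.2|)
            * |(p.1 - c) / distSq c t δ p - (p.1 - c) / distSq c s δ p|
          ≤ 4 * (A * 1) * (|t - s| / ρ ^ 2) := by
            gcongr
            exacts [hA₁ _, ha.abs_le_one _, h]
        _ = _ := by ring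
  have hb3 : |4 * (a (p.1 - c) * deriv a p.2)
      * ((p.2 - t) / distSq c t δ p - (p.2 - s) / distSq c s δ p)| ≤ 16 * A * |t - s| / ρ ^ 2 := by
    by_cases hX : |p.2| < ρ
    · rw [ha.deriv_eq_zero_of_lt hX]
      simp only [zero_mul, mul_zero, abs_zero]
      positivity
    -- Poles are restricted to |τ| ≤ ρ/2 so that they stay away from |y| ≥ ρ, where the derivative
    -- of the second cutoff lives.
    · have hsq : ∀ τ, |τ| ≤ ρ / 2 → ρ ^ 2 / 4 ≤ (p.2 - τ) ^ 2 := by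
        intro τ hτ
        have h1 : ρ / 2 ≤ |p.2 - τ| := by
          have := abs_sub_abs_le_abs_sub p.2 τ
          linarith [not_lt.1 hX]
        have h2 : (ρ / 2) ^ 2 ≤ |p.2 - τ| ^ 2 := by gcongr
        rw [sq_abs] at h2
        linarith
      have h := abs_div_sub_div_le' (y := p.2 - t) (z := p.2 - s) (B := (p.1 - c) ^ 2 + δ ^ 2)
        (d := ρ ^ 2 / 4) (by positivity) (by positivity)
        (by nlinarith [hsq t ht, sq_nonneg (p.1 - c), sq_nonneg δ])
        (by nlinarith [hsq s hs, sq_nonneg (p.1 - c), sq_nonneg δ])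
      have e : ∀ τ, (p.2 - τ) ^ 2 + ((p.1 - c) ^ 2 + δ ^ 2) = distSq c τ δ p := fun τ => by
        unfold distSq; ring
      rw [hy, e, e] at h
      rw [abs_mul, abs_mul, abs_mul, abs_of_pos (by norm_num : (0 : ℝ) < 4)]
      calc 4 * (|a (p.1 - c)| * |deriv a p.2|)
            * |(p.2 - t) / distSq c t δ p - (p.2 - s) / distSq c s δ p|
          ≤ 4 * (1 * A) * (|t - s| / (ρ ^ 2 / 4)) := by
            gcongr
            exacts [ha.abs_le_one _, hA₁ _]
        _ = _ := by field_simp; ring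
  have hsplit : remainder a E c t δ p - remainder a E c s δ p
      = (deriv (deriv a) (p.1 - c) * a p.2 + a (p.1 - c) * deriv (deriv a) p.2
        + E * (a (p.1 - c) * a p.2)) * (Real.log (distSq c t δ p) - Real.log (distSq c s δ p))
      + 4 * (deriv a (p.1 - c) * a p.2)
        * ((p.1 - c) / distSq c t δ p - (p.1 - c) / distSq c s δ p)
      + 4 * (a (p.1 - c) * deriv a p.2)
        * ((p.2 - t) / distSq c t δ p - (p.2 - s) / distSq c s δ p) := by
    simp only [remainder]; ring
  rw [hsplit]
  refine (abs_add_three _ _ _).trans ?_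
  have hb1 : |(deriv (deriv a) (p.1 - c) * a p.2 + a (p.1 - c) * deriv (deriv a) p.2
      + E * (a (p.1 - c) * a p.2)) * (Real.log (distSq c t δ p) - Real.log (distSq c s δ p))|
      ≤ (2 * A + |E|) * (2 * |t - s| * I) := by
    rw [abs_mul]
    gcongr
  have hfin : (2 * (2 * A + |E|) + 20 * A / ρ ^ 2) * |t - s| * (I + 1)
      = (2 * A + |E|) * (2 * |t - s| * I) + 4 * A * |t - s| / ρ ^ 2 + 16 * A * |t - s| / ρ ^ 2
        + 2 * (2 * A + |E|) * |t - s| + 20 * A / ρ ^ 2 * |t - s| * I := by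
    ring
  have hp1 : 0 ≤ 2 * (2 * A + |E|) * |t - s| := by positivity
  have hp2 : 0 ≤ 20 * A / ρ ^ 2 * |t - s| * I := by positivity
  rw [hfin]
  linarith

/-- The function `|x|^{-1/2}`. -/
def invSqrt (x : ℝ) : ℝ := (Real.sqrt |x|)⁻¹

lemma invSqrt_nonneg (x : ℝ) : 0 ≤ invSqrt x := inv_nonneg.2 (Real.sqrt_nonneg _)

lemma integrableOn_invSqrt (R : ℝ) (hR : 0 ≤ R) : IntegrableOn invSqrt (Icc (-R) R) := by
  have h1 : IntervalIntegrable invSqrt volume 0 R := by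
    refine (intervalIntegral.intervalIntegrable_rpow' (r := -(1 / 2)) (by norm_num)).congr_uIoo ?_
    intro x hx
    rw [uIoo_of_le hR] at hx
    simp only [invSqrt]
    rw [abs_of_pos hx.1, Real.rpow_neg hx.1.le, Real.sqrt_eq_rpow]
  have h2 : IntervalIntegrable invSqrt volume (-R) 0 := by
    rw [IntervalIntegrable.iff_comp_neg]
    simpa [invSqrt] using! h1.symm
  exact (intervalIntegrable_iff_integrableOn_Icc_of_le (by linarith)).1 (h2.trans h1)

/-- The integral of `|x|^{-1/2}` over `[-R, R]`. -/
def invSqrtMass (R : ℝ) : ℝ := ∫ x in Icc (-R) R, invSqrt x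

lemma integrableOn_invSqrt_sub (R m : ℝ) (hR : 0 ≤ R) :
    IntegrableOn (fun x => invSqrt (x - m)) (Icc (m - R) (m + R)) ∧
      ∫ x in Icc (m - R) (m + R), invSqrt (x - m) = invSqrtMass R := by
  have hpre : (fun x : ℝ => x - m) ⁻¹' Icc (-R) R = Icc (m - R) (m + R) := by
    ext x
    simp only [mem_preimage, mem_Icc]
    constructor <;> rintro ⟨h1, h2⟩ <;> constructor <;> linarith
  have hmp : MeasurePreserving (fun x : ℝ => x - m) volume volume :=
    measurePreserving_sub_right volume m
  have hemb : MeasurableEmbedding (fun x : ℝ => x - m) :=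
    (MeasurableEquiv.subRight m).measurableEmbedding
  rw [← hpre]
  exact ⟨(hmp.integrableOn_comp_preimage hemb).2 (integrableOn_invSqrt R hR),
    hmp.setIntegral_preimage_emb hemb _ _⟩

/-- Since |XY| ≤ X² + Y², the planar singularity 1/r is dominated by a product of one-dimensional
integrable ones, and Fubini replaces polar coordinates. -/
lemma inv_sqrt_distSq_le {p : ℝ × ℝ} (h1 : p.1 ≠ c) (h2 : p.2 ≠ t) :
    (Real.sqrt (distSq c t δ p))⁻¹ ≤ invSqrt (p.1 - c) * invSqrt (p.2 - t) := by
  have e1 : 0 < |p.1 - c| := abs_pos.2 (sub_ne_zero.2 h1)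
  have e2 : 0 < |p.2 - t| := abs_pos.2 (sub_ne_zero.2 h2)
  rw [invSqrt, invSqrt, ← mul_inv, ← Real.sqrt_mul e1.le]
  have h3 : 0 < Real.sqrt (|p.1 - c| * |p.2 - t|) := Real.sqrt_pos.2 (by positivity)
  gcongr
  unfold distSq
  nlinarith [sq_abs (p.1 - c), sq_abs (p.2 - t), sq_nonneg (|p.1 - c| - |p.2 - t|), sq_nonneg δ]

/-- The product `|x - c|^{-1/2} |y - t|^{-1/2}`, restricted to a square. -/
def invSqrtProd (c t R : ℝ) : ℝ × ℝ → ℝ :=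
  (Icc (c - R) (c + R) ×ˢ Icc (t - R) (t + R)).indicator
    fun p => invSqrt (p.1 - c) * invSqrt (p.2 - t)

lemma invSqrtProd_nonneg (c t R : ℝ) (p : ℝ × ℝ) : 0 ≤ invSqrtProd c t R p :=
  indicator_nonneg (fun _ _ => mul_nonneg (invSqrt_nonneg _) (invSqrt_nonneg _)) _

lemma integrable_invSqrtProd (c t R : ℝ) (hR : 0 ≤ R) :
    Integrable (invSqrtProd c t R) ∧ ∫ p, invSqrtProd c t R p = invSqrtMass R ^ 2 := by
  have hm : MeasurableSet (Icc (c - R) (c + R) ×ˢ Icc (t - R) (t + R)) :=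
    measurableSet_Icc.prod measurableSet_Icc
  obtain ⟨i1, v1⟩ := integrableOn_invSqrt_sub R c hR
  obtain ⟨i2, v2⟩ := integrableOn_invSqrt_sub R t hR
  refine ⟨?_, ?_⟩
  · rw [invSqrtProd, integrable_indicator_iff hm, IntegrableOn, Measure.volume_eq_prod,
      ← Measure.prod_restrict]
    exact i1.mul_prod i2
  · unfold invSqrtProd
    rw [integral_indicator hm, Measure.volume_eq_prod,
      setIntegral_prod_mul (fun x => invSqrt (x - c)) (fun y => invSqrt (y - t)), v1, v2, sq]

variable {S : ℝ} {U : Set (ℝ × ℝ)} {u : ℝ × ℝ → ℂ}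

lemma ae_fst_ne (c : ℝ) : ∀ᵐ p : ℝ × ℝ, p.1 ≠ c := by
  have h : ∀ᵐ x : ℝ, x ≠ c := by simp [ae_iff, measure_singleton]
  rw [Measure.volume_eq_prod]
  exact Measure.quasiMeasurePreserving_fst.ae h

lemma ae_snd_ne (t : ℝ) : ∀ᵐ p : ℝ × ℝ, p.2 ≠ t := by
  have h : ∀ᵐ x : ℝ, x ≠ t := by simp [ae_iff, measure_singleton]
  rw [Measure.volume_eq_prod]
  exact Measure.quasiMeasurePreserving_snd.ae h

/-- The closed square of radius `R` around `(c, 0)`. -/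
def closedSquare (c R : ℝ) : Set (ℝ × ℝ) := Icc (c - R) (c + R) ×ˢ Icc (-R) R

lemma mem_closedSquare_iff {R : ℝ} {p : ℝ × ℝ} :
    p ∈ closedSquare c R ↔ |p.1 - c| ≤ R ∧ |p.2| ≤ R := by
  simp only [closedSquare, mem_prod, mem_Icc, abs_le]
  constructor <;> rintro ⟨⟨h1, h2⟩, h3, h4⟩ <;> refine ⟨⟨?_, ?_⟩, ?_, ?_⟩ <;> linarith

lemma exists_norm_integral_remainder_sub_le (hUm : MeasurableSet U) (ha : IsCutoff a ρ) (E : ℝ)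
    (hS0 : 0 ≤ S) (hS : ∀ p ∈ U, p ∈ closedSquare c (2 * ρ) → ‖u p‖ ≤ S) :
    ∃ C, ∀ δ t s : ℝ, 0 < δ → |t| ≤ ρ / 2 → |s| ≤ ρ / 2 →
      ‖∫ p in U, u p * ((remainder a E c t δ p - remainder a E c s δ p : ℝ) : ℂ)‖
        ≤ C * |t - s| := by
  obtain ⟨A, hA, hA₁, hA₂⟩ := ha.exists_bound
  have hρ := ha.pos
  set D := 2 * (2 * A + |E|) + 20 * A / ρ ^ 2 with hD
  have hD0 : 0 ≤ D := by positivity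
  have hQm : MeasurableSet (closedSquare c (2 * ρ)) := measurableSet_Icc.prod measurableSet_Icc
  have hQc : IsCompact (closedSquare c (2 * ρ)) := isCompact_Icc.prod isCompact_Icc
  set V := ∫ p, (closedSquare c (2 * ρ)).indicator (fun _ => (1 : ℝ)) p with hV
  have hVi : Integrable ((closedSquare c (2 * ρ)).indicator fun _ => (1 : ℝ)) :=
    (integrable_indicator_iff hQm).2 (continuousOn_const.integrableOn_compact hQc)
  -- The square of radius 3ρ about any admissible pole contains the fixed square of radius 2ρ, and
  -- the mass of the majorant on it does not depend on the pole.
  refine ⟨S * D * (invSqrtMass (3 * ρ) ^ 2 + invSqrtMass (3 * ρ) ^ 2 + V),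
    fun δ t s hδ ht hs => ?_⟩
  obtain ⟨it, vt⟩ := integrable_invSqrtProd c t (3 * ρ) (by positivity)
  obtain ⟨is, vs⟩ := integrable_invSqrtProd c s (3 * ρ) (by positivity)
  set b : ℝ × ℝ → ℝ := fun p => S * (D * |t - s|) * (invSqrtProd c t (3 * ρ) p
    + invSqrtProd c s (3 * ρ) p + (closedSquare c (2 * ρ)).indicator (fun _ => (1 : ℝ)) p) with hb
  have hbi : Integrable b := ((it.add is).add hVi).const_mul _
  have hbn : ∀ p, 0 ≤ b p := fun p => by
    have h1 := invSqrtProd_nonneg c t (3 * ρ) p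
    have h2 := invSqrtProd_nonneg c s (3 * ρ) p
    have h3 : 0 ≤ (closedSquare c (2 * ρ)).indicator (fun _ => (1 : ℝ)) p :=
      indicator_nonneg (fun _ _ => zero_le_one) _
    simp only [hb]
    positivity
  have hval : ∫ p, b p = S * D * (invSqrtMass (3 * ρ) ^ 2 + invSqrtMass (3 * ρ) ^ 2 + V) * |t - s| := by
    simp only [hb]
    have its : Integrable fun p => invSqrtProd c t (3 * ρ) p + invSqrtProd c s (3 * ρ) p := it.add is
    rw [integral_const_mul, integral_add its hVi, integral_add it is, vt, vs]
    ring
  have hbd : ∀ᵐ p ∂volume.restrict U,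
      ‖u p * ((remainder a E c t δ p - remainder a E c s δ p : ℝ) : ℂ)‖ ≤ b p := by
    filter_upwards [ae_restrict_mem hUm, ae_restrict_of_ae (ae_fst_ne c),
      ae_restrict_of_ae (ae_snd_ne t), ae_restrict_of_ae (ae_snd_ne s)] with p hp h1 h2 h3
    by_cases hQ : p ∈ closedSquare c (2 * ρ)
    · rw [norm_mul, Complex.norm_real, Real.norm_eq_abs]
      have hQ' := mem_closedSquare_iff.1 hQ
      have hmem : ∀ τ, |τ| ≤ ρ / 2 →
          p ∈ Icc (c - 3 * ρ) (c + 3 * ρ) ×ˢ Icc (τ - 3 * ρ) (τ + 3 * ρ) := by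
        intro τ hτ
        have e1 := abs_le.1 hQ'.1
        have e2 := abs_le.1 hQ'.2
        have e3 := abs_le.1 hτ
        exact ⟨⟨by linarith [e1.1], by linarith [e1.2]⟩, by linarith [e2.1, e3.2],
          by linarith [e2.2, e3.1]⟩
      have hrem := abs_remainder_sub_le (E := E) (c := c) ha hA hA₁ hA₂ hδ ht hs p
      rw [← hD] at hrem
      have i1 := inv_sqrt_distSq_le (δ := δ) h1 h2
      have i2 := inv_sqrt_distSq_le (δ := δ) h1 h3
      have hb' : b p = S * (D * |t - s|) * (invSqrt (p.1 - c) * invSqrt (p.2 - t)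
          + invSqrt (p.1 - c) * invSqrt (p.2 - s) + 1) := by
        simp only [hb, invSqrtProd, indicator_of_mem hQ, indicator_of_mem (hmem t ht),
          indicator_of_mem (hmem s hs)]
      rw [hb', mul_assoc S]
      refine mul_le_mul (hS p hp hQ) (hrem.trans ?_) (abs_nonneg _) hS0
      gcongr
    · have hQ' : 2 * ρ < |p.1 - c| ∨ 2 * ρ < |p.2| := by
        rw [mem_closedSquare_iff, not_and_or, not_le, not_le] at hQ
        exact hQ
      rw [remainder_eq_zero ha hQ', remainder_eq_zero ha hQ']
      simpa using hbn p
  refine (norm_integral_le_of_norm_le hbi.integrableOn hbd).trans ?_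
  rw [← hval]
  exact setIntegral_le_integral hbi (Eventually.of_forall hbn)

/-! ### Concentration of the singular part at the pole -/

/-- The profile of the Laplacian of the regularized logarithm. -/
def profile (q : ℝ × ℝ) : ℝ := 4 / (q.1 ^ 2 + q.2 ^ 2 + 1) ^ 2

lemma profile_pos (q : ℝ × ℝ) : 0 < profile q := by unfold profile; positivity

lemma continuous_profile : Continuous profile := by
  unfold profile
  refine continuous_const.div (by fun_prop) fun q => ?_
  positivity

lemma integrable_profile : Integrable profile := by
  have h : Integrable fun q : ℝ × ℝ => 4 * ((1 + q.1 ^ 2)⁻¹ * (1 + q.2 ^ 2)⁻¹) := by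
    rw [Measure.volume_eq_prod]
    exact (integrable_inv_one_add_sq.mul_prod integrable_inv_one_add_sq).const_mul 4
  refine h.mono' continuous_profile.aestronglyMeasurable (Eventually.of_forall fun q => ?_)
  rw [Real.norm_of_nonneg (profile_pos q).le, profile, div_eq_mul_inv, ← mul_inv]
  gcongr
  nlinarith [sq_nonneg q.1, sq_nonneg q.2, mul_nonneg (sq_nonneg q.1) (sq_nonneg q.2),
    sq_nonneg (q.1 ^ 2), sq_nonneg (q.2 ^ 2)]

/-- The mass of the profile in the half-plane `0 < σ x`. -/
def halfMass (σ : ℝ) : ℝ := ∫ q in {q : ℝ × ℝ | 0 < σ * q.1}, profile q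

lemma isOpen_halfPlane (σ : ℝ) : IsOpen {q : ℝ × ℝ | 0 < σ * q.1} :=
  isOpen_lt continuous_const (by fun_prop)

/-- Positivity is all that is needed: the mass is only divided by at the end. -/
lemma halfMass_pos {σ : ℝ} (hσ : σ ≠ 0) : 0 < halfMass σ := by
  rw [halfMass, setIntegral_pos_iff_support_of_nonneg_ae
    (Eventually.of_forall fun q => (profile_pos q).le) integrable_profile.integrableOn]
  have hsupp : Function.support profile = univ := by
    ext q; simp [(profile_pos q).ne']
  rw [hsupp, univ_inter]
  refine (isOpen_halfPlane σ).measure_pos volume ⟨(σ, 0), ?_⟩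
  exact mul_self_pos.2 hσ

/-- The localization of `u` to `U`. -/
def localized (U : Set (ℝ × ℝ)) (u : ℝ × ℝ → ℂ) (a : ℝ → ℝ) (c : ℝ) : ℝ × ℝ → ℂ :=
  U.indicator fun p => u p * ((a (p.1 - c) * a p.2 : ℝ) : ℂ)

lemma continuous_cutoff_prod (ha : IsCutoff a ρ) (c : ℝ) :
    Continuous fun p : ℝ × ℝ => a (p.1 - c) * a p.2 := by
  have := ha.contDiff.continuous
  fun_prop

lemma abs_cutoff_prod_le (ha : IsCutoff a ρ) (p : ℝ × ℝ) : |a (p.1 - c) * a p.2| ≤ 1 := by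
  rw [abs_mul]
  exact mul_le_one₀ (ha.abs_le_one _) (abs_nonneg _) (ha.abs_le_one _)

lemma norm_localized_le (ha : IsCutoff a ρ) (hS0 : 0 ≤ S)
    (hS : ∀ p ∈ U, p ∈ closedSquare c (2 * ρ) → ‖u p‖ ≤ S) (p : ℝ × ℝ) :
    ‖localized U u a c p‖ ≤ S := by
  by_cases hp : p ∈ U
  · rw [localized, indicator_of_mem hp, norm_mul, Complex.norm_real, Real.norm_eq_abs]
    by_cases hQ : p ∈ closedSquare c (2 * ρ)
    · calc ‖u p‖ * |a (p.1 - c) * a p.2| ≤ S * 1 :=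
            mul_le_mul (hS p hp hQ) (abs_cutoff_prod_le ha p) (abs_nonneg _) hS0
        _ = S := mul_one S
    · rw [mem_closedSquare_iff, not_and_or, not_le, not_le] at hQ
      have : a (p.1 - c) * a p.2 = 0 := by
        rcases hQ with h | h <;> simp [ha.eq_zero _ h.le]
      rw [this]; simpa using hS0
  · rw [localized, indicator_of_notMem hp]; simpa using hS0

lemma integrable_localized (hUm : MeasurableSet U) (hu : IntegrableOn u U) (ha : IsCutoff a ρ)
    (c : ℝ) : Integrable (localized U u a c) := by
  rw [localized, integrable_indicator_iff hUm]
  refine Integrable.mul_bdd (c := 1) hu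
    (Complex.continuous_ofReal.comp (continuous_cutoff_prod ha c)).aestronglyMeasurable ?_
  exact Eventually.of_forall fun p => by
    rw [Complex.norm_real]; exact abs_cutoff_prod_le ha p

/-- Substitute p = (c, t) + δq: the Jacobian δ² absorbs the powers of δ and leaves a fixed profile.
-/
lemma integral_eq_integral_localized (hUm : MeasurableSet U) (hδ : 0 < δ) (c t : ℝ) :
    ∫ p in U, u p * ((a (p.1 - c) * a p.2 * (4 * δ ^ 2 / distSq c t δ p ^ 2) : ℝ) : ℂ)
      = ∫ q : ℝ × ℝ, localized U u a c ((c, t) + δ • q) * (profile q : ℂ) := by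
  rw [← integral_indicator hUm]
  set H := U.indicator fun p =>
    u p * ((a (p.1 - c) * a p.2 * (4 * δ ^ 2 / distSq c t δ p ^ 2) : ℝ) : ℂ) with hH
  have h1 : ∫ p, H p = ∫ q, H ((c, t) + q) := (integral_add_left_eq_self H (c, t)).symm
  have h2 := Measure.integral_comp_smul (volume : Measure (ℝ × ℝ)) (fun q => H ((c, t) + q)) δ
  have hfr : Module.finrank ℝ (ℝ × ℝ) = 2 := by simp
  rw [hfr, abs_of_pos (by positivity), ← h1, eq_inv_smul_iff₀ (by positivity),
    ← integral_smul] at h2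
  rw [← h2]
  congr 1
  funext q
  have hq : 0 < q.1 ^ 2 + q.2 ^ 2 + 1 := by positivity
  have hd : distSq c t δ ((c, t) + δ • q) = δ ^ 2 * (q.1 ^ 2 + q.2 ^ 2 + 1) := by
    simp [distSq]; ring
  by_cases hp : (c, t) + δ • q ∈ U
  · simp only [hH, localized, indicator_of_mem hp, hd, Complex.real_smul]
    rw [mul_left_comm, ← Complex.ofReal_mul, mul_assoc (u _), ← Complex.ofReal_mul]
    congr 2
    unfold profile
    field_simp
  · simp only [hH, localized, indicator_of_notMem hp, smul_zero, zero_mul]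

/-- After rescaling, `U` looks like a half-plane seen from the pole. There the localized function
tends to u(c, t), by continuity up to the boundary, and on the complementary side it is eventually
zero. The profile times `S` is the majorant. -/
lemma tendsto_integral_profile {σ r : ℝ} (hUm : MeasurableSet U) (hU : IsHalfPlaneNear U c σ r)
    (hu : IntegrableOn u U) (ha : IsCutoff a ρ) (hρ : 2 * ρ < r) (hS0 : 0 ≤ S)
    (hS : ∀ p ∈ U, p ∈ closedSquare c (2 * ρ) → ‖u p‖ ≤ S)
    (hcont : ContinuousOn u {p | p ∈ square c r ∧ 0 ≤ σ * (p.1 - c)}) (ht : |t| ≤ ρ / 2)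
    {d : ℕ → ℝ} (hd0 : ∀ n, 0 < d n) (hd : Tendsto d atTop (𝓝 0)) :
    Tendsto (fun n => ∫ p in U,
      u p * ((a (p.1 - c) * a p.2 * (4 * d n ^ 2 / distSq c t (d n) p ^ 2) : ℝ) : ℂ)) atTop
      (𝓝 ((halfMass σ : ℂ) * u (c, t))) := by
  have hρ0 := ha.pos
  simp only [integral_eq_integral_localized hUm (hd0 _)]
  have hlim : (halfMass σ : ℂ) * u (c, t)
      = ∫ q : ℝ × ℝ, ({q : ℝ × ℝ | 0 < σ * q.1}).indicator (fun _ => u (c, t)) q * (profile q : ℂ) := by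
    rw [halfMass, ← integral_complex_ofReal, ← integral_mul_const,
      ← integral_indicator (isOpen_halfPlane σ).measurableSet]
    congr 1
    funext q
    by_cases hq : q ∈ {q : ℝ × ℝ | 0 < σ * q.1}
    · rw [indicator_of_mem hq, indicator_of_mem hq, mul_comm]
    · rw [indicator_of_notMem hq, indicator_of_notMem hq, zero_mul]
  rw [hlim]
  have hpt : (c, t) ∈ square c r := ⟨by simpa using (by linarith : 0 < r), by
    change |t| < r; linarith⟩
  refine tendsto_integral_of_dominated_convergence (fun q => S * profile q) (fun n => ?_)
    (integrable_profile.const_mul S) (fun n => ?_) ?_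
  · have h := ((integrable_localized hUm hu ha c).comp_add_left (c, t)).comp_smul (hd0 n).ne'
    exact h.aestronglyMeasurable.mul
      (Complex.continuous_ofReal.comp continuous_profile).aestronglyMeasurable
  · refine Eventually.of_forall fun q => ?_
    rw [norm_mul, Complex.norm_real, Real.norm_of_nonneg (profile_pos q).le]
    exact mul_le_mul_of_nonneg_right (norm_localized_le ha hS0 hS _) (profile_pos q).le
  · filter_upwards [ae_fst_ne 0] with q hq
    refine Tendsto.mul_const _ ?_
    have hp : Tendsto (fun n => (c, t) + d n • q) atTop (𝓝 (c, t)) := by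
      simpa using (hd.smul_const q).const_add (c, t)
    have hsq : ∀ᶠ n in atTop, (c, t) + d n • q ∈ square c r := by
      have h1 : IsOpen {p : ℝ × ℝ | |p.1 - c| < r} := isOpen_lt (by fun_prop) continuous_const
      have h2 : IsOpen {p : ℝ × ℝ | |p.2| < r} := isOpen_lt (by fun_prop) continuous_const
      exact hp.eventually ((h1.inter h2).mem_nhds hpt)
    have hfst : ∀ n, σ * (((c, t) + d n • q : ℝ × ℝ).1 - c) = d n * (σ * q.1) := fun n => by
      simp; ring
    by_cases hσq : q ∈ {q : ℝ × ℝ | 0 < σ * q.1}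
    · rw [indicator_of_mem hσq]
      have hmemU : ∀ᶠ n in atTop, (c, t) + d n • q ∈ U := by
        filter_upwards [hsq] with n hn
        refine (hU.mem_iff _ hn.1 hn.2).2 ?_
        rw [hfst]
        exact mul_pos (hd0 n) hσq
      have hw : Tendsto (fun n => (c, t) + d n • q) atTop
          (𝓝[{p | p ∈ square c r ∧ 0 ≤ σ * (p.1 - c)}] (c, t)) := by
        refine tendsto_nhdsWithin_iff.2 ⟨hp, ?_⟩
        filter_upwards [hsq] with n hn
        refine ⟨hn, ?_⟩
        rw [hfst]
        exact (mul_pos (hd0 n) hσq).le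
      have hu' := (hcont (c, t) ⟨hpt, by simp⟩).tendsto.comp hw
      have ha' := ((Complex.continuous_ofReal.comp (continuous_cutoff_prod ha c)).tendsto
        (c, t)).comp hp
      -- The pole lies where both cutoffs equal 1, since |t| ≤ ρ/2.
      have hone : ((a (((c, t) : ℝ × ℝ).1 - c) * a ((c, t) : ℝ × ℝ).2 : ℝ) : ℂ) = 1 := by
        simp [ha.eq_one 0 (by simpa using hρ0.le), ha.eq_one t (by linarith)]
      have := hu'.mul ha'
      simp only [Function.comp_apply] at this
      rw [hone, mul_one] at this
      refine this.congr' ?_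
      filter_upwards [hmemU] with n hn
      rw [localized, indicator_of_mem hn]
    · rw [indicator_of_notMem hσq]
      refine tendsto_const_nhds.congr' ?_
      filter_upwards [hsq] with n hn
      rw [localized, indicator_of_notMem]
      intro hmem
      have := (hU.mem_iff _ hn.1 hn.2).1 hmem
      rw [hfst] at this
      exact hσq (pos_of_mul_pos_right this (hd0 n).le)

/-! ### The Lipschitz bound on a flat boundary segment -/

/-- A Neumann eigenfunction is Lipschitz along a flat part of the boundary. -/
theorem exists_lipschitz_boundary {σ r : ℝ} (hUm : MeasurableSet U) (hUf : volume U ≠ ⊤)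
    (hU : IsHalfPlaneNear U c σ r) (hu : IsNeumannEigenfunction U E u)
    (hcont : ContinuousOn u {p | p ∈ square c r ∧ 0 ≤ σ * (p.1 - c)}) :
    ∃ R M : ℝ, 0 < R ∧ 0 ≤ M ∧ ∀ t s : ℝ, |t| ≤ R → |s| ≤ R →
      ‖u (c, t) - u (c, s)‖ ≤ M * |t - s| := by
  have hr := hU.pos
  set ρ := r / 3 with hρ
  obtain ⟨a, ha⟩ := exists_isCutoff (ρ := ρ) (by positivity)
  have hρr : 2 * ρ < r := by rw [hρ]; linarith
  have hρ0 := ha.pos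
  have hQ : IsCompact (closedSquare c (2 * ρ) ∩ {p | 0 ≤ σ * (p.1 - c)}) :=
    (isCompact_Icc.prod isCompact_Icc).inter_right (isClosed_le continuous_const (by fun_prop))
  have hQsub : closedSquare c (2 * ρ) ∩ {p | 0 ≤ σ * (p.1 - c)}
      ⊆ {p | p ∈ square c r ∧ 0 ≤ σ * (p.1 - c)} := by
    rintro p ⟨h1, h2⟩
    rw [mem_closedSquare_iff] at h1
    exact ⟨⟨by linarith [h1.1], by linarith [h1.2]⟩, h2⟩
  obtain ⟨S, hS⟩ := hQ.exists_bound_of_continuousOn (hcont.mono hQsub)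
  have hS0 : 0 ≤ S := (norm_nonneg _).trans (hS (c, 0) ⟨by
    rw [mem_closedSquare_iff]; simp [hρ0.le], by simp⟩)
  have hS' : ∀ p ∈ U, p ∈ closedSquare c (2 * ρ) → ‖u p‖ ≤ S := by
    intro p hp hpQ
    refine hS p ⟨hpQ, ?_⟩
    rw [mem_closedSquare_iff] at hpQ
    exact ((hU.mem_iff p (by linarith [hpQ.1]) (by linarith [hpQ.2])).1 hp).le
  have hfin : IsFiniteMeasure (volume.restrict U) := ⟨by simpa using hUf.lt_top⟩
  have hui : IntegrableOn u U := by
    obtain ⟨-, g₁, g₂, hgrad, -⟩ := hu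
    exact hgrad.memLp.integrable (by norm_num)
  obtain ⟨C, hC⟩ := exists_norm_integral_remainder_sub_le (c := c) hUm ha E hS0 hS'
  have hκ := halfMass_pos hU.ne_zero
  set d : ℕ → ℝ := fun n => 1 / ((n : ℝ) + 1) with hd
  have hd0 : ∀ n, 0 < d n := fun n => by simp only [hd]; positivity
  have hdl : Tendsto d atTop (𝓝 0) := tendsto_one_div_add_atTop_nhds_zero_nat
  have hint : ∀ w : ℝ × ℝ → ℝ, Continuous w → HasCompactSupport w →
      IntegrableOn (fun p => u p * (w p : ℂ)) U := by
    intro w hw hwc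
    obtain ⟨W, hW⟩ := hw.bounded_above_of_compact_support hwc
    refine Integrable.mul_bdd (c := W) hui
      (Complex.continuous_ofReal.comp hw).aestronglyMeasurable ?_
    exact Eventually.of_forall fun p => by rw [Complex.norm_real]; exact hW p
  have hsupp : ∀ w : ℝ × ℝ → ℝ, (∀ p, 2 * ρ < |p.1 - c| ∨ 2 * ρ < |p.2| → w p = 0) →
      HasCompactSupport w := by
    intro w hw
    refine HasCompactSupport.intro (isCompact_Icc.prod isCompact_Icc :
      IsCompact (closedSquare c (2 * ρ))) fun p hp => hw p ?_
    have hp' : p ∉ closedSquare c (2 * ρ) := hp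
    rwa [mem_closedSquare_iff, not_and_or, not_le, not_le] at hp'
  set N : ℝ → ℝ → ℂ := fun δ t => ∫ p in U,
    u p * ((a (p.1 - c) * a p.2 * (4 * δ ^ 2 / distSq c t δ p ^ 2) : ℝ) : ℂ) with hN
  -- The tested equation exchanges the concentrating part N for the remainder: the first recovers
  -- boundary values as δ → 0, the second is Lipschitz in t uniformly in δ.
  have hNrem : ∀ δ t, 0 < δ → N δ t = -∫ p in U, u p * (remainder a E c t δ p : ℂ) := by
    intro δ t hδ
    have h0 := integral_logPotential_eq hUm hUf hU hu ha hρr hδ t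
    have hc1 : Continuous fun p : ℝ × ℝ =>
        a (p.1 - c) * a p.2 * (4 * δ ^ 2 / distSq c t δ p ^ 2) :=
      (continuous_cutoff_prod ha c).mul (continuous_const.div
        ((contDiff_distSq c t δ).continuous.pow 2) fun p => (pow_pos (distSq_pos hδ c t p) 2).ne')
    have i1 := hint _ hc1 (hsupp _ fun p hp => by
      rcases hp with h | h <;> simp [ha.eq_zero _ h.le])
    have i2 := hint _ (continuous_remainder ha hδ E c t) (hsupp _ fun p hp => remainder_eq_zero ha hp)
    rw [eq_neg_iff_add_eq_zero, hN, ← h0]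
    simp only
    rw [← integral_add i1 i2]
    congr 1
    funext p
    push_cast
    ring
  have hNdiff : ∀ δ t s, 0 < δ → |t| ≤ ρ / 2 → |s| ≤ ρ / 2 → ‖N δ t - N δ s‖ ≤ C * |t - s| := by
    intro δ t s hδ ht hs
    have i : ∀ τ, IntegrableOn (fun p => u p * (remainder a E c τ δ p : ℂ)) U := fun τ =>
      hint _ (continuous_remainder ha hδ E c τ) (hsupp _ fun p hp => remainder_eq_zero ha hp)
    have h := hC δ t s hδ ht hs
    have e : ∫ p in U, u p * ((remainder a E c t δ p - remainder a E c s δ p : ℝ) : ℂ)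
        = -(N δ t - N δ s) := by
      rw [hNrem δ t hδ, hNrem δ s hδ, neg_sub_neg, neg_sub, ← integral_sub (i t) (i s)]
      congr 1
      funext p
      push_cast
      ring
    rwa [e, norm_neg] at h
  have hlim : ∀ t, |t| ≤ ρ / 2 →
      Tendsto (fun n => N (d n) t) atTop (𝓝 ((halfMass σ : ℂ) * u (c, t))) := fun t ht =>
    tendsto_integral_profile hUm hU hui ha hρr hS0 hS' hcont ht hd0 hdl
  -- The limit δ → 0 bounds halfMass · |u(c, t) - u(c, s)|; the absolute value |C| only secures a
  -- nonnegative constant.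
  refine ⟨ρ / 2, |C| / halfMass σ, by positivity, by positivity, fun t s ht hs => ?_⟩
  have hle : ‖(halfMass σ : ℂ) * u (c, t) - (halfMass σ : ℂ) * u (c, s)‖ ≤ C * |t - s| :=
    le_of_tendsto ((hlim t ht).sub (hlim s hs)).norm
      (Eventually.of_forall fun n => hNdiff (d n) t s (hd0 n) ht hs)
  rw [← mul_sub, norm_mul, Complex.norm_real, Real.norm_of_nonneg hκ.le] at hle
  rw [div_mul_eq_mul_div, le_div_iff₀ hκ, mul_comm]
  refine hle.trans ?_
  gcongr
  exact le_abs_self C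

/-! ### The windows of the waveguide and the conclusion -/

lemma isOpen_openCell {Ω : Set (ℝ × ℝ)} (hΩ : IsOpen Ω) : IsOpen (openCell Ω) :=
  hΩ.inter (isOpen_Ioo.prod isOpen_univ)

lemma IsWaveguide.volume_openCell_ne_top {Ω : Set (ℝ × ℝ)} (hΩ : IsWaveguide Ω) :
    volume (openCell Ω) ≠ ⊤ := by
  have h := hΩ.bounded_cell 0
  refine ((h.subset ?_).measure_lt_top).ne
  rintro p ⟨h1, h2, -⟩
  exact ⟨h1, ⟨by simpa using h2.1.le, by simpa using h2.2.le⟩, trivial⟩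

/-- The bound r < 1 keeps the square at one window away from the vertical line through the other, so
that the open cell is exactly a half-plane in it. -/
lemma exists_square_subset {Ω : Set (ℝ × ℝ)} (hΩ : IsOpen Ω) {c : ℝ} (hc : (c, (0 : ℝ)) ∈ Ω) :
    ∃ r, 0 < r ∧ r < 1 ∧ square c r ⊆ Ω := by
  obtain ⟨r, hr, h⟩ := Metric.isOpen_iff.1 hΩ _ hc
  refine ⟨min r (1 / 2), by positivity, (min_le_right _ _).trans_lt (by norm_num), ?_⟩
  rintro p ⟨h1, h2⟩
  refine h ?_
  rw [Metric.mem_ball, Prod.dist_eq, Real.dist_eq, Real.dist_eq, sub_zero]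
  exact max_lt (h1.trans_le (min_le_left _ _)) (h2.trans_le (min_le_left _ _))

lemma IsWaveguide.exists_lipschitz_left {Ω : Set (ℝ × ℝ)} (hΩ : IsWaveguide Ω) {E : ℝ}
    {u : ℝ × ℝ → ℂ} (hu : IsNeumannEigenfunction (openCell Ω) E u)
    (hcont : ContinuousOn u (cell Ω)) :
    ∃ R M : ℝ, 0 < R ∧ 0 ≤ M ∧ ∀ t s : ℝ, |t| ≤ R → |s| ≤ R →
      ‖u (0, t) - u (0, s)‖ ≤ M * |t - s| := by
  obtain ⟨r, hr, hr1, hsub⟩ := exists_square_subset hΩ.isOpen (by simpa using hΩ.window_mem 0)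
  refine exists_lipschitz_boundary (σ := 1) (r := r) (isOpen_openCell hΩ.isOpen).measurableSet
    hΩ.volume_openCell_ne_top ⟨hr, one_ne_zero, fun p h1 h2 => ?_⟩ hu (hcont.mono ?_)
  · have hp := abs_lt.1 h1
    refine ⟨fun h => by linarith [h.2.1.1], fun h => ⟨hsub ⟨h1, h2⟩, ⟨?_, ?_⟩, trivial⟩⟩ <;>
      linarith
  · rintro p ⟨hp, h⟩
    have hp' := abs_lt.1 hp.1
    exact ⟨hsub hp, ⟨by linarith, by linarith⟩, trivial⟩

lemma IsWaveguide.exists_lipschitz_right {Ω : Set (ℝ × ℝ)} (hΩ : IsWaveguide Ω) {E : ℝ}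
    {u : ℝ × ℝ → ℂ} (hu : IsNeumannEigenfunction (openCell Ω) E u)
    (hcont : ContinuousOn u (cell Ω)) :
    ∃ R M : ℝ, 0 < R ∧ 0 ≤ M ∧ ∀ t s : ℝ, |t| ≤ R → |s| ≤ R →
      ‖u (1, t) - u (1, s)‖ ≤ M * |t - s| := by
  obtain ⟨r, hr, hr1, hsub⟩ := exists_square_subset hΩ.isOpen (by simpa using hΩ.window_mem 1)
  refine exists_lipschitz_boundary (σ := -1) (r := r) (isOpen_openCell hΩ.isOpen).measurableSet
    hΩ.volume_openCell_ne_top ⟨hr, by norm_num, fun p h1 h2 => ?_⟩ hu (hcont.mono ?_)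
  · have hp := abs_lt.1 h1
    refine ⟨fun h => by linarith [h.2.1.2], fun h => ⟨hsub ⟨h1, h2⟩, ⟨?_, ?_⟩, trivial⟩⟩ <;>
      linarith
  · rintro p ⟨hp, h⟩
    have hp' := abs_lt.1 hp.1
    exact ⟨hsub hp, ⟨by linarith, by linarith⟩, trivial⟩

/-- The phase has modulus one, which makes all later bounds uniform in θ. -/
lemma norm_uTheta_le (u : ℝ × ℝ → ℂ) (θ y : ℝ) :
    ‖uTheta u θ y‖ ≤ ‖u (0, y)‖ + ‖u (1, y)‖ := by
  refine (norm_sub_le _ _).trans_eq ?_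
  rw [norm_mul, mul_comm Complex.I, Complex.norm_exp_ofReal_mul_I, one_mul]

lemma norm_uTheta_sub_le (u : ℝ × ℝ → ℂ) (θ x y : ℝ) :
    ‖uTheta u θ x - uTheta u θ y‖ ≤ ‖u (0, x) - u (0, y)‖ + ‖u (1, x) - u (1, y)‖ := by
  have h : uTheta u θ x - uTheta u θ y
      = uTheta (fun p => u (p.1, x) - u (p.1, y)) θ 0 := by
    simp only [uTheta]; ring
  rw [h]
  exact norm_uTheta_le _ θ 0

end CrackedWaveguide

end

open CrackedWaveguide in
theorem proposition2 (Ω : Set (ℝ × ℝ)) (hΩ : IsWaveguide Ω) (E : ℝ) (u : ℝ × ℝ → ℂ)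
    (hu : IsNeumannEigenfunction (openCell Ω) E u) (hcont : ContinuousOn u (cell Ω)) :
    ∃ ε₀ C A : ℝ, 0 < ε₀ ∧ ε₀ < 1 ∧ 0 < C ∧ 0 < A ∧ ∀ ε : ℝ, 0 < ε → ε < ε₀ →
      Set.BijOn (L ε) Set.univ (Y ε) ∧
      ∀ θ : ℝ,
        uThetaRestrict u θ ε ∈ Y ε ∧
        ‖pairing ε (Linv ε (uThetaRestrict u θ ε)) (uTheta u θ)
            - ((‖uTheta u θ 0‖ ^ 2 / Real.log ε : ℝ) : ℂ)‖ ≤ C / |Real.log ε| ^ 2 ∧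
        ∀ B : X ε →L[ℂ] X ε,
          ‖pairing ε (B (Linv ε (uThetaRestrict u θ ε))) (uTheta u θ)‖
            ≤ A * ‖B‖ / |Real.log ε| := by
  obtain ⟨R₀, M₀, hR₀, hM₀, h₀⟩ := hΩ.exists_lipschitz_left hu hcont
  obtain ⟨R₁, M₁, hR₁, hM₁, h₁⟩ := hΩ.exists_lipschitz_right hu hcont
  obtain ⟨M, hM⟩ : ∃ M, M = M₀ + M₁ := ⟨_, rfl⟩
  obtain ⟨S, hS⟩ : ∃ S, S = ‖u (0, 0)‖ + ‖u (1, 0)‖ := ⟨_, rfl⟩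
  have hM0 : 0 ≤ M := by rw [hM]; positivity
  have hS0 : 0 ≤ S := by rw [hS]; positivity
  have hlog : 0 ≤ logBound := norm_nonneg _
  have hC : 0 ≤ S ^ 2 + 4 * (2 * S * (M * Real.sqrt Real.pi)
      + (S + M) * Real.sqrt Real.pi * ((2 * logBound + 1) * (4 * M))) := by positivity
  have hA : 0 ≤ (S + M) * Real.sqrt Real.pi * (S + (2 * logBound + 1) * (4 * M)) := by positivity
  -- The radii give the Lipschitz range at both windows, and 1/2 ensures ε₀ < 1. The placeholders
  -- become the nonnegative constants of `estimates_of_lipschitz` plus one, for strict positivity.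
  refine ⟨min (min R₀ R₁) (1 / 2), _, _, by positivity,
    (min_le_right _ _).trans_lt (by norm_num), add_pos_of_nonneg_of_pos hC one_pos,
    add_pos_of_nonneg_of_pos hA one_pos, fun ε hε hε' => ?_⟩
  have hεR₀ : ε ≤ R₀ := hε'.le.trans ((min_le_left _ _).trans (min_le_left _ _))
  have hεR₁ : ε ≤ R₁ := hε'.le.trans ((min_le_left _ _).trans (min_le_right _ _))
  have hε2 : ε < 1 / 2 := hε'.trans_le (min_le_right _ _)
  refine ⟨bijOn_L hε (by linarith), fun θ => ?_⟩
  have hlip : ∀ x ∈ Set.Icc (-ε) ε, ∀ y ∈ Set.Icc (-ε) ε,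
      ‖uTheta u θ x - uTheta u θ y‖ ≤ M * |x - y| := by
    intro x hx y hy
    have hx' := abs_le.2 hx
    have hy' := abs_le.2 hy
    rw [hM, add_mul]
    exact (norm_uTheta_sub_le u θ x y).trans (add_le_add
      (h₀ x y (hx'.trans hεR₀) (hy'.trans hεR₀)) (h₁ x y (hx'.trans hεR₁) (hy'.trans hεR₁)))
  obtain ⟨hY, hlead, hB⟩ := estimates_of_lipschitz hε (by linarith) hM0 hlip
    ((norm_uTheta_le u θ 0).trans_eq hS.symm)
  refine ⟨hY, hlead.trans ?_, fun B => (hB B).trans ?_⟩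
  · exact div_le_div_of_nonneg_right (le_add_of_nonneg_right zero_le_one) (by positivity)
  · gcongr
    exact le_add_of_nonneg_right zero_le_one
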